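/- Let $p$ be a prime. Let $G$ be a pro-$p$ group of finite $p$-rank $d=\dim_{\mathbb F_p}H^1(G,\mathbb F_p)$, let $F$ be a free pro-$p$ group on $x_1,\dots,x_d$, and let $1\to R\to F\xrightarrow{\pi} G\to 1$ be a (minimal) presentation of $G$. For a pro-$p$ group $H$ write $\Lambda_H=\mathbb F_p[[H]]=\varprojlim_U \mathbb F_p[H/U]$ for the completed group algebra, and let $R^p[R,R]$ denote the closed subgroup of $R$ generated by $p$-th powers and commutators; $R/R^p[R,R]$ is a compact $\Lambda_G$-module, $G$ acting by conjugation. Let $E=\mathbb F_p^{nc}[[X_1,\dots,X_d]]$ be the algebra of noncommutative power series, let $\omega(Z)$ be the least degree of a monomial occurring in $Z\in E$ (with $\omega(0)=\infty$), put $E_n=\{Z\in E:\omega(Z)\ge n\}$, and let $\varphi:\Lambda_F\to E$ be the Magnus isomorphism, $x_i\mapsto 1+X_i$. Order monomials by: $X_\alpha>X_\beta$ if $\deg X_\alpha<\deg X_\beta$, or if the degrees are equal and $\alpha$ is larger than $\beta$ in the lexicographic order with $X_1<\dots<X_d$. For $1\ne y\in F$ let $\deg(y)=\omega(\varphi(y-1))$,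 and let the highest term $\widehat y$ be the largest monomial occurring in $\varphi(y-1)$. A family $(m_i)_{i\in I}$ of monomials is combinatorially free if (i) for $i\neq j$, $m_i$ is not a submonomial (a factor of consecutive letters) of $m_j$, and (ii) for all $i,j\in I$, including $i=j$, whenever $m_i=uv$ and $m_j=u'v'$ with $u,v,u',v'$ monomials different from $1$, one has $u\neq v'$. Let $(\rho_i)_{i\in I}$ be a family of elements $\neq1$ of $R$, with $I$ possibly infinite, whose classes topologically generate the $\Lambda_G$-module $R/R^p[R,R]$. If the family $(\widehat{\rho_i})_{i\in I}$ is combinatorially free, then: (i) $R/R^p[R,R]\simeq\prod_{i\in I}\Lambda_G$ as topological $\Lambda_G$-modules, and $\mathrm{cd}(G)\le 2$, that is, $H^n(G,\mathbb F_p)=0$ for all $n\geq 3$; (ii) with $n_i=\deg(\rho_i)$, only finitely many $n_i$ take any given value, and $$P_G(t):=\sum_{n\ge0}\dim_{\mathbb F_p}(E_{G,n}/E_{G,n+1})\,t^n=\Big(1-dt+\sum_{i\in I}t^{n_i}\Big)^{-1}$$ in $\mathbb Z[[t]]$, where $E_{G,n}\subseteq\Lambda_G$ is the image of $\varphi^{-1}(E_n)$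 under the map $\Lambda_F\to\Lambda_G$ induced by $\pi$, and all the dimensions are finite. -/

import Mathlib

noncomputable section

/-! ### Noncommutative formal power series over `𝔽_p` -/

/-- The Magnus algebra `E = 𝔽_p^{nc}⟦X_1, …, X_d⟧`. The word `[α_1, …, α_n]` stands for the
monomial `X_{α_1} ⋯ X_{α_n}`, and a series is the function giving its coefficients. -/
def MagnusAlgebra (p d : ℕ) : Type := List (Fin d) → ZMod p

namespace MagnusAlgebra

variable {p d : ℕ}

instance : AddCommGroup (MagnusAlgebra p d) := inferInstanceAs (AddCommGroup (_ → ZMod p))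

instance : Module (ZMod p) (MagnusAlgebra p d) := inferInstanceAs (Module (ZMod p) (_ → ZMod p))

/-- The topology of coefficientwise convergence, `𝔽_p` being discrete. -/
instance : TopologicalSpace (MagnusAlgebra p d) := inferInstanceAs (TopologicalSpace (_ → ZMod p))

@[ext] theorem ext {a b : MagnusAlgebra p d} (h : ∀ w, a w = b w) : a = b := funext h

@[simp] theorem add_apply (a b : MagnusAlgebra p d) (w) : (a + b) w = a w + b w := rfl
@[simp] theorem sub_apply (a b : MagnusAlgebra p d) (w) : (a - b) w = a w - b w := rfl
@[simp] theorem neg_apply (a : MagnusAlgebra p d) (w) : (-a) w = -a w := rfl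
@[simp] theorem zero_apply (w) : (0 : MagnusAlgebra p d) w = 0 := rfl
@[simp] theorem smul_apply (r : ZMod p) (a : MagnusAlgebra p d) (w) : (r • a) w = r * a w := rfl

/-- The monomial `X_w` attached to a word `w`. -/
def monomial (w : List (Fin d)) : MagnusAlgebra p d := fun v => if v = w then 1 else 0

/-- The variable `X_i`. -/
def X (i : Fin d) : MagnusAlgebra p d := monomial [i]

instance : One (MagnusAlgebra p d) := ⟨monomial []⟩

/-- The product of series: the coefficient at `w` is the sum of `a_u b_v` over all the
factorizations `w = u v`. -/
instance : Mul (MagnusAlgebra p d) :=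
  ⟨fun a b w => ∑ k ∈ Finset.range (w.length + 1), a (w.take k) * b (w.drop k)⟩

theorem one_apply (w : List (Fin d)) : (1 : MagnusAlgebra p d) w = if w = [] then 1 else 0 := rfl

theorem mul_apply (a b : MagnusAlgebra p d) (w) :
    (a * b) w = ∑ k ∈ Finset.range (w.length + 1), a (w.take k) * b (w.drop k) := rfl

protected theorem mul_assoc (a b c : MagnusAlgebra p d) : a * b * c = a * (b * c) := by
  ext w
  simp only [mul_apply, Finset.sum_mul, Finset.mul_sum]
  rw [Finset.sum_sigma', Finset.sum_sigma']
  refine Finset.sum_bij' (fun s _ => ⟨s.2, s.1 - s.2⟩) (fun s _ => ⟨s.1 + s.2, s.1⟩) ?_ ?_ ?_ ?_ ?_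
  · rintro ⟨i, j⟩ h
    simp at h ⊢; omega
  · rintro ⟨i, j⟩ h
    simp at h ⊢; omega
  · rintro ⟨i, j⟩ h
    simp at h ⊢; omega
  · rintro ⟨i, j⟩ h
    simp at h ⊢
  · rintro ⟨i, j⟩ h
    simp at h
    simp only [List.take_take, List.drop_drop, List.drop_take]
    rw [min_eq_left (by omega), Nat.add_sub_cancel' (by omega), mul_assoc]

protected theorem one_mul (a : MagnusAlgebra p d) : 1 * a = a := by
  ext w
  rw [mul_apply, Finset.sum_eq_single 0]
  · simp [one_apply]
  · intro k hk h0
    have : w.take k ≠ [] := by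
      intro h; simp at h hk; rcases h with h | h
      · exact h0 h
      · subst h; simp at hk; exact h0 hk
    simp [one_apply, this]
  · simp

protected theorem mul_one (a : MagnusAlgebra p d) : a * 1 = a := by
  ext w
  rw [mul_apply, Finset.sum_eq_single w.length]
  · simp [one_apply]
  · intro k hk h0
    have : w.drop k ≠ [] := by
      intro h; simp at h hk; omega
    simp [one_apply, this]
  · simp

instance : Ring (MagnusAlgebra p d) where
  __ := (inferInstance : AddCommGroup (MagnusAlgebra p d))
  mul_assoc := MagnusAlgebra.mul_assoc
  one_mul := MagnusAlgebra.one_mul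
  mul_one := MagnusAlgebra.mul_one
  left_distrib a b c := by ext w; simp [mul_apply, mul_add, Finset.sum_add_distrib]
  right_distrib a b c := by ext w; simp [mul_apply, add_mul, Finset.sum_add_distrib]
  zero_mul a := by ext w; simp [mul_apply]
  mul_zero a := by ext w; simp [mul_apply]

instance : Algebra (ZMod p) (MagnusAlgebra p d) :=
  Algebra.ofModule
    (fun r a b => by ext w; simp [mul_apply, Finset.mul_sum, mul_assoc])
    (fun r a b => by ext w; simp [mul_apply, Finset.mul_sum, mul_left_comm])

/-- The valuation `ω(Z)`: the least degree of a monomial occurring in `Z`, with `ω(0) = ∞`. -/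
def valuation (Z : MagnusAlgebra p d) : ℕ∞ := ⨅ (w : List (Fin d)) (_ : Z w ≠ 0), (w.length : ℕ∞)

theorem le_valuation_iff {Z : MagnusAlgebra p d} {n : ℕ} :
    (n : ℕ∞) ≤ Z.valuation ↔ ∀ w, w.length < n → Z w = 0 := by
  simp only [valuation, le_iInf_iff, Nat.cast_le]
  exact forall_congr' fun w => ⟨fun h hw => by by_contra h0; exact absurd (h h0) (by omega),
    fun h h0 => by by_contra hw; exact h0 (h (by omega))⟩

/-- The filtration `E_n = {Z | ω(Z) ≥ n}`. -/
def filtration (p d n : ℕ) : Submodule (ZMod p) (MagnusAlgebra p d) where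
  carrier := {Z | (n : ℕ∞) ≤ Z.valuation}
  add_mem' {a b} ha hb := by
    simp only [Set.mem_ofPred_eq, le_valuation_iff] at *
    intro w hw; simp [ha w hw, hb w hw]
  zero_mem' := by simp [le_valuation_iff]
  smul_mem' r a ha := by
    simp only [Set.mem_ofPred_eq, le_valuation_iff] at *
    intro w hw; simp [ha w hw]

/-- The total order on monomials: `X_v ≤ X_w` if `X_v` has larger degree than `X_w`, or if both
have the same degree and `v` is at most `w` lexicographically, where `X_1 < ⋯ < X_d`. -/
def MonomialLE (v w : List (Fin d)) : Prop :=
  w.length < v.length ∨ (v.length = w.length ∧ v ≤ w)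

/-- `X_w` is the highest term of `Z`. -/
def IsHighestTerm (Z : MagnusAlgebra p d) (w : List (Fin d)) : Prop :=
  Z w ≠ 0 ∧ ∀ v, Z v ≠ 0 → MonomialLE v w

/-! The finite quotient algebras `E / E_n`. -/

/-- Congruence modulo `E_n`. -/
def truncCon (p d n : ℕ) : RingCon (MagnusAlgebra p d) where
  r a b := ∀ w, w.length < n → a w = b w
  iseqv := ⟨fun _ _ _ => rfl, fun h w hw => (h w hw).symm,
    fun h h' w hw => (h w hw).trans (h' w hw)⟩
  add' h h' w hw := by simp [h w hw, h' w hw]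
  mul' h h' w hw := by
    simp only [mul_apply]
    refine Finset.sum_congr rfl fun k _ => ?_
    rw [h _ (by simp; omega), h' _ (by simp; omega)]

/-- The quotient algebra `E / E_n`. -/
abbrev Trunc (p d n : ℕ) : Type := (truncCon p d n).Quotient

/-- The projection `E → E / E_n`. -/
def toTrunc (p d n : ℕ) : MagnusAlgebra p d →+* Trunc p d n := (truncCon p d n).mk'

theorem toTrunc_eq_iff {n : ℕ} {a b : MagnusAlgebra p d} :
    toTrunc p d n a = toTrunc p d n b ↔ ∀ w, w.length < n → a w = b w :=
  (truncCon p d n).eq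

theorem toTrunc_surjective (n : ℕ) : Function.Surjective (toTrunc p d n) :=
  (truncCon p d n).mk'_surjective

/-- The coefficient of a word of length `< n`, on `E / E_n`. -/
def truncCoeff (n : ℕ) (w : List (Fin d)) (hw : w.length < n) : Trunc p d n →ₗ[ZMod p] ZMod p where
  toFun q := Quotient.liftOn q (fun a => a w) fun _ _ h => h w hw
  map_add' a b := by
    obtain ⟨a, rfl⟩ := toTrunc_surjective n a
    obtain ⟨b, rfl⟩ := toTrunc_surjective n b
    rfl
  map_smul' r a := by
    obtain ⟨a, rfl⟩ := toTrunc_surjective n a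
    rfl

@[simp] theorem truncCoeff_toTrunc (n : ℕ) (w : List (Fin d)) (hw : w.length < n)
    (a : MagnusAlgebra p d) : truncCoeff n w hw (toTrunc p d n a) = a w := rfl

instance [Fact p.Prime] (n : ℕ) : Finite (Trunc p d n) := by
  have : Finite {w : List (Fin d) // w.length < n} := List.finite_length_lt (Fin d) n
  refine Finite.of_injective
    (fun q : Trunc p d n => fun w : {w : List (Fin d) // w.length < n} => truncCoeff n w.1 w.2 q) ?_
  intro a b h
  obtain ⟨a, rfl⟩ := toTrunc_surjective n a
  obtain ⟨b, rfl⟩ := toTrunc_surjective n b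
  exact toTrunc_eq_iff.2 fun w hw => congrFun h ⟨w, hw⟩

theorem pow_apply_eq_zero {y : MagnusAlgebra p d} (hy : y [] = 0) (m : ℕ) :
    ∀ w : List (Fin d), w.length < m → (y ^ m) w = 0 := by
  induction m with
  | zero => simp
  | succ m ih =>
    intro w hw
    rw [pow_succ, mul_apply]
    refine Finset.sum_eq_zero fun k hk => ?_
    simp at hk
    by_cases h : (w.take k).length < m
    · rw [ih _ h, zero_mul]
    · have : w.drop k = [] := by simp at h ⊢; omega
      rw [this, hy, mul_zero]

theorem mul_nil (a b : MagnusAlgebra p d) : (a * b) [] = a [] * b [] := by simp [mul_apply]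

theorem pow_nil {a : MagnusAlgebra p d} (ha : a [] = 1) (m : ℕ) : (a ^ m) [] = 1 := by
  induction m with
  | zero => simp [one_apply]
  | succ m ih => rw [pow_succ, mul_nil, ih, ha, one_mul]

variable [hp : Fact p.Prime]

instance : CharP (MagnusAlgebra p d) p := by
  have : Nontrivial (MagnusAlgebra p d) :=
    ⟨1, 0, fun h => by simpa [one_apply] using congrFun h []⟩
  exact charP_of_injective_algebraMap (algebraMap (ZMod p) (MagnusAlgebra p d)).injective p

theorem toTrunc_pow_eq_one {a : MagnusAlgebra p d} (ha : a [] = 1) (n : ℕ) :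
    toTrunc p d n a ^ p ^ n = 1 := by
  have h : a ^ p ^ n = 1 + (a - 1) ^ p ^ n := by
    conv_lhs => rw [← add_sub_cancel 1 a]
    rw [add_pow_char_pow_of_commute p n (Commute.one_left _), one_pow]
  rw [← map_pow, ← map_one (toTrunc p d n), toTrunc_eq_iff, h]
  intro w hw
  rw [add_apply, pow_apply_eq_zero (by simp [ha, one_apply]) (p ^ n) w
    (hw.trans (Nat.lt_pow_self hp.out.one_lt)), add_zero]

/-- The group of units of `E / E_n` with constant coefficient `1`. -/
def oneUnits (p d n : ℕ) [hp : Fact p.Prime] : Subgroup (Trunc p d n)ˣ where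
  carrier := {u | ∃ a : MagnusAlgebra p d, a [] = 1 ∧ toTrunc p d n a = u}
  mul_mem' := by
    rintro u v ⟨a, ha, hu⟩ ⟨b, hb, hv⟩
    exact ⟨a * b, by rw [mul_nil, ha, hb, one_mul], by rw [map_mul, hu, hv, Units.val_mul]⟩
  one_mem' := ⟨1, by simp [one_apply], by simp⟩
  inv_mem' := by
    rintro u ⟨a, ha, hu⟩
    refine ⟨a ^ (p ^ n - 1), pow_nil ha _, ?_⟩
    have h1 : u ^ p ^ n = 1 := by
      ext; rw [Units.val_pow_eq_pow_val, ← hu, toTrunc_pow_eq_one ha, Units.val_one]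
    have h2 : u⁻¹ = u ^ (p ^ n - 1) := by
      rw [inv_eq_iff_mul_eq_one, ← pow_succ', Nat.sub_add_cancel (pow_pos hp.out.pos n), h1]
    rw [h2, map_pow, hu, Units.val_pow_eq_pow_val]

instance (n : ℕ) : Finite (oneUnits p d n) :=
  Finite.of_injective (fun u : oneUnits p d n => (u.1 : Trunc p d n))
    fun _ _ h => Subtype.ext (Units.ext h)

theorem isPGroup_oneUnits (n : ℕ) : IsPGroup p (oneUnits p d n) := by
  rintro ⟨u, a, ha, hu⟩
  refine ⟨n, Subtype.ext (Units.ext ?_)⟩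
  simp [← hu, toTrunc_pow_eq_one ha]

theorem exists_oneUnit {a : MagnusAlgebra p d} (ha : a [] = 1) (n : ℕ) :
    ∃ u : oneUnits p d n, (u.1 : Trunc p d n) = toTrunc p d n a :=
  ⟨⟨Units.ofPowEqOne _ _ (toTrunc_pow_eq_one ha n) (pow_pos hp.out.pos n).ne', a, ha, rfl⟩, rfl⟩

theorem exists_oneUnits_map {n m : ℕ} (h : n ≤ m) :
    ∃ f : oneUnits p d m →* oneUnits p d n, ∀ (u : oneUnits p d m) (a : MagnusAlgebra p d),
      toTrunc p d m a = (u.1 : Trunc p d m) → toTrunc p d n a = ((f u).1 : Trunc p d n) := by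
  have key : ∀ a b, truncCon p d m a b → toTrunc p d n a = toTrunc p d n b :=
    fun a b hab => toTrunc_eq_iff.2 fun w hw => hab w (hw.trans_le h)
  let g : Trunc p d m →+* Trunc p d n := (truncCon p d m).lift (toTrunc p d n) key
  have hg : ∀ a, g (toTrunc p d m a) = toTrunc p d n a := fun a => rfl
  refine ⟨((Units.map (g : Trunc p d m →* Trunc p d n)).comp (oneUnits p d m).subtype).codRestrict
    (oneUnits p d n) ?_, ?_⟩
  · rintro ⟨u, a, ha, hu⟩
    exact ⟨a, ha, by simp [← hu, hg]⟩
  · intro u a hu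
    simp [← hu, hg]

end MagnusAlgebra

/-! ### Pro-`p` groups and free pro-`p` groups -/

/-- `G` is a pro-`p` group: a profinite group all of whose finite continuous quotients are
`p`-groups. -/
structure IsProP (p : ℕ) (G : Type*) [Group G] [TopologicalSpace G] [IsTopologicalGroup G] :
    Prop where
  compactSpace : CompactSpace G
  t2Space : T2Space G
  totallyDisconnectedSpace : TotallyDisconnectedSpace G
  isPGroup_quotient : ∀ U : OpenNormalSubgroup G, IsPGroup p (G ⧸ U.toSubgroup)

/-- `F` is the free pro-`p` group on `x_1, …, x_d`: it is pro-`p` and every map from the `x_i` to a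
finite `p`-group (with the discrete topology) extends uniquely to a continuous homomorphism on `F`.
Passing to inverse limits, the same universal property holds with respect to all pro-`p` groups. -/
structure IsFreeProP (p : ℕ) {d : ℕ} {F : Type*} [Group F] [TopologicalSpace F]
    [IsTopologicalGroup F] (x : Fin d → F) : Prop extends IsProP p F where
  existsUnique_hom : ∀ (H : Type) [Group H] [Finite H] [TopologicalSpace H] [DiscreteTopology H],
    IsPGroup p H → ∀ f : Fin d → H, ∃! φ : F →ₜ* H, ∀ i, φ (x i) = f i

namespace IsFreeProP

open MagnusAlgebra

variable {p d : ℕ} [Fact p.Prime] {F : Type*} [Group F] [TopologicalSpace F]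
  [IsTopologicalGroup F] {x : Fin d → F}

/-- Existence of the Magnus homomorphism `F → E`, `x_i ↦ 1 + X_i`. -/
theorem exists_magnus (hF : IsFreeProP p x) :
    ∃ μ : F →* MagnusAlgebra p d, Continuous μ ∧ ∀ i, μ (x i) = 1 + X i := by
  have hX : ∀ i, (1 + X i : MagnusAlgebra p d) [] = 1 := by
    intro i; simp [one_apply, X, monomial]
  choose e he using fun (n : ℕ) (i : Fin d) => exists_oneUnit (p := p) (hX i) n
  let _ (n : ℕ) : TopologicalSpace (oneUnits p d n) := ⊥
  have (n : ℕ) : DiscreteTopology (oneUnits p d n) := ⟨rfl⟩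
  choose f hf using fun n => (hF.existsUnique_hom (oneUnits p d n) (isPGroup_oneUnits n) (e n)).exists
  have hcompat : ∀ {n m : ℕ} (_ : n ≤ m) (y : F) (a : MagnusAlgebra p d),
      toTrunc p d m a = ((f m y).1 : Trunc p d m) → toTrunc p d n a = ((f n y).1 : Trunc p d n) := by
    intro n m h y a ha
    obtain ⟨g, hg⟩ := exists_oneUnits_map (p := p) (d := d) h
    let g' : oneUnits p d m →ₜ* oneUnits p d n := ⟨g, continuous_of_discreteTopology⟩
    have : g'.comp (f m) = f n := by
      refine (hF.existsUnique_hom (oneUnits p d n) (isPGroup_oneUnits n) (e n)).unique ?_ (hf n)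
      intro i
      refine Subtype.ext (Units.ext ?_)
      rw [he n i]
      refine (hg (f m (x i)) (1 + X i) ?_).symm
      rw [hf, he]
    rw [hg _ a ha, ← this]
    rfl
  choose a ha using fun (n : ℕ) (y : F) => toTrunc_surjective n ((f n y).1 : Trunc p d n)
  let m : F → MagnusAlgebra p d := fun y w => a (w.length + 1) y w
  have hm : ∀ n y, toTrunc p d n (m y) = ((f n y).1 : Trunc p d n) := by
    intro n y
    rw [← ha n y, toTrunc_eq_iff]
    intro w hw
    have := hcompat (Nat.succ_le_of_lt hw) y (a n y) (ha n y)
    rw [← ha (w.length + 1) y, toTrunc_eq_iff] at this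
    exact (this w (Nat.lt_succ_self _)).symm
  have hext : ∀ b c : MagnusAlgebra p d, (∀ n, toTrunc p d n b = toTrunc p d n c) → b = c := by
    intro b c h
    ext w
    exact toTrunc_eq_iff.1 (h (w.length + 1)) w (Nat.lt_succ_self _)
  refine ⟨⟨⟨m, ?_⟩, ?_⟩, ?_, ?_⟩
  · refine hext _ _ fun n => ?_
    rw [hm, map_one, map_one]; rfl
  · intro y z
    refine hext _ _ fun n => ?_
    simp only [hm, map_mul]; rfl
  · refine continuous_pi fun w => ?_
    have : (fun y : F => m y w) = (fun u : oneUnits p d (w.length + 1) =>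
        truncCoeff (w.length + 1) w (Nat.lt_succ_self _) (u.1 : Trunc p d (w.length + 1)))
          ∘ f (w.length + 1) := by
      funext y
      simp [← hm]
    change Continuous (fun y : F => m y w)
    rw [this]
    exact continuous_of_discreteTopology.comp (f (w.length + 1)).continuous_toFun
  · intro i
    refine hext _ _ fun n => ?_
    change toTrunc p d n (m (x i)) = _
    rw [hm, hf, he]

/-- The Magnus homomorphism `F → E`: the (unique) continuous multiplicative map with
`x_i ↦ 1 + X_i`. -/
def magnus (hF : IsFreeProP p x) : F →* MagnusAlgebra p d := hF.exists_magnus.choose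

theorem continuous_magnus (hF : IsFreeProP p x) : Continuous hF.magnus :=
  hF.exists_magnus.choose_spec.1

theorem magnus_generator (hF : IsFreeProP p x) (i : Fin d) : hF.magnus (x i) = 1 + X i :=
  hF.exists_magnus.choose_spec.2 i

/-- The degree `deg(y) = ω(φ(y - 1))` of an element `y` of `F`. -/
def degree (hF : IsFreeProP p x) (y : F) : ℕ∞ := (hF.magnus y - 1).valuation

/-- The Magnus homomorphism modulo `E_n`. -/
def magnusTrunc (hF : IsFreeProP p x) (n : ℕ) : F →* Trunc p d n :=
  (toTrunc p d n : MagnusAlgebra p d →* Trunc p d n).comp hF.magnus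

/-- The open normal subgroup `F_n = {y ∈ F | φ(y - 1) ∈ E_n}`, as the kernel of `F → E / E_n`. -/
def zassenhaus (hF : IsFreeProP p x) (n : ℕ) : OpenNormalSubgroup F where
  toSubgroup := (hF.magnusTrunc n).ker
  isOpen' := by
    have : ((hF.magnusTrunc n).ker : Set F) = ⋂ w ∈ {w : List (Fin d) | w.length < n},
        (fun y => hF.magnus y w) ⁻¹' {(1 : MagnusAlgebra p d) w} := by
      ext y
      simp only [SetLike.mem_coe, MonoidHom.mem_ker, magnusTrunc, MonoidHom.coe_comp,
        Function.comp_apply, MonoidHom.coe_coe, Set.mem_iInter, Set.mem_preimage,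
        Set.mem_singleton_iff]
      rw [← map_one (toTrunc p d n)]
      exact toTrunc_eq_iff
    change IsOpen ((hF.magnusTrunc n).ker : Set F)
    rw [this]
    refine (List.finite_length_lt (Fin d) n).isOpen_biInter fun w _ => ?_
    exact (isOpen_discrete _).preimage ((continuous_apply w).comp hF.continuous_magnus)
  isNormal' := inferInstance

end IsFreeProP

/-! ### Completed group algebras -/

/-- The inverse limit of the group algebras `𝔽_p[G/U]` over the open normal subgroups `U` of `G`,
as a subalgebra of their product. -/
def completedGroupSubalgebra (p : ℕ) (G : Type*) [Group G] [TopologicalSpace G] :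
    Subalgebra (ZMod p) (∀ U : OpenNormalSubgroup G, MonoidAlgebra (ZMod p) (G ⧸ U.toSubgroup)) where
  carrier := {z | ∀ (U V : OpenNormalSubgroup G) (h : U ≤ V),
    MonoidAlgebra.mapDomainAlgHom (ZMod p) (ZMod p)
      (QuotientGroup.map U.toSubgroup V.toSubgroup (MonoidHom.id G) h) (z U) = z V}
  mul_mem' ha hb U V h := by rw [Pi.mul_apply, map_mul, ha U V h, hb U V h, Pi.mul_apply]
  add_mem' ha hb U V h := by rw [Pi.add_apply, map_add, ha U V h, hb U V h, Pi.add_apply]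
  algebraMap_mem' r U V h := by rw [Pi.algebraMap_apply, AlgHom.commutes, Pi.algebraMap_apply]

/-- The completed group algebra `Λ_G = 𝔽_p⟦G⟧`. -/
def CompletedGroupAlgebra (p : ℕ) (G : Type*) [Group G] [TopologicalSpace G] : Type _ :=
  completedGroupSubalgebra p G

namespace CompletedGroupAlgebra

variable (p : ℕ) {G : Type*} [Group G] [TopologicalSpace G]

instance : Ring (CompletedGroupAlgebra p G) := inferInstanceAs (Ring (completedGroupSubalgebra p G))

instance : Algebra (ZMod p) (CompletedGroupAlgebra p G) :=
  inferInstanceAs (Algebra (ZMod p) (completedGroupSubalgebra p G))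

/-- The projection `Λ_G → 𝔽_p[G/U]`. -/
def proj (U : OpenNormalSubgroup G) :
    CompletedGroupAlgebra p G →ₐ[ZMod p] MonoidAlgebra (ZMod p) (G ⧸ U.toSubgroup) :=
  (Pi.evalAlgHom (ZMod p) _ U).comp (completedGroupSubalgebra p G).val

/-- The inverse limit topology, each `𝔽_p[G/U]` being discrete. -/
instance : TopologicalSpace (CompletedGroupAlgebra p G) :=
  ⨅ U : OpenNormalSubgroup G, TopologicalSpace.induced (proj p U) ⊥

/-- The image of `g ∈ G` in `Λ_G`. -/
def of (g : G) : CompletedGroupAlgebra p G :=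
  ⟨fun U => MonoidAlgebra.of (ZMod p) (G ⧸ U.toSubgroup) (g : G ⧸ U.toSubgroup), fun U V h => by
    simp only [MonoidAlgebra.of_apply, MonoidAlgebra.mapDomainAlgHom_apply,
      MonoidAlgebra.mapDomain_single]
    rfl⟩

/-- The preimage of an open normal subgroup under a continuous homomorphism. -/
def comapOpenNormal {F : Type*} [Group F] [TopologicalSpace F] (π : F →ₜ* G)
    (V : OpenNormalSubgroup G) : OpenNormalSubgroup F where
  toOpenSubgroup := V.toOpenSubgroup.comap (π : F →* G) π.continuous_toFun
  isNormal' := inferInstanceAs (V.toSubgroup.comap (π : F →* G)).Normal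

/-- The algebra homomorphism `θ : Λ_F → Λ_G` induced by a continuous homomorphism `F → G`. -/
def map {F : Type*} [Group F] [TopologicalSpace F] (π : F →ₜ* G) :
    CompletedGroupAlgebra p F →ₐ[ZMod p] CompletedGroupAlgebra p G :=
  AlgHom.codRestrict
    (AlgHom.pi fun V : OpenNormalSubgroup G =>
      (MonoidAlgebra.mapDomainAlgHom (ZMod p) (ZMod p)
        (QuotientGroup.map (comapOpenNormal π V).toSubgroup V.toSubgroup (π : F →* G) le_rfl)).comp
          (proj p (comapOpenNormal π V)))
    (completedGroupSubalgebra p G) (by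
      intro z U V h
      have hz := z.2 (comapOpenNormal π U) (comapOpenNormal π V) (fun y hy => h hy)
      change _ = MonoidAlgebra.mapDomainAlgHom (ZMod p) (ZMod p) _
        (z.1 (comapOpenNormal π V))
      rw [← hz]
      change MonoidAlgebra.mapDomainAlgHom (ZMod p) (ZMod p) _
        (MonoidAlgebra.mapDomainAlgHom (ZMod p) (ZMod p) _ (z.1 (comapOpenNormal π U))) = _
      rw [← AlgHom.comp_apply, ← AlgHom.comp_apply, ← MonoidAlgebra.mapDomainAlgHom_comp,
        ← MonoidAlgebra.mapDomainAlgHom_comp]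
      congr 2
      ext y
      rfl)

end CompletedGroupAlgebra

section Filtration

open MagnusAlgebra

variable {p d : ℕ} [Fact p.Prime] {F : Type*} [Group F] [TopologicalSpace F]
  [IsTopologicalGroup F] {x : Fin d → F} {G : Type*} [Group G] [TopologicalSpace G]

/-- The map `φ : Λ_F → E` extending the Magnus homomorphism by linearity and continuity: modulo
`E_n` it is the composite `Λ_F → 𝔽_p[F/F_n] → E / E_n`. -/
def IsFreeProP.magnusLinear (hF : IsFreeProP p x) :
    CompletedGroupAlgebra p F →ₗ[ZMod p] MagnusAlgebra p d :=
  LinearMap.pi fun w : List (Fin d) =>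
    (truncCoeff (w.length + 1) w (Nat.lt_succ_self _)).comp
      ((MonoidAlgebra.lift (ZMod p) (Trunc p d (w.length + 1)) _
        (QuotientGroup.lift (hF.zassenhaus (w.length + 1)).toSubgroup
          (hF.magnusTrunc (w.length + 1)) le_rfl)).toLinearMap.comp
        (CompletedGroupAlgebra.proj p (hF.zassenhaus (w.length + 1))).toLinearMap)

/-- The filtration `E_{G,n}` of `Λ_G` induced by the valuation of `Λ_F ≃ E`: the elements
`θ(z)` with `z ∈ Λ_F` and `ω(φ(z)) ≥ n`. -/
def inducedFiltration (hF : IsFreeProP p x) (π : F →ₜ* G) (n : ℕ) :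
    Submodule (ZMod p) (CompletedGroupAlgebra p G) :=
  ((filtration p d n).comap hF.magnusLinear).map (CompletedGroupAlgebra.map p π).toLinearMap

/-- The graded piece `E_{G,n} / E_{G,n+1}`. -/
abbrev gradedPiece (hF : IsFreeProP p x) (π : F →ₜ* G) (n : ℕ) : Type _ :=
  inducedFiltration hF π n ⧸
    (inducedFiltration hF π (n + 1)).submoduleOf (inducedFiltration hF π n)

/-- The Poincaré series `P_G(t) = ∑ dim (E_{G,n} / E_{G,n+1}) tⁿ`. -/
def poincareSeries (hF : IsFreeProP p x) (π : F →ₜ* G) : PowerSeries ℤ :=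
  PowerSeries.mk fun n => (Module.finrank (ZMod p) (gradedPiece hF π n) : ℤ)

end Filtration

/-! ### The module `R / R^p[R,R]` -/

/-- The closed subgroup `R^p[R,R]` of a topological group `R`. -/
def pCommutator (p : ℕ) (R : Type*) [Group R] [TopologicalSpace R] [IsTopologicalGroup R] :
    Subgroup R :=
  (Subgroup.closure (Set.range fun r : R => r ^ p) ⊔ commutator R).topologicalClosure

theorem commutator_le_pCommutator (p : ℕ) (R : Type*) [Group R] [TopologicalSpace R]
    [IsTopologicalGroup R] : commutator R ≤ pCommutator p R :=
  le_sup_right.trans (Subgroup.le_topologicalClosure _)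

instance (p : ℕ) (R : Type*) [Group R] [TopologicalSpace R] [IsTopologicalGroup R] :
    (pCommutator p R).Normal :=
  Subgroup.Normal.of_commutator_le R (commutator_le_pCommutator p R)

/-- The topological abelian group `R / R^p[R,R]`, written additively. -/
def RelationModule (p : ℕ) (R : Type*) [Group R] [TopologicalSpace R] [IsTopologicalGroup R] :
    Type _ :=
  Additive (R ⧸ pCommutator p R)

namespace RelationModule

variable (p : ℕ) {R : Type*} [Group R] [TopologicalSpace R] [IsTopologicalGroup R]

instance : AddCommGroup (RelationModule p R) where
  __ := (inferInstance : AddGroup (Additive (R ⧸ pCommutator p R)))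
  add_comm a b := by
    have := (Subgroup.Normal.quotient_commutative_iff_commutator_le
      (N := pCommutator p R)).2 (commutator_le_pCommutator p R)
    exact congrArg Additive.ofMul (this.is_comm.comm a.toMul b.toMul)

instance : TopologicalSpace (RelationModule p R) :=
  inferInstanceAs (TopologicalSpace (R ⧸ pCommutator p R))

/-- The class of `r ∈ R` in `R / R^p[R,R]`. -/
def mk (r : R) : RelationModule p R := Additive.ofMul (r : R ⧸ pCommutator p R)

end RelationModule

/-! ### Cohomology -/

instance (p : ℕ) : ContinuousSMul (ZMod p) (ULift (ZMod p)) := ⟨continuous_of_discreteTopology⟩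

/-- The continuous cohomology group `H^n(G) = H^n(G, 𝔽_p)`, with trivial action on the discrete
module `𝔽_p`. -/
abbrev modPCohomology.{u} (p : ℕ) (G : Type u) [Group G] [TopologicalSpace G]
    [IsTopologicalGroup G] (n : ℕ) : TopModuleCat.{u} (ZMod p) :=
  continuousCohomology n
    (TopRep.of (ContRepresentation.trivial (ZMod p) G (ULift.{u} (ZMod p))))

/-- The `p`-rank `d_p G = dim H^1(G)`. -/
def pRank (p : ℕ) (G : Type*) [Group G] [TopologicalSpace G] [IsTopologicalGroup G] : ℕ :=
  Module.finrank (ZMod p) (modPCohomology p G 1)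

/-- The cohomological dimension of a pro-`p` group: the least `n ≤ ∞` such that `H^i(G) = 0` for
every `i > n`. -/
def cohomologicalDimension (p : ℕ) (G : Type*) [Group G] [TopologicalSpace G]
    [IsTopologicalGroup G] : ℕ∞ :=
  sInf {n : ℕ∞ | ∀ i : ℕ, n < i → Subsingleton (modPCohomology p G i)}

/-! ### Combinatorially free families -/

/-- A family of monomials is combinatorially free if no member is a submonomial of another one, and
no proper nontrivial left factor of a member is a proper right factor of a member (the same or
another one). -/
def CombinatoriallyFree {d : ℕ} {I : Type*} (α : I → List (Fin d)) : Prop :=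
  (∀ i j, i ≠ j → ¬ α i <:+: α j) ∧
  ∀ i j, ∀ u v u' v' : List (Fin d), u ≠ [] → v ≠ [] → u' ≠ [] → v' ≠ [] →
    α i = u ++ v → α j = u' ++ v' → u ≠ v'

end

/-! Write f_i = φ(ρ_i) - 1, let M be the ideal of series without constant term, and call a word
normal if it contains no highest term α_i. Combinatorial freeness says that the α_i neither contain
nor overlap one another, so every word that is not normal factors in exactly one way as u α_i v with
u normal (`CombinatoriallyFree.append_unique`). The series X_w for w normal and X_u f_i X_v for w =
u α_i v have highest term X_w, and a family that is triangular in this sense is a topological basis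
of E (`comb_injective`, `comb_surjective`). The elements X_u f_i X_v topologically span a closed
subspace J. Rewriting modulo J shows that J is a two-sided ideal, that the normal words give a basis
of E/J, and that J/JM is free over E/J on the classes of the f_i (`relCoeff_mul_rel`,
`relCoeff_mul`).

The link with groups is that J is the kernel of E → Λ_G (`toCompleted_eq_zero_iff`). By a Frattini
argument an open normal subgroup of F containing every ρ_i contains R, so φ(r) - 1 lies in J for r
in R. Hence E → E/(J + E_n) factors through Λ_G for every n, and J is the intersection of the J +
E_n.

Three consequences follow. Counting the ways of appending a letter to a normal word gives the
recursion behind the Poincaré series. The map r ↦ φ(r) - 1 modulo JM sends R/R^p[R,R] to a product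
of copies of Λ_G. It is surjective by compactness; it is injective because the ρ_i generate and
their images are free, so that each homomorphism to a discrete elementary abelian p-group,
continuous and trivial on R ∩ U for some open normal subgroup U of F, factors through the
coefficients. Finally, the dual of the resolution 0 → ∏ Λ_G → Λ_G^d → Λ_G → 𝔽_p → 0 is an exact
sequence 0 → 𝔽_p → C(G, 𝔽_p) → C(G, 𝔽_p^d) → C(G, 𝔽_p^(I)) → 0 with acyclic coinduced terms.
Dimension shifting along it kills the cohomology in degrees at least 3
(`TopRep.cochainExact_of_exact`). -/

noncomputable section

/-! ### Normal words -/

section NormalWords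

variable {d : ℕ} {I : Type*} {α : I → List (Fin d)}

/-- A word is normal if it contains none of the words `α i`. -/
def IsNormalWord (α : I → List (Fin d)) (w : List (Fin d)) : Prop := ∀ i, ¬ α i <:+: w

theorem IsNormalWord.of_isInfix {u w : List (Fin d)} (hw : IsNormalWord α w) (h : u <:+: w) :
    IsNormalWord α u := fun i hi => hw i (hi.trans h)

theorem not_isNormalWord_append (u : List (Fin d)) (i : I) (v : List (Fin d)) :
    ¬ IsNormalWord α (u ++ α i ++ v) := fun h => h i ⟨u, v, rfl⟩

theorem isNormalWord_nil (hα : ∀ i, α i ≠ []) : IsNormalWord α [] :=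
  fun i h => hα i (List.infix_nil.1 h)

/-- Every word that is not normal factors as `u α_i v` with `u` normal. -/
theorem exists_eq_append_of_not_isNormalWord (hα : ∀ i, α i ≠ []) {w : List (Fin d)}
    (h : ¬ IsNormalWord α w) : ∃ u i v, IsNormalWord α u ∧ w = u ++ α i ++ v := by
  induction hn : w.length using Nat.strong_induction_on generalizing w with
  | _ n ih =>
    simp only [IsNormalWord, not_forall, not_not] at h
    obtain ⟨i, s, t, rfl⟩ := h
    by_cases hs : IsNormalWord α s
    · exact ⟨s, i, t, hs, rfl⟩
    · have h0 := List.length_pos_iff.2 (hα i)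
      obtain ⟨u, k, v, hu, rfl⟩ := ih s.length (by simp at hn; omega) hs rfl
      exact ⟨u, k, v ++ α i ++ t, hu, by simp⟩

theorem CombinatoriallyFree.injective (hfree : CombinatoriallyFree α) : Function.Injective α := by
  intro i j h
  by_contra hij
  exact hfree.1 i j hij (h ▸ List.infix_rfl)

/-- As `u ++ s` is normal, `α i` cannot end inside `s`, so it reaches the place where `α k` starts.
Then either one of the two words contains the other, which forces `i = k`, or they overlap properly,
which the second condition forbids. -/
theorem CombinatoriallyFree.append_unique_aux (hfree : CombinatoriallyFree α)
    {u s v v' : List (Fin d)} {i k : I} (hu' : IsNormalWord α (u ++ s))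
    (h : α i ++ v = s ++ (α k ++ v')) : s = [] ∧ i = k ∧ v = v' := by
  rcases List.append_eq_append_iff.1 h with ⟨t, rfl, ht⟩ | ⟨t, hs, ht⟩
  · exact absurd (hu' i ⟨u, t, by simp⟩) (by simp)
  · rcases List.append_eq_append_iff.1 ht with ⟨q, rfl, hq⟩ | ⟨q, hk, hq⟩
    · have hik : k = i := by
        by_contra hki
        exact hfree.1 k i hki (hs ▸ ⟨s, q, by simp⟩)
      subst hik
      have hl := congrArg List.length hs
      simp at hl
      have hs0 : s = [] := List.length_eq_zero_iff.1 (by omega)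
      have hq0 : q = [] := List.length_eq_zero_iff.1 (by omega)
      subst hs0 hq0
      exact ⟨rfl, rfl, by simpa using hq.symm⟩
    · by_cases hs0 : s = []
      · subst hs0
        have hik : i = k := by
          by_contra hki
          refine hfree.1 i k hki ⟨[], q, ?_⟩
          simp [hk, hs]
        subst hik
        exact ⟨rfl, rfl, by simpa using h⟩
      · by_cases ht0 : t = []
        · subst ht0
          exact absurd (hu' i ⟨u, [], by simp [hs]⟩) (by simp)
        · by_cases hq0 : q = []
          · subst hq0
            have hik : k = i := by
              by_contra hki
              refine hfree.1 k i hki ⟨s, [], ?_⟩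
              simp [hk, hs]
            subst hik
            have hl := congrArg List.length hs
            have hl' := congrArg List.length hk
            simp at hl hl'
            exact absurd (List.length_eq_zero_iff.1 (by omega)) hs0
          · exact absurd rfl (hfree.2 k i t q s t ht0 hq0 hs0 ht0 hk hs)

/-- The factorization `u α_i v` with `u` normal is unique for a combinatorially free family. -/
theorem CombinatoriallyFree.append_unique (hfree : CombinatoriallyFree α)
    {u u' v v' : List (Fin d)} {i k : I} (hu : IsNormalWord α u)
    (hu' : IsNormalWord α u') (h : u ++ α i ++ v = u' ++ α k ++ v') :
    u = u' ∧ i = k ∧ v = v' := by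
  rw [List.append_assoc, List.append_assoc] at h
  rcases List.append_eq_append_iff.1 h with ⟨s, rfl, hs⟩ | ⟨s, rfl, hs⟩
  · obtain ⟨rfl, hi, hv⟩ := hfree.append_unique_aux hu' hs
    exact ⟨by simp, hi, hv⟩
  · obtain ⟨rfl, hi, hv⟩ := hfree.append_unique_aux hu hs
    exact ⟨by simp, hi.symm, hv.symm⟩

/-- A word `u α_i` with `u` normal becomes normal when its last letter is removed. -/
theorem CombinatoriallyFree.isNormalWord_of_append_singleton (hfree : CombinatoriallyFree α)
    (hα : ∀ i, α i ≠ []) {u w : List (Fin d)} {i : I} {j : Fin d} (hu : IsNormalWord α u)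
    (h : w ++ [j] = u ++ α i) : IsNormalWord α w := by
  by_contra hw
  obtain ⟨u', k, v, hu', rfl⟩ := exists_eq_append_of_not_isNormalWord hα hw
  -- A forbidden factor of `w` would give a second factorization of `w ++ [j]`, with a nonempty tail
  -- in place of the empty one.
  have := (hfree.append_unique hu hu' (v := []) (v' := v ++ [j]) (by simp at h ⊢; exact h.symm)).2.2
  simp at this

/-- If `w` is normal and `w X_j` is not, then `w X_j = u α_i` with `u` normal. -/
theorem exists_append_singleton_eq (hα : ∀ i, α i ≠ []) {w : List (Fin d)} {j : Fin d}
    (hw : IsNormalWord α w) (h : ¬ IsNormalWord α (w ++ [j])) :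
    ∃ u i, IsNormalWord α u ∧ w ++ [j] = u ++ α i := by
  obtain ⟨u, i, v, hu, hv⟩ := exists_eq_append_of_not_isNormalWord hα h
  rcases List.eq_nil_or_concat v with rfl | ⟨v', b, rfl⟩
  · exact ⟨u, i, hu, by simpa using hv⟩
  · rw [List.concat_eq_append, ← List.append_assoc] at hv
    have := (List.append_inj' hv rfl).1
    exact absurd (this ▸ hw) (not_isNormalWord_append u i v')

end NormalWords

end

noncomputable section

/-! ### Topology of the Magnus algebra and triangular families -/

namespace MagnusAlgebra

variable {p d : ℕ}

instance : T2Space (MagnusAlgebra p d) := inferInstanceAs (T2Space (_ → ZMod p))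

instance [Fact p.Prime] : CompactSpace (MagnusAlgebra p d) :=
  inferInstanceAs (CompactSpace (_ → ZMod p))

theorem continuous_coeff (w : List (Fin d)) : Continuous fun a : MagnusAlgebra p d => a w :=
  continuous_apply w

theorem continuous_iff_coeff {X : Type*} [TopologicalSpace X] {f : X → MagnusAlgebra p d} :
    Continuous f ↔ ∀ w, Continuous fun x => f x w := continuous_pi_iff

instance : IsTopologicalRing (MagnusAlgebra p d) where
  continuous_add := continuous_iff_coeff.2 fun w =>
    ((continuous_coeff w).comp continuous_fst).add ((continuous_coeff w).comp continuous_snd)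
  continuous_mul := continuous_iff_coeff.2 fun w => by
    simp only [mul_apply]
    exact continuous_finsetSum _ fun k _ => ((continuous_coeff _).comp continuous_fst).mul
      ((continuous_coeff _).comp continuous_snd)
  continuous_neg := continuous_iff_coeff.2 fun w => (continuous_coeff w).neg

/-- The words of length at most `n`. -/
def wordsLE (d n : ℕ) : Finset (List (Fin d)) := (List.finite_length_le (Fin d) n).toFinset

@[simp] theorem mem_wordsLE {n : ℕ} {w : List (Fin d)} : w ∈ wordsLE d n ↔ w.length ≤ n := by
  simp [wordsLE]

theorem monomial_apply (w v : List (Fin d)) :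
    (monomial w : MagnusAlgebra p d) v = if v = w then 1 else 0 := rfl

theorem monomial_nil : (monomial [] : MagnusAlgebra p d) = 1 := rfl

theorem sum_apply {ι : Type*} (s : Finset ι) (f : ι → MagnusAlgebra p d) (w : List (Fin d)) :
    (∑ i ∈ s, f i) w = ∑ i ∈ s, f i w := Finset.sum_apply w s f

theorem monomial_mul_apply_append (u v : List (Fin d)) (a : MagnusAlgebra p d) :
    (monomial u * a : MagnusAlgebra p d) (u ++ v) = a v := by
  rw [mul_apply, Finset.sum_eq_single u.length]
  · simp [monomial_apply]
  · intro k hk hne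
    rw [monomial_apply, if_neg, zero_mul]
    intro h
    have := congrArg List.length h
    simp at this hk
    omega
  · simp

theorem monomial_mul_apply_of_not_isPrefix {u w : List (Fin d)} (a : MagnusAlgebra p d)
    (h : ¬ u <+: w) : (monomial u * a : MagnusAlgebra p d) w = 0 := by
  rw [mul_apply]
  refine Finset.sum_eq_zero fun k _ => ?_
  rw [monomial_apply, if_neg, zero_mul]
  rintro rfl
  exact h ⟨_, List.take_append_drop _ _⟩

theorem mul_monomial_apply_append (u v : List (Fin d)) (a : MagnusAlgebra p d) :
    (a * monomial v : MagnusAlgebra p d) (u ++ v) = a u := by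
  rw [mul_apply, Finset.sum_eq_single u.length]
  · simp [monomial_apply]
  · intro k hk hne
    rw [monomial_apply, if_neg, mul_zero]
    intro h
    have := congrArg List.length h
    simp at this hk
    omega
  · simp

theorem mul_monomial_apply_of_not_suffix {v w : List (Fin d)} (a : MagnusAlgebra p d)
    (h : ¬ v <:+ w) : (a * monomial v : MagnusAlgebra p d) w = 0 := by
  rw [mul_apply]
  refine Finset.sum_eq_zero fun k _ => ?_
  rw [monomial_apply, if_neg, mul_zero]
  rintro rfl
  exact h (List.drop_suffix _ _)

theorem monomial_mul_monomial (u v : List (Fin d)) :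
    (monomial u * monomial v : MagnusAlgebra p d) = monomial (u ++ v) := by
  ext w
  by_cases h : u <+: w
  · obtain ⟨w, rfl⟩ := h
    rw [monomial_mul_apply_append]
    simp [monomial_apply]
  · rw [monomial_mul_apply_of_not_isPrefix _ h, monomial_apply, if_neg]
    rintro rfl
    exact h (List.prefix_append _ _)

theorem monomial_mul_X (u : List (Fin d)) (j : Fin d) :
    (monomial u * X j : MagnusAlgebra p d) = monomial (u ++ [j]) := monomial_mul_monomial u [j]

/-! #### Density of the monomials -/

/-- The truncation of a series below degree `n`. -/
def truncate (n : ℕ) (a : MagnusAlgebra p d) : MagnusAlgebra p d :=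
  fun w => if w.length ≤ n then a w else 0

theorem truncate_eq_sum (n : ℕ) (a : MagnusAlgebra p d) :
    truncate n a = ∑ w ∈ wordsLE d n, a w • (monomial w : MagnusAlgebra p d) := by
  ext v
  simp only [truncate, sum_apply, smul_apply, monomial_apply, mul_ite, mul_one, mul_zero]
  refine Eq.trans ?_ (Finset.sum_ite_eq (wordsLE d n) v fun w => a w).symm
  simp only [mem_wordsLE]

theorem tendsto_truncate (a : MagnusAlgebra p d) :
    Filter.Tendsto (fun n => truncate n a) Filter.atTop (nhds a) := by
  refine tendsto_pi_nhds.2 fun w => tendsto_const_nhds.congr' ?_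
  filter_upwards [Filter.eventually_ge_atTop w.length] with n hn
  simp [truncate, hn]

variable {Y : Type*} [AddCommGroup Y] [Module (ZMod p) Y] [TopologicalSpace Y]

/-- A continuous linear map sends series supported in `A` to a closed subspace as soon as it sends
the monomials of `A` there. -/
theorem map_mem_of_monomial (L : MagnusAlgebra p d →ₗ[ZMod p] Y) (hL : Continuous L)
    (S : Submodule (ZMod p) Y) (hS : IsClosed (S : Set Y)) (A : Set (List (Fin d)))
    (h : ∀ w ∈ A, L (monomial w) ∈ S) {c : MagnusAlgebra p d} (hc : ∀ w ∉ A, c w = 0) :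
    L c ∈ S := by
  refine hS.mem_of_tendsto ((hL.tendsto c).comp (tendsto_truncate c)) (.of_forall fun n => ?_)
  simp only [Function.comp_apply, truncate_eq_sum, map_sum, map_smul]
  refine S.sum_mem fun w _ => ?_
  by_cases hw : w ∈ A
  · exact S.smul_mem _ (h w hw)
  · simp [hc w hw]

theorem map_eq_zero_of_monomial [T1Space Y] (L : MagnusAlgebra p d →ₗ[ZMod p] Y)
    (hL : Continuous L) (A : Set (List (Fin d))) (h : ∀ w ∈ A, L (monomial w) = 0)
    {c : MagnusAlgebra p d} (hc : ∀ w ∉ A, c w = 0) : L c = 0 := by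
  have := map_mem_of_monomial L hL ⊥ (by simp) A (by simpa using h) hc
  simpa using this

theorem linearMap_ext [T2Space Y] [IsTopologicalAddGroup Y]
    {L L' : MagnusAlgebra p d →ₗ[ZMod p] Y} (hL : Continuous L) (hL' : Continuous L')
    (h : ∀ w, L (monomial w) = L' (monomial w)) : L = L' := by
  ext c
  have := map_eq_zero_of_monomial (L - L') (hL.sub hL') Set.univ (by simp [h]) (c := c) (by simp)
  simpa [sub_eq_zero] using this

/-! #### The order on monomials -/

theorem MonomialLE.length_le {v w : List (Fin d)} (h : MonomialLE v w) : w.length ≤ v.length := by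
  rcases h with h | h <;> omega

theorem MonomialLE.refl (w : List (Fin d)) : MonomialLE w w := Or.inr ⟨rfl, le_refl _⟩

theorem MonomialLE.trans {u v w : List (Fin d)} (h : MonomialLE u v) (h' : MonomialLE v w) :
    MonomialLE u w := by
  rcases h with h | ⟨h, h1⟩ <;> rcases h' with h' | ⟨h', h2⟩
  · exact Or.inl (by omega)
  · exact Or.inl (by omega)
  · exact Or.inl (by omega)
  · exact Or.inr ⟨by omega, le_trans h1 h2⟩

theorem MonomialLE.antisymm {v w : List (Fin d)} (h : MonomialLE v w) (h' : MonomialLE w v) :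
    v = w := by
  rcases h with h | ⟨h, h1⟩ <;> rcases h' with h' | ⟨h', h2⟩
  · omega
  · omega
  · omega
  · exact le_antisymm h1 h2

/-- Equality of lengths is essential: the lexicographic order is not compatible with right
multiplication when one word is a proper prefix of the other. -/
theorem lex_append_right {v w : List (Fin d)} (t : List (Fin d)) (hl : v.length = w.length)
    (h : v < w) : v ++ t < w ++ t := by
  induction v generalizing w with
  | nil => rw [List.length_eq_zero_iff.1 hl.symm] at h; simp at h
  | cons a v ih =>
    cases w with
    | nil => simp at hl
    | cons b w =>
      simp only [List.cons_append, List.cons_lt_cons_iff] at h ⊢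
      exact h.imp_right fun h => ⟨h.1, ih (by simpa using hl) h.2⟩

theorem MonomialLE.append (a b : List (Fin d)) {v w : List (Fin d)} (h : MonomialLE v w) :
    MonomialLE (a ++ v ++ b) (a ++ w ++ b) := by
  rcases h with h | ⟨h, h1⟩
  · exact Or.inl (by simp; omega)
  · rcases h1.eq_or_lt with rfl | h1
    · exact MonomialLE.refl _
    · exact Or.inr ⟨by simp [h],
        (lex_append_right b (by simp [h]) (List.append_left_lt h1)).le⟩

theorem IsHighestTerm.monomial (w : List (Fin d)) [Nontrivial (ZMod p)] :
    (MagnusAlgebra.monomial w : MagnusAlgebra p d).IsHighestTerm w := by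
  refine ⟨by simp [monomial_apply], fun v hv => ?_⟩
  rw [monomial_apply] at hv
  split_ifs at hv with h
  · exact h ▸ MonomialLE.refl _
  · exact absurd rfl hv

/-- Multiplication by monomials on both sides only relabels the coefficients, and the order on
monomials is compatible with it. -/
theorem IsHighestTerm.monomial_mul_mul {f : MagnusAlgebra p d} {w : List (Fin d)}
    (hf : f.IsHighestTerm w) (u v : List (Fin d)) :
    (MagnusAlgebra.monomial u * f * MagnusAlgebra.monomial v : MagnusAlgebra p d).IsHighestTerm (u ++ w ++ v) := by
  constructor
  · rw [mul_monomial_apply_append, monomial_mul_apply_append]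
    exact hf.1
  · intro m hm
    have h1 : v <:+ m := by
      by_contra h
      exact hm (mul_monomial_apply_of_not_suffix _ h)
    obtain ⟨m, rfl⟩ := h1
    rw [mul_monomial_apply_append] at hm
    have h2 : u <+: m := by
      by_contra h
      exact hm (monomial_mul_apply_of_not_isPrefix _ h)
    obtain ⟨m, rfl⟩ := h2
    rw [monomial_mul_apply_append] at hm
    exact (hf.2 m hm).append u v

theorem IsHighestTerm.valuation_eq {f : MagnusAlgebra p d} {w : List (Fin d)}
    (hf : f.IsHighestTerm w) : f.valuation = w.length := by
  refine le_antisymm (iInf₂_le w hf.1) (le_valuation_iff.2 fun v hv => ?_)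
  by_contra h
  have := (hf.2 v h).length_le
  omega

theorem mem_filtration {n : ℕ} {a : MagnusAlgebra p d} :
    a ∈ filtration p d n ↔ ∀ w, w.length < n → a w = 0 := le_valuation_iff

theorem mul_mem_filtration {m n : ℕ} {a b : MagnusAlgebra p d} (ha : a ∈ filtration p d m)
    (hb : b ∈ filtration p d n) : a * b ∈ filtration p d (m + n) := by
  rw [mem_filtration] at *
  intro w hw
  rw [mul_apply]
  refine Finset.sum_eq_zero fun k hk => ?_
  simp at hk
  by_cases h : k < m
  · rw [ha _ (by simp; omega), zero_mul]
  · rw [hb _ (by simp; omega), mul_zero]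

/-- A nonzero series has a highest term. -/
theorem exists_isHighestTerm {a : MagnusAlgebra p d} (ha : a ≠ 0) : ∃ w, a.IsHighestTerm w := by
  classical
  have h0 : ∃ n, ∃ w : List (Fin d), w.length = n ∧ a w ≠ 0 := by
    by_contra! h
    exact ha (ext fun w => h _ w rfl)
  let n := Nat.find h0
  obtain ⟨w₀, hw₀, hw₀'⟩ := Nat.find_spec h0
  let s := (wordsLE d n).filter fun w => a w ≠ 0
  have hs : s.Nonempty := ⟨w₀, by simp [s, hw₀', n, hw₀]⟩
  obtain ⟨w, hw, hmax⟩ := s.exists_maximal hs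
  have hlen : ∀ v, a v ≠ 0 → n ≤ v.length := fun v hv => Nat.find_min' h0 ⟨v, rfl, hv⟩
  simp only [s, Finset.mem_filter, mem_wordsLE] at hw hmax
  refine ⟨w, hw.2, fun v hv => ?_⟩
  have h1 := hlen v hv
  have h2 := hlen w hw.2
  rcases h1.eq_or_lt with h1 | h1
  · exact Or.inr ⟨by omega, (le_total v w).elim id fun h => hmax ⟨h1.ge, hv⟩ h⟩
  · exact Or.inl (by omega)

/-! #### Triangular families -/

/-- The series `∑ c_w t_w`, for a family `t` with `ω(t_w) ≥ |w|`. -/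
def comb (t : List (Fin d) → MagnusAlgebra p d) : MagnusAlgebra p d →ₗ[ZMod p] MagnusAlgebra p d where
  toFun c := fun v => ∑ w ∈ wordsLE d v.length, c w * t w v
  map_add' a b := by
    ext v
    refine Eq.trans ?_ (Finset.sum_add_distrib (s := wordsLE d v.length))
    simp [add_mul]
  map_smul' r a := by
    ext v
    refine Eq.trans ?_ (Finset.mul_sum (wordsLE d v.length) _ _).symm
    simp [mul_assoc]

theorem comb_apply (t : List (Fin d) → MagnusAlgebra p d) (c : MagnusAlgebra p d) (v) :
    comb t c v = ∑ w ∈ wordsLE d v.length, c w * t w v := rfl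

theorem continuous_comb (t : List (Fin d) → MagnusAlgebra p d) : Continuous (comb t) :=
  continuous_iff_coeff.2 fun v => by
    simp only [comb_apply]
    exact continuous_finsetSum _ fun w _ => (continuous_coeff w).mul continuous_const

variable {t : List (Fin d) → MagnusAlgebra p d} (ht : ∀ w, (t w).IsHighestTerm w)

include ht

theorem comb_monomial (w : List (Fin d)) : comb t (monomial w) = t w := by
  ext v
  rw [comb_apply]
  simp only [monomial_apply, ite_mul, one_mul, zero_mul, Finset.sum_ite_eq', mem_wordsLE]
  split_ifs with h
  · rfl
  · by_contra h'
    exact h ((ht w).2 v (Ne.symm h')).length_le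

/-- At the highest word `w` of `c`, only `t w` contributes: a contribution of another `t v` would
need both `v ≤ w` and `w ≤ v` in the monomial order. -/
theorem IsHighestTerm.comb [Fact p.Prime] {c : MagnusAlgebra p d} {w : List (Fin d)}
    (hc : c.IsHighestTerm w) : (comb t c).IsHighestTerm w := by
  constructor
  · rw [comb_apply, Finset.sum_eq_single w]
    · exact mul_ne_zero hc.1 (ht w).1
    · intro v _ hv
      by_contra h
      exact hv ((hc.2 v (left_ne_zero_of_mul h)).antisymm ((ht v).2 w (right_ne_zero_of_mul h)))
    · simp
  · intro v hv
    obtain ⟨u, -, hu⟩ := Finset.exists_ne_zero_of_sum_ne_zero hv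
    exact ((ht u).2 v (right_ne_zero_of_mul hu)).trans (hc.2 u (left_ne_zero_of_mul hu))

theorem comb_injective [Fact p.Prime] : Function.Injective (comb t) := by
  rw [injective_iff_map_eq_zero]
  intro c hc
  by_contra h
  obtain ⟨w, hw⟩ := exists_isHighestTerm h
  exact (hw.comb ht).1 (by rw [hc]; rfl)

/-- The coefficients are found by triangular elimination. Only finitely many monomials are larger
than a given one, so well-founded recursion downwards from the larger monomials is available. -/
theorem comb_surjective [Fact p.Prime] : Function.Surjective (comb t) := by
  classical
  intro a
  let r : List (Fin d) → List (Fin d) → Prop := fun v w => MonomialLE w v ∧ v ≠ w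
  let s : List (Fin d) → Finset (List (Fin d)) := fun w => (wordsLE d w.length).filter (r · w)
  have hs : ∀ {v w}, v ∈ s w ↔ r v w := by
    intro v w
    simp only [s, Finset.mem_filter, mem_wordsLE, and_iff_right_iff_imp]
    exact fun h => h.1.length_le
  have hwf : WellFounded r := by
    refine Subrelation.wf (r := InvImage (· < ·) fun w => (s w).card) ?_
      (InvImage.wf _ wellFounded_lt)
    intro v w hvw
    refine Finset.card_lt_card ⟨fun u hu => ?_, fun h => ?_⟩
    · rw [hs] at hu ⊢
      exact ⟨hvw.1.trans hu.1, fun h => hu.2 (by subst h; exact hvw.1.antisymm hu.1)⟩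
    · exact (hs.1 (h (hs.2 hvw))).2 rfl
  -- The coefficient at `w` is solved from the equation at `w`, once the contributions of all larger
  -- monomials are known.
  let c : MagnusAlgebra p d := hwf.fix fun w ih =>
    (t w w)⁻¹ * (a w - ∑ v ∈ (s w).attach, ih v.1 (hs.1 v.2) * t v.1 w)
  have hc : ∀ w, c w = (t w w)⁻¹ * (a w - ∑ v ∈ s w, c v * t v w) := by
    intro w
    conv_lhs => rw [show c w = _ from hwf.fix_eq _ w]
    rw [← Finset.sum_attach (s w) fun v => c v * t v w]
  refine ⟨c, ext fun w => ?_⟩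
  have hsub : insert w (s w) ⊆ wordsLE d w.length := by
    intro v hv
    rcases Finset.mem_insert.1 hv with rfl | hv
    · simp
    · exact (Finset.mem_filter.1 hv).1
  rw [comb_apply, ← Finset.sum_subset hsub, Finset.sum_insert (fun h => (hs.1 h).2 rfl)]
  · conv_lhs => rw [hc w]
    have h0 := (ht w).1
    field_simp
    ring
  · intro v _ hv
    simp only [Finset.mem_insert, hs, not_or, r, not_and, not_not] at hv
    by_contra h
    exact hv.1 (hv.2 ((ht v).2 w (right_ne_zero_of_mul h)))

/-- For a triangular family `t`, the map `c ↦ ∑ c_w t_w` is an isomorphism. -/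
def combEquiv [Fact p.Prime] : MagnusAlgebra p d ≃ₗ[ZMod p] MagnusAlgebra p d :=
  LinearEquiv.ofBijective (comb t) ⟨comb_injective ht, comb_surjective ht⟩

theorem combEquiv_apply [Fact p.Prime] (c : MagnusAlgebra p d) : combEquiv ht c = comb t c := rfl

/-- A continuous bijection from a compact space to a Hausdorff space is a homeomorphism. -/
theorem continuous_combEquiv_symm [Fact p.Prime] : Continuous (combEquiv ht).symm :=
  ((continuous_comb t).homeoOfEquivCompactToT2 (f := (combEquiv ht).toEquiv)).symm.continuous

/-- Since `comb t` preserves highest terms it preserves the valuation, so taking coordinates does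
not lower the degree. -/
theorem combEquiv_symm_mem_filtration [Fact p.Prime] {n : ℕ} {a : MagnusAlgebra p d}
    (ha : a ∈ filtration p d n) : (combEquiv ht).symm a ∈ filtration p d n := by
  by_cases h0 : (combEquiv ht).symm a = 0
  · rw [h0]; exact zero_mem _
  · obtain ⟨w, hw⟩ := exists_isHighestTerm h0
    have h1 := hw.comb ht
    rw [← combEquiv_apply ht, LinearEquiv.apply_symm_apply] at h1
    rw [mem_filtration] at ha ⊢
    intro v hv
    by_contra h
    exact h1.1 (ha w ((hw.2 v h).length_le.trans_lt hv))

end MagnusAlgebra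

end

noncomputable section

/-! ### The ideal generated by series with combinatorially free highest terms -/

namespace MagnusAlgebra

variable {p d : ℕ}

/-- The right derivative: the coefficient of `X_j` in the decomposition
`a = a_∅ + ∑_j (∂_j a) X_j`. -/
def deriv (j : Fin d) : MagnusAlgebra p d →ₗ[ZMod p] MagnusAlgebra p d where
  toFun a := fun w => a (w ++ [j])
  map_add' _ _ := rfl
  map_smul' _ _ := rfl

theorem deriv_apply (j : Fin d) (a : MagnusAlgebra p d) (w : List (Fin d)) :
    deriv j a w = a (w ++ [j]) := rfl

theorem continuous_deriv (j : Fin d) : Continuous (deriv j : MagnusAlgebra p d → _) :=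
  continuous_iff_coeff.2 fun w => continuous_coeff (w ++ [j])

theorem mul_X_apply_append (a : MagnusAlgebra p d) (w : List (Fin d)) (i j : Fin d) :
    (a * X j : MagnusAlgebra p d) (w ++ [i]) = if i = j then a w else 0 := by
  split_ifs with h
  · subst h
    exact mul_monomial_apply_append w [i] a
  · refine mul_monomial_apply_of_not_suffix a fun hs => h ?_
    rw [List.singleton_suffix_iff_getLast?_eq_some] at hs
    simpa using hs

theorem mul_X_apply_nil (a : MagnusAlgebra p d) (j : Fin d) : (a * X j : MagnusAlgebra p d) [] = 0 :=
  mul_monomial_apply_of_not_suffix a (by simp)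

theorem eq_sum_deriv_mul_X {a : MagnusAlgebra p d} (ha : a [] = 0) :
    a = ∑ j, deriv j a * X j := by
  ext w
  rw [sum_apply]
  rcases List.eq_nil_or_concat w with rfl | ⟨w, i, rfl⟩
  · simp only [mul_X_apply_nil, ha, Finset.sum_const_zero]
  · simp only [List.concat_eq_append, mul_X_apply_append]
    exact ((Finset.sum_ite_eq Finset.univ i fun j => deriv j a w).trans
      (if_pos (Finset.mem_univ i))).symm

theorem deriv_mul_X (a : MagnusAlgebra p d) (i j : Fin d) :
    deriv i (a * X j) = if i = j then a else 0 := by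
  ext w
  rw [deriv_apply, mul_X_apply_append]
  split_ifs <;> rfl

end MagnusAlgebra

/-- A family of series whose highest terms are nontrivial and combinatorially free. -/
structure FreeRelators (p d : ℕ) (I : Type*) where
  /-- The highest terms. -/
  lead : I → List (Fin d)
  /-- The series. -/
  rel : I → MagnusAlgebra p d
  isHighestTerm : ∀ i, (rel i).IsHighestTerm (lead i)
  lead_ne_nil : ∀ i, lead i ≠ []
  free : CombinatoriallyFree lead

namespace FreeRelators

open MagnusAlgebra

variable {p d : ℕ} {I : Type*} (S : FreeRelators p d I)

theorem rel_nil (i : I) : S.rel i [] = 0 := by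
  by_contra h
  have := ((S.isHighestTerm i).2 [] h).length_le
  exact S.lead_ne_nil i (List.length_eq_zero_iff.1 (by simpa using this))

theorem finite_length_lead_le (n : ℕ) : {i | (S.lead i).length ≤ n}.Finite :=
  ((List.finite_length_le (Fin d) n).preimage S.free.injective.injOn)

theorem rel_mem_filtration {n : ℕ} {i : I} (h : n ≤ (S.lead i).length) :
    S.rel i ∈ filtration p d n := by
  rw [mem_filtration]
  intro w hw
  by_contra h0
  have := ((S.isHighestTerm i).2 w h0).length_le
  omega

open Classical in
/-- The series with highest term `w`: `X_w` itself for a normal word, and `X_u f_i X_v` for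
`w = u α_i v` with `u` normal. -/
def basis (w : List (Fin d)) : MagnusAlgebra p d :=
  if h : ∃ u i v, IsNormalWord S.lead u ∧ w = u ++ S.lead i ++ v then
    monomial h.choose * S.rel h.choose_spec.choose * monomial h.choose_spec.choose_spec.choose
  else monomial w

theorem basis_of_isNormalWord {w : List (Fin d)} (hw : IsNormalWord S.lead w) :
    S.basis w = monomial w := by
  rw [basis, dif_neg]
  rintro ⟨u, i, v, -, rfl⟩
  exact not_isNormalWord_append u i v hw

/-- Uniqueness of the factorization makes the choices in `basis` irrelevant. -/
theorem basis_append {u : List (Fin d)} (hu : IsNormalWord S.lead u) (i : I) (v : List (Fin d)) :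
    S.basis (u ++ S.lead i ++ v) = monomial u * S.rel i * monomial v := by
  have h : ∃ u' i' v', IsNormalWord S.lead u' ∧ u ++ S.lead i ++ v = u' ++ S.lead i' ++ v' :=
    ⟨u, i, v, hu, rfl⟩
  rw [basis, dif_pos h]
  have h' := h.choose_spec.choose_spec.choose_spec
  obtain ⟨h1, h2, h3⟩ := S.free.append_unique hu h'.1 h'.2
  have key : ∀ u' i' v', u = u' → i = i' → v = v' →
      monomial u' * S.rel i' * monomial v' = monomial u * S.rel i * monomial v := by
    rintro _ _ _ rfl rfl rfl
    rfl
  exact key _ _ _ h1 h2 h3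

variable [Fact p.Prime]

theorem isHighestTerm_basis (w : List (Fin d)) : (S.basis w).IsHighestTerm w := by
  by_cases hw : IsNormalWord S.lead w
  · rw [S.basis_of_isNormalWord hw]
    exact IsHighestTerm.monomial w
  · obtain ⟨u, i, v, hu, rfl⟩ := exists_eq_append_of_not_isNormalWord S.lead_ne_nil hw
    rw [S.basis_append hu]
    exact (S.isHighestTerm i).monomial_mul_mul u v

/-- The coordinates of a series with respect to the topological basis `S.basis`. -/
def coord : MagnusAlgebra p d ≃ₗ[ZMod p] MagnusAlgebra p d :=
  (combEquiv S.isHighestTerm_basis).symm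

theorem continuous_coord : Continuous S.coord := continuous_combEquiv_symm _

theorem continuous_coord_symm : Continuous S.coord.symm := continuous_comb _

theorem coord_symm_monomial (w : List (Fin d)) : S.coord.symm (monomial w) = S.basis w :=
  comb_monomial S.isHighestTerm_basis w

theorem coord_basis (w : List (Fin d)) : S.coord (S.basis w) = monomial w := by
  rw [← S.coord_symm_monomial, LinearEquiv.apply_symm_apply]

theorem coord_mem_filtration {n : ℕ} {a : MagnusAlgebra p d} (ha : a ∈ filtration p d n) :
    S.coord a ∈ filtration p d n := combEquiv_symm_mem_filtration _ ha

open Classical in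
/-- The normal part of the coordinates of a series. -/
def normalPart : MagnusAlgebra p d →ₗ[ZMod p] MagnusAlgebra p d where
  toFun a := fun w => if IsNormalWord S.lead w then S.coord a w else 0
  map_add' a b := by
    ext w
    change (if IsNormalWord S.lead w then S.coord (a + b) w else 0) =
      (if IsNormalWord S.lead w then S.coord a w else 0) +
      (if IsNormalWord S.lead w then S.coord b w else 0)
    split_ifs <;> simp
  map_smul' r a := by
    ext w
    change (if IsNormalWord S.lead w then S.coord (r • a) w else 0) =
      r * (if IsNormalWord S.lead w then S.coord a w else 0)
    split_ifs <;> simp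

theorem normalPart_apply_of_isNormalWord (a : MagnusAlgebra p d) {w : List (Fin d)}
    (hw : IsNormalWord S.lead w) : S.normalPart a w = S.coord a w := if_pos hw

theorem normalPart_apply_of_not_isNormalWord (a : MagnusAlgebra p d) {w : List (Fin d)}
    (hw : ¬ IsNormalWord S.lead w) : S.normalPart a w = 0 := if_neg hw

theorem continuous_normalPart : Continuous S.normalPart :=
  continuous_iff_coeff.2 fun w => by
    by_cases hw : IsNormalWord S.lead w
    · simp only [S.normalPart_apply_of_isNormalWord _ hw]
      exact (continuous_coeff w).comp S.continuous_coord
    · simpa only [S.normalPart_apply_of_not_isNormalWord _ hw] using continuous_const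

/-- The closed ideal generated by the relators, as a subspace. -/
def ideal : Submodule (ZMod p) (MagnusAlgebra p d) := S.normalPart.ker

theorem mem_ideal {a : MagnusAlgebra p d} :
    a ∈ S.ideal ↔ ∀ w, IsNormalWord S.lead w → S.coord a w = 0 := by
  rw [ideal, LinearMap.mem_ker]
  constructor
  · intro h w hw
    rw [← S.normalPart_apply_of_isNormalWord a hw, h, zero_apply]
  · intro h
    ext w
    by_cases hw : IsNormalWord S.lead w
    · rw [S.normalPart_apply_of_isNormalWord a hw, h w hw, zero_apply]
    · rw [S.normalPart_apply_of_not_isNormalWord a hw, zero_apply]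

theorem isClosed_ideal : IsClosed (S.ideal : Set (MagnusAlgebra p d)) :=
  isClosed_singleton.preimage S.continuous_normalPart

theorem basis_mem_ideal {w : List (Fin d)} (hw : ¬ IsNormalWord S.lead w) :
    S.basis w ∈ S.ideal := by
  rw [mem_ideal, coord_basis]
  intro v hv
  rw [monomial_apply, if_neg]
  rintro rfl
  exact hw hv

theorem monomial_mul_rel_mul_monomial_mem {u : List (Fin d)} (hu : IsNormalWord S.lead u) (i : I)
    (v : List (Fin d)) : monomial u * S.rel i * monomial v ∈ S.ideal := by
  rw [← S.basis_append hu]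
  exact S.basis_mem_ideal (not_isNormalWord_append u i v)

section Density

variable {Y : Type*} [AddCommGroup Y] [Module (ZMod p) Y] [TopologicalSpace Y]

/-- The induction principle for J: a closed linear condition need only be checked on the elements
X_u f_i X_v with u normal. -/
theorem map_mem_of_mem_ideal (L : MagnusAlgebra p d →ₗ[ZMod p] Y) (hL : Continuous L)
    (T : Submodule (ZMod p) Y) (hT : IsClosed (T : Set Y))
    (h : ∀ u, IsNormalWord S.lead u → ∀ i v, L (monomial u * S.rel i * monomial v) ∈ T)
    {a : MagnusAlgebra p d} (ha : a ∈ S.ideal) : L a ∈ T := by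
  have := map_mem_of_monomial (L.comp S.coord.symm.toLinearMap) (hL.comp S.continuous_coord_symm)
    T hT {w | ¬ IsNormalWord S.lead w} ?_ (c := S.coord a) ?_
  · simpa using this
  · intro w hw
    obtain ⟨u, i, v, hu, rfl⟩ := exists_eq_append_of_not_isNormalWord S.lead_ne_nil hw
    rw [LinearMap.comp_apply, LinearEquiv.coe_coe, coord_symm_monomial, S.basis_append hu]
    exact h u hu i v
  · intro w hw
    exact S.mem_ideal.1 ha w (by simpa using hw)

end Density

theorem coord_symm_normalPart (a : MagnusAlgebra p d) :
    S.coord.symm (S.normalPart a) = S.normalPart a := by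
  have := map_eq_zero_of_monomial (S.coord.symm.toLinearMap - LinearMap.id)
    (S.continuous_coord_symm.sub continuous_id) {w | IsNormalWord S.lead w} ?_
    (c := S.normalPart a) (fun w hw => S.normalPart_apply_of_not_isNormalWord a hw)
  · simpa [sub_eq_zero] using this
  · intro w hw
    simp [coord_symm_monomial, S.basis_of_isNormalWord hw]

theorem coord_normalPart (a : MagnusAlgebra p d) : S.coord (S.normalPart a) = S.normalPart a := by
  conv_lhs => rw [← S.coord_symm_normalPart, LinearEquiv.apply_symm_apply]

theorem coord_of_support_isNormalWord {c : MagnusAlgebra p d}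
    (hc : ∀ w, ¬ IsNormalWord S.lead w → c w = 0) : S.coord c = c := by
  have : S.normalPart (S.coord.symm c) = c := by
    ext w
    by_cases hw : IsNormalWord S.lead w
    · rw [S.normalPart_apply_of_isNormalWord _ hw, LinearEquiv.apply_symm_apply]
    · rw [S.normalPart_apply_of_not_isNormalWord _ hw, hc w hw]
  rw [← this, S.coord_normalPart]

theorem sub_normalPart_mem (a : MagnusAlgebra p d) : a - S.normalPart a ∈ S.ideal := by
  rw [mem_ideal]
  intro w hw
  rw [map_sub, coord_normalPart, sub_apply, S.normalPart_apply_of_isNormalWord a hw, sub_self]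

/-- The spanning elements X_u f_i X_v are visibly stable under right multiplication by monomials,
and continuity does the rest. Stability on the left is less direct, since X_w X_u need not be
normal. -/
theorem mul_mem_ideal_right {a : MagnusAlgebra p d} (ha : a ∈ S.ideal) (b : MagnusAlgebra p d) :
    a * b ∈ S.ideal := by
  refine map_mem_of_monomial (LinearMap.mulLeft (ZMod p) a) (continuous_const_mul a) S.ideal
    S.isClosed_ideal Set.univ (fun m _ => ?_) (c := b) (by simp)
  refine S.map_mem_of_mem_ideal (LinearMap.mulRight (ZMod p) (monomial m))
    (continuous_mul_const _) S.ideal S.isClosed_ideal (fun u hu i v => ?_) ha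
  rw [LinearMap.mulRight_apply, mul_assoc, monomial_mul_monomial]
  exact S.monomial_mul_rel_mul_monomial_mem hu i _

/-- Split `a` into its normal part and an element of J. The normal part times f_i is a limit of
combinations of basis elements X_u f_i, and J f_i lies in J because J is already known to be a right
ideal. -/
theorem mul_rel_mem_ideal (a : MagnusAlgebra p d) (i : I) : a * S.rel i ∈ S.ideal := by
  have h1 : (a - S.normalPart a) * S.rel i ∈ S.ideal :=
    S.mul_mem_ideal_right (S.sub_normalPart_mem a) _
  have h2 : S.normalPart a * S.rel i ∈ S.ideal := by
    refine map_mem_of_monomial (LinearMap.mulRight (ZMod p) (S.rel i)) (continuous_mul_const _)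
      S.ideal S.isClosed_ideal {w | IsNormalWord S.lead w} (fun u hu => ?_)
      (fun w hw => S.normalPart_apply_of_not_isNormalWord a hw)
    have := S.monomial_mul_rel_mul_monomial_mem hu i []
    rwa [monomial_nil, mul_one] at this
  have := S.ideal.add_mem h1 h2
  rwa [← add_mul, sub_add_cancel] at this

theorem mul_mem_ideal_left (a : MagnusAlgebra p d) {b : MagnusAlgebra p d} (hb : b ∈ S.ideal) :
    a * b ∈ S.ideal := by
  refine S.map_mem_of_mem_ideal (LinearMap.mulLeft (ZMod p) a) (continuous_const_mul a) S.ideal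
    S.isClosed_ideal (fun u _ i v => ?_) hb
  rw [LinearMap.mulLeft_apply, ← mul_assoc, ← mul_assoc]
  exact S.mul_mem_ideal_right (S.mul_rel_mem_ideal _ i) _

theorem rel_mem_ideal (i : I) : S.rel i ∈ S.ideal := by
  simpa using S.mul_rel_mem_ideal 1 i

/-! #### The coordinates of the ideal modulo its product with the augmentation ideal -/

open Classical in
/-- The `i`-th coefficient of a series modulo `J M`, where `J` is the ideal generated by the
relators and `M` the augmentation ideal: a combination of normal words. -/
def relCoeff (i : I) : MagnusAlgebra p d →ₗ[ZMod p] MagnusAlgebra p d where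
  -- The word `w ++ S.lead i` indexes the basis element X_w f_i. Basis elements X_u f_i X_v with v
  -- nonempty lie in JM and are discarded.
  toFun a := fun w => if IsNormalWord S.lead w then S.coord a (w ++ S.lead i) else 0
  map_add' a b := by
    ext w
    change (if IsNormalWord S.lead w then S.coord (a + b) (w ++ S.lead i) else 0) =
      (if IsNormalWord S.lead w then S.coord a (w ++ S.lead i) else 0) +
      (if IsNormalWord S.lead w then S.coord b (w ++ S.lead i) else 0)
    split_ifs <;> simp
  map_smul' r a := by
    ext w
    change (if IsNormalWord S.lead w then S.coord (r • a) (w ++ S.lead i) else 0) =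
      r * (if IsNormalWord S.lead w then S.coord a (w ++ S.lead i) else 0)
    split_ifs <;> simp

theorem relCoeff_apply_of_isNormalWord (i : I) (a : MagnusAlgebra p d) {w : List (Fin d)}
    (hw : IsNormalWord S.lead w) : S.relCoeff i a w = S.coord a (w ++ S.lead i) := if_pos hw

theorem relCoeff_apply_of_not_isNormalWord (i : I) (a : MagnusAlgebra p d) {w : List (Fin d)}
    (hw : ¬ IsNormalWord S.lead w) : S.relCoeff i a w = 0 := if_neg hw

theorem continuous_relCoeff (i : I) : Continuous (S.relCoeff i) :=
  continuous_iff_coeff.2 fun w => by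
    by_cases hw : IsNormalWord S.lead w
    · simp only [S.relCoeff_apply_of_isNormalWord i _ hw]
      exact (continuous_coeff (w ++ S.lead i)).comp S.continuous_coord
    · simpa only [S.relCoeff_apply_of_not_isNormalWord i _ hw] using continuous_const

open Classical in
theorem relCoeff_basis {u : List (Fin d)} (hu : IsNormalWord S.lead u) (i k : I) :
    S.relCoeff k (monomial u * S.rel i) = if k = i then monomial u else 0 := by
  have h1 : monomial u * S.rel i = S.basis (u ++ S.lead i) := by
    have := S.basis_append hu i []
    rw [List.append_nil, monomial_nil, mul_one] at this
    exact this.symm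
  rw [h1]
  ext w
  by_cases hw : IsNormalWord S.lead w
  · rw [S.relCoeff_apply_of_isNormalWord k _ hw, coord_basis, monomial_apply]
    split_ifs with h h' h'
    · subst h'
      rw [monomial_apply, if_pos (List.append_inj_left' h rfl)]
    · exact absurd (S.free.append_unique hw hu (v := []) (v' := []) (by simpa using h)).2.1 h'
    · subst h'
      rw [monomial_apply, if_neg]
      rintro rfl
      exact h rfl
    · rfl
  · rw [S.relCoeff_apply_of_not_isNormalWord k _ hw]
    split_ifs
    · rw [monomial_apply, if_neg]
      rintro rfl
      exact hw hu
    · rfl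

/-- Right multiplication by X_j turns X_u f_i X_v into a basis element with a nonempty tail, whose
index is never w α_k with w normal. -/
theorem relCoeff_mul_X {g : MagnusAlgebra p d} (hg : g ∈ S.ideal) (j : Fin d) (k : I) :
    S.relCoeff k (g * X j) = 0 := by
  have := S.map_mem_of_mem_ideal ((S.relCoeff k).comp (LinearMap.mulRight (ZMod p) (X j)))
    ((S.continuous_relCoeff k).comp (continuous_mul_const _)) ⊥ (by simp) ?_ hg
  · simpa using this
  · intro u hu i v
    rw [LinearMap.comp_apply, LinearMap.mulRight_apply, mul_assoc, monomial_mul_X,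
      ← S.basis_append hu, Submodule.mem_bot]
    ext w
    by_cases hw : IsNormalWord S.lead w
    · rw [S.relCoeff_apply_of_isNormalWord k _ hw, coord_basis, monomial_apply, if_neg, zero_apply]
      intro h
      have := (S.free.append_unique hw hu (v := []) (v' := v ++ [j]) (by simpa using h)).2.2
      simp at this
    · exact S.relCoeff_apply_of_not_isNormalWord k _ hw

theorem relCoeff_mul_of_mem {g b : MagnusAlgebra p d} (hg : g ∈ S.ideal) (hb : b [] = 0) (k : I) :
    S.relCoeff k (g * b) = 0 := by
  rw [eq_sum_deriv_mul_X hb, Finset.mul_sum, map_sum]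
  refine Finset.sum_eq_zero fun j _ => ?_
  rw [← mul_assoc]
  exact S.relCoeff_mul_X (S.mul_mem_ideal_right hg _) j k

open Classical in
-- Modulo J the series `a` is its normal part, and J f_i lies in JM because f_i has no constant
-- term. This is the freeness of J/JM over E/J.
theorem relCoeff_mul_rel (a : MagnusAlgebra p d) (i k : I) :
    S.relCoeff k (a * S.rel i) = if k = i then S.normalPart a else 0 := by
  have h1 : S.relCoeff k (a * S.rel i) = S.relCoeff k (S.normalPart a * S.rel i) := by
    rw [← sub_eq_zero, ← map_sub, ← sub_mul]
    exact S.relCoeff_mul_of_mem (S.sub_normalPart_mem a) (S.rel_nil i) k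
  rw [h1]
  have := map_eq_zero_of_monomial ((S.relCoeff k).comp (LinearMap.mulRight (ZMod p) (S.rel i)) -
    if k = i then LinearMap.id else 0) ?_ {w | IsNormalWord S.lead w} ?_
    (c := S.normalPart a) (fun w hw => S.normalPart_apply_of_not_isNormalWord a hw)
  · rw [LinearMap.sub_apply, sub_eq_zero] at this
    refine this.trans ?_
    split_ifs <;> rfl
  · refine ((S.continuous_relCoeff k).comp (continuous_mul_const _)).sub ?_
    split_ifs
    · exact continuous_id
    · exact continuous_const
  · intro w hw
    rw [LinearMap.sub_apply, sub_eq_zero]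
    refine (S.relCoeff_basis hw i k).trans ?_
    split_ifs <;> rfl

/-- Modulo the ideal, `relCoeff` is left linear on the ideal. -/
theorem relCoeff_mul (a : MagnusAlgebra p d) {g : MagnusAlgebra p d} (hg : g ∈ S.ideal) (k : I) :
    a * S.relCoeff k g - S.relCoeff k (a * g) ∈ S.ideal := by
  classical
  refine S.map_mem_of_mem_ideal ((LinearMap.mulLeft (ZMod p) a).comp (S.relCoeff k) -
    (S.relCoeff k).comp (LinearMap.mulLeft (ZMod p) a))
    (((continuous_const_mul a).comp (S.continuous_relCoeff k)).sub
      ((S.continuous_relCoeff k).comp (continuous_const_mul a))) S.ideal S.isClosed_ideal ?_ hg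
  intro u hu i v
  simp only [LinearMap.sub_apply, LinearMap.comp_apply, LinearMap.mulLeft_apply]
  -- With an empty tail the claim is `relCoeff_mul_rel`; with a nonempty one both terms vanish, as
  -- the elements lie in JM.
  by_cases hv : v = []
  · subst hv
    rw [monomial_nil, mul_one, S.relCoeff_basis hu, ← mul_assoc, S.relCoeff_mul_rel]
    split_ifs
    · exact S.sub_normalPart_mem _
    · simp
  · have h0 : (monomial v : MagnusAlgebra p d) [] = 0 := by
      rw [monomial_apply, if_neg (Ne.symm hv)]
    rw [← mul_assoc a, S.relCoeff_mul_of_mem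
      (S.mul_mem_ideal_left a (S.mul_rel_mem_ideal _ i)) h0,
      S.relCoeff_mul_of_mem (S.mul_rel_mem_ideal _ i) h0]
    simp

end FreeRelators

end

noncomputable section

/-! ### The augmentation ideal of a finite `p`-group -/

section GroupAlgebra

variable {p : ℕ} [Fact p.Prime] {P : Type*} [Group P]

instance [Finite P] : Finite (MonoidAlgebra (ZMod p) P) :=
  Finite.of_injective (fun a : MonoidAlgebra (ZMod p) P => (a.coeff : P → ZMod p))
    fun a b h => by cases a; cases b; congr; exact DFunLike.coe_injective h

/-- The augmentation ideal of the group algebra of a finite `p`-group over `𝔽_p` is nilpotent. -/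
theorem IsPGroup.exists_prod_of_sub_one_eq_zero [Finite P] (hP : IsPGroup p P) :
    ∃ n, ∀ l : List P, n ≤ l.length →
      (l.map fun g => MonoidAlgebra.of (ZMod p) P g - 1).prod = 0 := by
  let A := MonoidAlgebra (ZMod p) P
  -- The set of left ideals killed by all sufficiently long products of elements g - 1. A maximal
  -- member S must be A: otherwise the p-group P fixes a nonzero vector of A/S, and adjoining a lift
  -- of it enlarges S at the cost of one more factor.
  let Q : Set (Submodule A A) := {S | ∃ n, ∀ l : List P, n ≤ l.length → ∀ s ∈ S,
    (l.map fun g => MonoidAlgebra.of (ZMod p) P g - 1).prod * s = 0}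
  have hA : Finite (Submodule A A) := inferInstance
  obtain ⟨S, hS⟩ := Q.toFinite.exists_maximal
    ⟨⊥, 0, fun l _ s hs => by rw [(Submodule.mem_bot A).1 hs, mul_zero]⟩
  obtain ⟨n, hn⟩ := hS.prop
  by_cases hT : S = ⊤
  · exact ⟨n, fun l hl => by simpa using hn l hl 1 (hT ▸ Submodule.mem_top)⟩
  exfalso
  let act : MulAction P (A ⧸ S) := MulAction.compHom _ (MonoidAlgebra.of (ZMod p) P)
  have hsmul : ∀ (g : P) (m : A ⧸ S), act.smul g m = MonoidAlgebra.of (ZMod p) P g • m :=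
    fun g m => rfl
  have : Finite (A ⧸ S) := Finite.of_surjective _ (Submodule.mkQ_surjective S)
  have : Nontrivial (A ⧸ S) := Submodule.Quotient.nontrivial_iff.2 hT
  obtain ⟨m₀, hm₀⟩ := exists_ne (0 : A ⧸ S)
  have hp0 : p • m₀ = 0 := by
    have : ((p : A) : A) = 0 := by
      rw [← map_natCast (algebraMap (ZMod p) A), ZMod.natCast_self, map_zero]
    rw [← Nat.cast_smul_eq_nsmul A, this, zero_smul]
  have hdvd : p ∣ Nat.card (A ⧸ S) := 
    (addOrderOf_eq_prime hp0 hm₀).symm.dvd.trans (addOrderOf_dvd_natCard m₀)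
  obtain ⟨b, hb, hb0⟩ := hP.exists_fixed_point_of_prime_dvd_card_of_fixed_point (A ⧸ S) hdvd
    (a := 0) (fun g => (hsmul g 0).trans (smul_zero _))
  obtain ⟨m, rfl⟩ := Submodule.mkQ_surjective S b
  have hm : m ∉ S := fun h => hb0 ((Submodule.Quotient.mk_eq_zero S).2 h).symm
  have hfix : ∀ g, (MonoidAlgebra.of (ZMod p) P g - 1) * m ∈ S := by
    intro g
    rw [← Submodule.Quotient.mk_eq_zero]
    have := hb g
    rw [sub_mul, one_mul, Submodule.Quotient.mk_sub, sub_eq_zero]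
    exact this
  -- Invariance passes from `m` to the whole left ideal `A m`, because (g - 1)h = (gh - 1) - (h -
  -- 1).
  have hfix' : ∀ (a : A) (g : P), (MonoidAlgebra.of (ZMod p) P g - 1) * (a * m) ∈ S := by
    intro a g
    induction a using MonoidAlgebra.induction_on with
    | of h =>
      have : (MonoidAlgebra.of (ZMod p) P g - 1) * (MonoidAlgebra.of (ZMod p) P h * m) =
          (MonoidAlgebra.of (ZMod p) P (g * h) - 1) * m -
            (MonoidAlgebra.of (ZMod p) P h - 1) * m := by
        rw [map_mul]; noncomm_ring
      rw [this]
      exact S.sub_mem (hfix _) (hfix _)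
    | add x y hx hy =>
      rw [add_mul, mul_add]
      exact S.add_mem hx hy
    | smul r x hx =>
      rw [smul_mul_assoc, mul_smul_comm, ← algebraMap_smul A r]
      exact S.smul_mem _ hx
  have hQ : S ⊔ Submodule.span A {m} ∈ Q := by
    refine ⟨n + 1, fun l hl s hs => ?_⟩
    obtain ⟨s₁, hs₁, s₂, hs₂, rfl⟩ := Submodule.mem_sup.1 hs
    obtain ⟨a, rfl⟩ := Submodule.mem_span_singleton.1 hs₂
    rcases List.eq_nil_or_concat l with rfl | ⟨l, g, rfl⟩
    · simp at hl
    rw [mul_add, hn _ (by omega) s₁ hs₁, zero_add, List.concat_eq_append, List.map_append,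
      List.prod_append, List.map_singleton, List.prod_singleton, mul_assoc]
    exact hn l (by simp at hl; omega) _ (hfix' a g)
  exact hm (hS.le_of_ge hQ le_sup_left
    (Submodule.mem_sup_right (Submodule.mem_span_singleton_self m)))

end GroupAlgebra

/-! ### Evaluation of series at nilpotent families -/

namespace MagnusAlgebra

variable {p d : ℕ} {A : Type*} [Ring A] [Algebra (ZMod p) A]

/-- The evaluation of a series at a family for which all words of length `> n` vanish. -/
def evalLinear (a : Fin d → A) (n : ℕ) : MagnusAlgebra p d →ₗ[ZMod p] A where
  toFun c := ∑ w ∈ wordsLE d n, c w • (w.map a).prod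
  map_add' b c := by simp [add_smul, Finset.sum_add_distrib]
  map_smul' r c := by simp [Finset.smul_sum, mul_smul]

theorem evalLinear_apply (a : Fin d → A) (n : ℕ) (c : MagnusAlgebra p d) :
    evalLinear a n c = ∑ w ∈ wordsLE d n, c w • (w.map a).prod := rfl

theorem continuous_evalLinear [TopologicalSpace A] [IsTopologicalRing A] (a : Fin d → A) (n : ℕ) :
    Continuous (evalLinear a n : MagnusAlgebra p d →ₗ[ZMod p] A) :=
  continuous_finsetSum _ fun w _ =>
    (continuous_of_discreteTopology (f := fun r : ZMod p => r • (w.map a).prod)).comp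
      (continuous_coeff w)

variable (a : Fin d → A) {n : ℕ} (hn : ∀ w : List (Fin d), n < w.length → (w.map a).prod = 0)

include hn in
theorem evalLinear_monomial (w : List (Fin d)) :
    evalLinear a n (monomial w : MagnusAlgebra p d) = (w.map a).prod := by
  simp only [evalLinear_apply, monomial_apply, ite_smul, one_smul, zero_smul]
  rw [Finset.sum_ite_eq']
  split_ifs with h
  · rfl
  · exact (hn w (by simpa using h)).symm

include hn in
-- Evaluation involves finitely many coefficients, so it is continuous for the discrete topology on
-- `A`, and multiplicativity extends from monomials by density, one variable at a time.
theorem evalLinear_mul (b c : MagnusAlgebra p d) :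
    evalLinear a n (b * c) = evalLinear a n b * evalLinear a n c := by
  let _ : TopologicalSpace A := ⊥
  have : DiscreteTopology A := ⟨rfl⟩
  have h1 : ∀ u, (evalLinear a n).comp (LinearMap.mulLeft (ZMod p) (monomial u)) =
      (LinearMap.mulLeft (ZMod p) (evalLinear a n (monomial u : MagnusAlgebra p d))).comp
        (evalLinear a n) := by
    intro u
    refine linearMap_ext ((continuous_evalLinear a n).comp (continuous_const_mul _))
      ((continuous_const_mul _).comp (continuous_evalLinear a n)) fun v => ?_
    simp [monomial_mul_monomial, evalLinear_monomial a hn]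
  have h2 : (evalLinear a n).comp (LinearMap.mulRight (ZMod p) c) =
      (LinearMap.mulRight (ZMod p) (evalLinear a n c)).comp (evalLinear a n) := by
    refine linearMap_ext ((continuous_evalLinear a n).comp (continuous_mul_const _))
      ((continuous_mul_const _).comp (continuous_evalLinear a n)) fun v => ?_
    exact LinearMap.congr_fun (h1 v) c
  exact LinearMap.congr_fun h2 b

/-- The evaluation of a series at a family for which all words of length `> n` vanish, as an
algebra homomorphism. -/
def eval : MagnusAlgebra p d →ₐ[ZMod p] A :=
  AlgHom.ofLinearMap (evalLinear a n)
    (by rw [← monomial_nil, evalLinear_monomial a hn]; simp) (evalLinear_mul a hn)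

theorem eval_monomial (w : List (Fin d)) : (eval a hn : MagnusAlgebra p d →ₐ[ZMod p] A)
    (monomial w) = (w.map a).prod := evalLinear_monomial a hn w

theorem eval_X (j : Fin d) : (eval a hn : MagnusAlgebra p d →ₐ[ZMod p] A) (X j) = a j := by
  simp [X, eval_monomial a hn]

theorem continuous_eval [TopologicalSpace A] [IsTopologicalRing A] :
    Continuous (eval a hn : MagnusAlgebra p d →ₐ[ZMod p] A) := continuous_evalLinear a n

theorem eval_eq_zero_of_mem_filtration {c : MagnusAlgebra p d} (hc : c ∈ filtration p d (n + 1)) :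
    eval a hn c = 0 := by
  refine Finset.sum_eq_zero fun w hw => ?_
  rw [mem_filtration.1 hc w (by simpa [Nat.lt_succ_iff] using hw), zero_smul]

end MagnusAlgebra

/-! ### Generation of free pro-`p` groups -/

section Generation

variable {p : ℕ} {F : Type*} [Group F] [TopologicalSpace F] [IsTopologicalGroup F]

theorem IsProP.exists_openNormalSubgroup_subset (hF : IsProP p F) {W : Set F} (hW : IsOpen W)
    (h1 : (1 : F) ∈ W) : ∃ U : OpenNormalSubgroup F, (U : Set F) ⊆ W := by
  have := hF.compactSpace
  have := hF.totallyDisconnectedSpace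
  exact ProfiniteGrp.exist_openNormalSubgroup_sub_open_nhds_of_one hW h1

theorem IsProP.finite_quotient (hF : IsProP p F) (U : OpenNormalSubgroup F) :
    Finite (F ⧸ U.toSubgroup) := by
  have := hF.compactSpace
  exact U.toSubgroup.quotient_finite_of_isOpen U.isOpen'

variable [Fact p.Prime]

/-- A finite p-group is nilpotent, so its maximal subgroups are normal. -/
theorem IsPGroup.exists_normal_ge_of_ne_top {P : Type*} [Group P] [Finite P] (hP : IsPGroup p P)
    {H : Subgroup P} (hH : H ≠ ⊤) : ∃ M : Subgroup P, M.Normal ∧ M ≠ ⊤ ∧ H ≤ M := by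
  have := hP.isNilpotent
  obtain h | ⟨M, hM, hHM⟩ := eq_top_or_exists_le_coatom H
  · exact absurd h hH
  · exact ⟨M, Subgroup.NormalizerCondition.normal_of_coatom M
      Group.normalizerCondition_of_isNilpotent hM, hM.1, hHM⟩

variable {d : ℕ} {x : Fin d → F}

/-- The generators of a free pro-`p` group generate it topologically. -/
theorem IsFreeProP.eq_top_of_isClosed (hF : IsFreeProP p x) {H : Subgroup F}
    (hH : IsClosed (H : Set F)) (hx : ∀ j, x j ∈ H) : H = ⊤ := by
  by_contra hne
  obtain ⟨y, hy⟩ : ∃ y, y ∉ H := by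
    by_contra! h
    exact hne (eq_top_iff.2 fun y _ => h y)
  -- The coset `y U` misses `H`, so `H` has a proper image in the finite p-group `F / U`.
  obtain ⟨U, hU⟩ := hF.toIsProP.exists_openNormalSubgroup_subset
    (W := {u | y * u ∉ H}) (hH.isOpen_compl.preimage (continuous_const_mul y)) (by simpa using hy)
  have := hF.toIsProP.finite_quotient U
  have hP := hF.isPGroup_quotient U
  have hmap : H.map (QuotientGroup.mk' U.toSubgroup) ≠ ⊤ := by
    intro h
    obtain ⟨z, hz, hzy⟩ : (y : F ⧸ U.toSubgroup) ∈ H.map (QuotientGroup.mk' U.toSubgroup) :=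
      h ▸ Subgroup.mem_top _
    have hzy' : y⁻¹ * z ∈ U.toSubgroup := QuotientGroup.eq.1 hzy.symm
    exact hU hzy' (by simpa using hz)
  obtain ⟨M, hM, hMtop, hle⟩ := hP.exists_normal_ge_of_ne_top hmap
  -- The universal property speaks only of finite groups in `Type`, hence the shrinking of the
  -- quotient.
  let Q := Shrink.{0} ((F ⧸ U.toSubgroup) ⧸ M)
  let _ : TopologicalSpace Q := ⊥
  have : DiscreteTopology Q := ⟨rfl⟩
  have hQ : IsPGroup p Q := (hP.to_quotient M).of_equiv Shrink.mulEquiv.symm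
  let q : F →* Q := (Shrink.mulEquiv.symm : _ ≃* Q).toMonoidHom.comp
    ((QuotientGroup.mk' M).comp (QuotientGroup.mk' U.toSubgroup))
  have hker : ∀ y, q y = 1 ↔ (y : F ⧸ U.toSubgroup) ∈ M := by
    intro y
    simp [q]
  have hq : Continuous q := by
    have : DiscreteTopology (F ⧸ U.toSubgroup) := QuotientGroup.discreteTopology U.isOpen'
    exact (continuous_of_discreteTopology (f := fun z : F ⧸ U.toSubgroup =>
      (Shrink.mulEquiv.symm : _ ≃* Q) (QuotientGroup.mk' M z))).comp QuotientGroup.continuous_mk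
  -- The quotient map kills every generator, so uniqueness makes it trivial, although its target is
  -- not.
  have huniq : (⟨q, hq⟩ : F →ₜ* Q) = 1 := by
    refine (hF.existsUnique_hom Q hQ fun _ => 1).unique (fun i => ?_) (fun i => rfl)
    exact (hker _).2 (hle ⟨x i, hx i, rfl⟩)
  refine hMtop (eq_top_iff.2 fun z _ => ?_)
  obtain ⟨y, rfl⟩ := QuotientGroup.mk_surjective z
  exact (hker y).1 (DFunLike.congr_fun huniq y)

/-- Two continuous homomorphisms on a free pro-`p` group that agree on the generators are equal. -/
theorem IsFreeProP.monoidHom_ext (hF : IsFreeProP p x) {N : Type*} [Monoid N] [TopologicalSpace N]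
    [T2Space N] {f g : F →* N} (hf : Continuous f) (hg : Continuous g)
    (h : ∀ j, f (x j) = g (x j)) : f = g := by
  have : f.eqLocus g = ⊤ := hF.eq_top_of_isClosed (isClosed_eq hf hg) h
  exact MonoidHom.eq_of_eqOn_top fun y _ => (this ▸ Subgroup.mem_top y : y ∈ f.eqLocus g)

/-- The constant coefficient is a continuous multiplicative map equal to 1 on the generators. -/
theorem IsFreeProP.magnus_nil (hF : IsFreeProP p x) (y : F) : hF.magnus y [] = 1 := by
  let ε : F →* ZMod p :=
    { toFun := fun y => hF.magnus y []
      map_one' := by simp [MagnusAlgebra.one_apply]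
      map_mul' := fun y z => by rw [map_mul, MagnusAlgebra.mul_nil] }
  have : ε = 1 := hF.monoidHom_ext
    ((MagnusAlgebra.continuous_coeff []).comp hF.continuous_magnus) continuous_const fun j => by
      simp [ε, hF.magnus_generator, MagnusAlgebra.one_apply, MagnusAlgebra.X,
        MagnusAlgebra.monomial]
  exact DFunLike.congr_fun this y

end Generation

end

noncomputable section

/-! ### Topology of completed group algebras -/

/-- The group algebras over `𝔽_p` of the finite quotients are discrete. -/
instance (p : ℕ) (P : Type*) : TopologicalSpace (MonoidAlgebra (ZMod p) P) := ⊥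

instance (p : ℕ) (P : Type*) : DiscreteTopology (MonoidAlgebra (ZMod p) P) := ⟨rfl⟩

namespace CompletedGroupAlgebra

variable {p : ℕ} {G : Type*} [Group G] [TopologicalSpace G]

@[ext] theorem ext {a b : CompletedGroupAlgebra p G} (h : ∀ V, proj p V a = proj p V b) : a = b :=
  Subtype.ext (funext h)

theorem continuous_rng_iff {Y : Type*} [TopologicalSpace Y] {f : Y → CompletedGroupAlgebra p G} :
    Continuous f ↔ ∀ V, Continuous fun y => proj p V (f y) := by
  rw [continuous_iInf_rng]
  exact forall_congr' fun V => continuous_induced_rng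

theorem continuous_proj (V : OpenNormalSubgroup G) :
    Continuous (proj p V : CompletedGroupAlgebra p G → _) :=
  continuous_rng_iff.1 continuous_id V

instance : T2Space (CompletedGroupAlgebra p G) where
  t2 a b hab := by
    obtain ⟨V, hV⟩ : ∃ V, proj p V a ≠ proj p V b := by
      by_contra! h
      exact hab (ext h)
    exact separated_by_continuous (continuous_proj V) hV

instance : IsTopologicalRing (CompletedGroupAlgebra p G) where
  continuous_add := continuous_rng_iff.2 fun V => by
    simp only [map_add]
    exact ((continuous_proj V).comp continuous_fst).add ((continuous_proj V).comp continuous_snd)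
  continuous_mul := continuous_rng_iff.2 fun V => by
    simp only [map_mul]
    exact ((continuous_proj V).comp continuous_fst).mul ((continuous_proj V).comp continuous_snd)
  continuous_neg := continuous_rng_iff.2 fun V => by
    simp only [map_neg]
    exact (continuous_proj V).neg

theorem proj_of (V : OpenNormalSubgroup G) (g : G) :
    proj p V (of p g) = MonoidAlgebra.of (ZMod p) (G ⧸ V.toSubgroup) g := rfl

theorem of_mul (g h : G) : of p (g * h) = of p g * of p h :=
  ext fun V => by simp only [map_mul, proj_of, QuotientGroup.mk_mul]

theorem of_one : of p (1 : G) = 1 :=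
  ext fun V => by simp only [map_one, proj_of, QuotientGroup.mk_one]

theorem mapDomain_proj (z : CompletedGroupAlgebra p G) {U V : OpenNormalSubgroup G} (h : U ≤ V) :
    MonoidAlgebra.mapDomainAlgHom (ZMod p) (ZMod p)
      (QuotientGroup.map U.toSubgroup V.toSubgroup (MonoidHom.id G) h) (proj p U z) = proj p V z :=
  z.2 U V h

variable {F : Type*} [Group F] [TopologicalSpace F] (π : F →ₜ* G)

theorem proj_map (V : OpenNormalSubgroup G) (z : CompletedGroupAlgebra p F) :
    proj p V (map p π z) = MonoidAlgebra.mapDomainAlgHom (ZMod p) (ZMod p)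
        (QuotientGroup.map (comapOpenNormal π V).toSubgroup V.toSubgroup (π : F →* G) le_rfl)
          (proj p (comapOpenNormal π V) z) := rfl

theorem map_of (y : F) : map p π (of p y) = of p (π y) :=
  ext fun V => by
    rw [proj_map, proj_of, proj_of, MonoidAlgebra.of_apply, MonoidAlgebra.mapDomainAlgHom_apply,
      MonoidAlgebra.mapDomain_single]
    rfl

theorem continuous_map : Continuous (map p π) :=
  continuous_rng_iff.2 fun V => by
    simp only [proj_map]
    exact continuous_of_discreteTopology.comp (continuous_proj _)

/-- A continuous function from a compact group to a discrete space is invariant under right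
translation by an open normal subgroup, if such subgroups form a neighborhood basis of `1`. -/
theorem exists_openNormalSubgroup_forall_mul_eq [IsTopologicalGroup G] (hG : IsProP p G)
    {Y : Type*} [TopologicalSpace Y] [DiscreteTopology Y] {f : G → Y} (hf : Continuous f) :
    ∃ V : OpenNormalSubgroup G, ∀ g, ∀ v ∈ V.toSubgroup, f (g * v) = f g := by
  have := hG.compactSpace
  have h1 : ∀ᶠ v in nhds (1 : G), ∀ g ∈ (Set.univ : Set G), f (g * v) = f g := by
    refine isCompact_univ.eventually_forall_of_forall_eventually fun g _ => ?_
    have ho : IsOpen {z : G × G | f (z.2 * z.1) = f z.2} := by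
      have hc : Continuous fun z : G × G => (f (z.2 * z.1), f z.2) := by fun_prop
      exact (isOpen_discrete {q : Y × Y | q.1 = q.2}).preimage hc
    exact ho.mem_nhds (by simp)
  obtain ⟨W, hW, hWo, hW1⟩ := mem_nhds_iff.1 h1
  obtain ⟨V, hV⟩ := hG.exists_openNormalSubgroup_subset hWo hW1
  exact ⟨V, fun g v hv => hW (hV hv) g trivial⟩

/-- A continuous function from `G` to a discrete `𝔽_p`-vector space extends to a continuous linear
map on `Λ_G`. -/
theorem exists_linearMap_of_continuous [IsTopologicalGroup G] (hG : IsProP p G)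
    {Y : Type*} [AddCommGroup Y] [Module (ZMod p) Y] [TopologicalSpace Y] [DiscreteTopology Y]
    {f : G → Y} (hf : Continuous f) :
    ∃ L : CompletedGroupAlgebra p G →ₗ[ZMod p] Y, Continuous L ∧ ∀ g, L (of p g) = f g := by
  obtain ⟨V, hV⟩ := exists_openNormalSubgroup_forall_mul_eq hG hf
  let f' : G ⧸ V.toSubgroup → Y := Quotient.lift f fun a b hab => by
    have := hV a _ (QuotientGroup.leftRel_apply.1 hab)
    simpa using this.symm
  let L : MonoidAlgebra (ZMod p) (G ⧸ V.toSubgroup) →ₗ[ZMod p] Y :=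
    (Finsupp.linearCombination (ZMod p) f').comp
      (MonoidAlgebra.coeffLinearEquiv (ZMod p)).toLinearMap
  refine ⟨L.comp (proj p V).toLinearMap,
    (continuous_of_discreteTopology (f := L)).comp (continuous_proj V), fun g => ?_⟩
  change L (proj p V (of p g)) = f g
  rw [proj_of, MonoidAlgebra.of_apply]
  change Finsupp.linearCombination (ZMod p) f' (MonoidAlgebra.single _ 1).coeff = _
  rw [MonoidAlgebra.coeff_single, Finsupp.linearCombination_single, one_smul]
  rfl

end CompletedGroupAlgebra

/-! ### The homomorphism from the Magnus algebra to the completed group algebra -/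

namespace IsFreeProP

open MagnusAlgebra CompletedGroupAlgebra

variable {p d : ℕ} [Fact p.Prime] {F : Type*} [Group F] [TopologicalSpace F]
  [IsTopologicalGroup F] {x : Fin d → F} (hF : IsFreeProP p x)

include hF in
/-- A closed subspace containing the Magnus image of the group is the whole algebra. -/
theorem eq_top_of_magnus_mem {T : Submodule (ZMod p) (MagnusAlgebra p d)}
    (hT : IsClosed (T : Set (MagnusAlgebra p d))) (h : ∀ y, hF.magnus y ∈ T) : T = ⊤ := by
  -- Since X_j φ(y) = φ(x_j y) - φ(y), induction on the word shows that every X_w φ(y) lies in `T`;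
  -- taking y = 1 gives the monomials, which are dense.
  have hm : ∀ (w : List (Fin d)) (y : F), monomial w * hF.magnus y ∈ T := by
    intro w
    induction w using List.reverseRecOn with
    | nil => simpa [monomial_nil] using h
    | append_singleton w j ih =>
      intro y
      have : (monomial (w ++ [j]) : MagnusAlgebra p d) * hF.magnus y =
          monomial w * hF.magnus (x j * y) - monomial w * hF.magnus y := by
        rw [← monomial_mul_X, map_mul, hF.magnus_generator]
        noncomm_ring
      rw [this]
      exact T.sub_mem (ih _) (ih _)
  refine eq_top_iff.2 fun c _ => ?_
  exact map_mem_of_monomial LinearMap.id continuous_id T hT Set.univ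
    (fun w _ => by simpa using hm w 1) (by simp)

theorem linearMap_ext_magnus {Y : Type*} [AddCommGroup Y] [Module (ZMod p) Y] [TopologicalSpace Y]
    [T2Space Y] {L L' : MagnusAlgebra p d →ₗ[ZMod p] Y} (hL : Continuous L) (hL' : Continuous L')
    (h : ∀ y, L (hF.magnus y) = L' (hF.magnus y)) : L = L' :=
  LinearMap.eqLocus_eq_top.1 (hF.eq_top_of_magnus_mem (T := LinearMap.eqLocus L L')
    (isClosed_eq hL hL') h)

variable {G : Type*} [Group G] [TopologicalSpace G] [IsTopologicalGroup G] (hG : IsProP p G)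
  (π : F →ₜ* G)

include hG in
theorem exists_prod_sub_one_eq_zero (V : OpenNormalSubgroup G) (g : Fin d → G) :
    ∃ n, ∀ w : List (Fin d), n < w.length → (w.map fun j =>
      MonoidAlgebra.of (ZMod p) (G ⧸ V.toSubgroup) (g j : G ⧸ V.toSubgroup) - 1).prod = 0 := by
  have := hG.finite_quotient V
  obtain ⟨n, hn⟩ := (hG.isPGroup_quotient V).exists_prod_of_sub_one_eq_zero
  refine ⟨n, fun w hw => ?_⟩
  have := hn (w.map fun j => (g j : G ⧸ V.toSubgroup)) (by simpa using hw.le)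
  rwa [List.map_map] at this

/-- The homomorphism `E → 𝔽_p[G/V]`, `1 + X_j ↦ π(x_j)`. -/
def magnusQuotient (x : Fin d → F) (V : OpenNormalSubgroup G) :
    MagnusAlgebra p d →ₐ[ZMod p] MonoidAlgebra (ZMod p) (G ⧸ V.toSubgroup) :=
  eval _ (exists_prod_sub_one_eq_zero hG V fun j => π (x j)).choose_spec

omit [IsTopologicalGroup F] in
theorem continuous_magnusQuotient (V : OpenNormalSubgroup G) :
    Continuous (magnusQuotient hG π x V) := continuous_eval _ _

theorem magnusQuotient_magnus (V : OpenNormalSubgroup G) (y : F) :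
    magnusQuotient hG π x V (hF.magnus y) =
      MonoidAlgebra.of (ZMod p) (G ⧸ V.toSubgroup) (π y : G ⧸ V.toSubgroup) := by
  have : DiscreteTopology (G ⧸ V.toSubgroup) := QuotientGroup.discreteTopology V.isOpen'
  refine DFunLike.congr_fun (hF.monoidHom_ext
    (f := (magnusQuotient hG π x V : MagnusAlgebra p d →* _).comp hF.magnus)
    (g := (MonoidAlgebra.of (ZMod p) (G ⧸ V.toSubgroup)).comp
      ((QuotientGroup.mk' V.toSubgroup).comp (π : F →* G))) ?_ ?_ ?_) y
  · exact (continuous_magnusQuotient hG π V).comp hF.continuous_magnus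
  · exact (continuous_of_discreteTopology (f := MonoidAlgebra.of (ZMod p) (G ⧸ V.toSubgroup))).comp
      (QuotientGroup.continuous_mk.comp π.continuous_toFun)
  · intro j
    change magnusQuotient hG π x V (hF.magnus (x j)) = MonoidAlgebra.of _ _ _
    rw [hF.magnus_generator, map_add, map_one, magnusQuotient, eval_X, add_sub_cancel]
    rfl

/-- The homomorphism `ψ : E → Λ_G` corresponding to `Λ_F → Λ_G` under the Magnus isomorphism. -/
def toCompleted : MagnusAlgebra p d →ₐ[ZMod p] CompletedGroupAlgebra p G :=
  AlgHom.codRestrict (AlgHom.pi fun V => magnusQuotient hG π x V)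
    (completedGroupSubalgebra p G) (by
      intro c U V h
      change ((MonoidAlgebra.mapDomainAlgHom (ZMod p) (ZMod p) _).toLinearMap.comp
        (magnusQuotient hG π x U).toLinearMap) c = (magnusQuotient hG π x V).toLinearMap c
      congr 1
      refine hF.linearMap_ext_magnus
        ((continuous_of_discreteTopology (f := MonoidAlgebra.mapDomainAlgHom (ZMod p) (ZMod p)
          (QuotientGroup.map U.toSubgroup V.toSubgroup (MonoidHom.id G) h))).comp
          (continuous_magnusQuotient hG π U))
        (continuous_magnusQuotient hG π V) fun y => ?_
      simp only [LinearMap.comp_apply, AlgHom.toLinearMap_apply, hF.magnusQuotient_magnus]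
      rw [MonoidAlgebra.of_apply, MonoidAlgebra.mapDomainAlgHom_apply,
        MonoidAlgebra.mapDomain_single]
      rfl)

theorem proj_toCompleted (V : OpenNormalSubgroup G) (c : MagnusAlgebra p d) :
    proj p V (hF.toCompleted hG π c) = magnusQuotient hG π x V c := rfl

theorem continuous_toCompleted : Continuous (hF.toCompleted hG π) :=
  continuous_rng_iff.2 fun V => continuous_magnusQuotient hG π V

theorem toCompleted_magnus (y : F) : hF.toCompleted hG π (hF.magnus y) = of p (π y) :=
  CompletedGroupAlgebra.ext fun V => by
    rw [proj_toCompleted, hF.magnusQuotient_magnus, proj_of]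

/-- Each map to 𝔽_p[G/V] is surjective, and the fibres over a compatible family are nonempty, closed
and directed in the compact space E, so they have a common point. -/
theorem toCompleted_surjective (hπ : Function.Surjective π) :
    Function.Surjective (hF.toCompleted hG π) := by
  intro z
  have hsurj : ∀ V, Function.Surjective (magnusQuotient hG π x V) := by
    intro V q
    induction q using MonoidAlgebra.induction_on with
    | of g =>
      obtain ⟨g, rfl⟩ := QuotientGroup.mk_surjective g
      obtain ⟨y, rfl⟩ := hπ g
      exact ⟨_, hF.magnusQuotient_magnus hG π V y⟩
    | add a b ha hb =>
      obtain ⟨a, rfl⟩ := ha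
      obtain ⟨b, rfl⟩ := hb
      exact ⟨a + b, map_add _ a b⟩
    | smul r a ha =>
      obtain ⟨a, rfl⟩ := ha
      exact ⟨r • a, map_smul _ r a⟩
  let C : OpenNormalSubgroup G → Set (MagnusAlgebra p d) :=
    fun V => {c | magnusQuotient hG π x V c = proj p V z}
  have hC : ∀ V, IsClosed (C V) := fun V =>
    isClosed_eq (continuous_magnusQuotient hG π V) continuous_const
  have hmono : ∀ U V : OpenNormalSubgroup G, U ≤ V → C U ⊆ C V := by
    intro U V h c hc
    change magnusQuotient hG π x V c = _
    rw [← hF.proj_toCompleted, ← mapDomain_proj _ h, ← mapDomain_proj z h, proj_toCompleted]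
    exact congrArg _ hc
  have : Nonempty (OpenNormalSubgroup G) :=
    ⟨{ toSubgroup := ⊤, isOpen' := isOpen_univ, isNormal' := inferInstance }⟩
  obtain ⟨c, hc⟩ := IsCompact.nonempty_iInter_of_directed_nonempty_isCompact_isClosed C
    (fun U V => ⟨U ⊓ V, hmono _ _ inf_le_left, hmono _ _ inf_le_right⟩)
    (fun V => hsurj V _) (fun V => (hC V).isCompact) hC
  exact ⟨c, CompletedGroupAlgebra.ext fun V => Set.mem_iInter.1 hc V⟩

/-! #### The Magnus isomorphism -/

theorem magnusLinear_apply (z : CompletedGroupAlgebra p F) (w : List (Fin d)) :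
    hF.magnusLinear z w = truncCoeff (w.length + 1) w (Nat.lt_succ_self _)
      (MonoidAlgebra.lift (ZMod p) (Trunc p d (w.length + 1)) _
        (QuotientGroup.lift (hF.zassenhaus (w.length + 1)).toSubgroup
          (hF.magnusTrunc (w.length + 1)) le_rfl)
            (proj p (hF.zassenhaus (w.length + 1)) z)) := rfl

theorem magnusLinear_of (y : F) : hF.magnusLinear (of p y) = hF.magnus y := by
  ext w
  rw [magnusLinear_apply, proj_of, MonoidAlgebra.lift_of]
  rfl

theorem continuous_magnusLinear : Continuous hF.magnusLinear :=
  continuous_iff_coeff.2 fun w => by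
    simp only [magnusLinear_apply]
    exact (continuous_of_discreteTopology (f := fun q => truncCoeff (w.length + 1) w
      (Nat.lt_succ_self _) (MonoidAlgebra.lift (ZMod p) (Trunc p d (w.length + 1)) _
        (QuotientGroup.lift (hF.zassenhaus (w.length + 1)).toSubgroup
          (hF.magnusTrunc (w.length + 1)) le_rfl) q))).comp (continuous_proj _)

theorem magnusLinear_toCompleted (c : MagnusAlgebra p d) :
    hF.magnusLinear (hF.toCompleted hF.toIsProP (ContinuousMonoidHom.id F) c) = c := by
  refine LinearMap.congr_fun (hF.linearMap_ext_magnus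
    (L := hF.magnusLinear.comp (hF.toCompleted hF.toIsProP (ContinuousMonoidHom.id F)).toLinearMap)
    (L' := LinearMap.id)
    (hF.continuous_magnusLinear.comp (hF.continuous_toCompleted _ _)) continuous_id fun y => ?_) c
  change hF.magnusLinear (hF.toCompleted hF.toIsProP (ContinuousMonoidHom.id F) (hF.magnus y)) = _
  rw [toCompleted_magnus]
  exact hF.magnusLinear_of y

theorem map_toCompleted (c : MagnusAlgebra p d) :
    CompletedGroupAlgebra.map p π
      (hF.toCompleted hF.toIsProP (ContinuousMonoidHom.id F) c) = hF.toCompleted hG π c := by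
  refine LinearMap.congr_fun (hF.linearMap_ext_magnus
    (L := (CompletedGroupAlgebra.map p π).toLinearMap.comp
      (hF.toCompleted hF.toIsProP (ContinuousMonoidHom.id F)).toLinearMap)
    (L' := (hF.toCompleted hG π).toLinearMap)
    ((continuous_map π).comp (hF.continuous_toCompleted _ _))
    (hF.continuous_toCompleted hG π) fun y => ?_) c
  change CompletedGroupAlgebra.map p π
    (hF.toCompleted hF.toIsProP (ContinuousMonoidHom.id F) (hF.magnus y)) =
      hF.toCompleted hG π (hF.magnus y)
  rw [toCompleted_magnus, toCompleted_magnus]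
  exact map_of π y

/-- The identification of Λ_F with E allows Λ_F to be forgotten: only the surjection E → Λ_G and the
degree filtration of E matter from here on. -/
theorem inducedFiltration_eq (n : ℕ) :
    inducedFiltration hF π n = (filtration p d n).map (hF.toCompleted hG π).toLinearMap := by
  ext z
  constructor
  · rintro ⟨y, hy, rfl⟩
    obtain ⟨c, rfl⟩ := hF.toCompleted_surjective hF.toIsProP (ContinuousMonoidHom.id F)
      Function.surjective_id y
    refine ⟨c, ?_, (hF.map_toCompleted hG π c).symm⟩
    have : hF.magnusLinear _ ∈ filtration p d n := hy
    rwa [magnusLinear_toCompleted] at this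
  · rintro ⟨c, hc, rfl⟩
    refine ⟨hF.toCompleted hF.toIsProP (ContinuousMonoidHom.id F) c, ?_, hF.map_toCompleted hG π c⟩
    change hF.magnusLinear _ ∈ filtration p d n
    rwa [magnusLinear_toCompleted]

end IsFreeProP

end

noncomputable section

/-! ### Generators of the relation module -/

/-- The p-th power map is surjective on the abelianization, hence injective by finiteness; a p-group
with this property is trivial. So `P` is perfect, and being nilpotent it is trivial. -/
theorem IsPGroup.subsingleton_of_closure_pow_sup_commutator {p : ℕ} [Fact p.Prime] {P : Type*}
    [Group P] [Finite P] (hP : IsPGroup p P)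
    (h : Subgroup.closure (Set.range fun r : P => r ^ p) ⊔ commutator P = ⊤) : Subsingleton P := by
  by_contra hns
  rw [not_subsingleton_iff_nontrivial] at hns
  have := hP.isNilpotent
  have hlt := Group.IsSolvable.commutator_lt_top_of_nontrivial P
  have hrange : (powMonoidHom p : Abelianization P →* Abelianization P).range = ⊤ := by
    rw [eq_top_iff, ← Subgroup.map_top_of_surjective (Abelianization.of (G := P))
      QuotientGroup.mk_surjective, ← h, Subgroup.map_sup, sup_le_iff]
    constructor
    · rw [Subgroup.map_le_iff_le_comap, Subgroup.closure_le]
      rintro _ ⟨r, rfl⟩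
      exact ⟨Abelianization.of r, by simp⟩
    · rw [Subgroup.map_le_iff_le_comap, ← Abelianization.ker_of P]
      exact fun r hr => Subgroup.mem_comap.2 ((MonoidHom.mem_ker.1 hr) ▸ one_mem _)
  have hinj : Function.Injective (powMonoidHom p : Abelianization P →* Abelianization P) :=
    Finite.injective_iff_surjective.2 (MonoidHom.range_eq_top.1 hrange)
  have htriv : ∀ (k : ℕ) (a : Abelianization P), a ^ p ^ k = 1 → a = 1 := by
    intro k
    induction k with
    | zero => intro a ha; simpa using ha
    | succ k ih =>
      intro a ha
      rw [pow_succ, pow_mul] at ha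
      exact ih a (hinj (by simpa using ha))
  refine hlt.ne (eq_top_iff.2 fun r _ => ?_)
  rw [← Abelianization.ker_of P, MonoidHom.mem_ker]
  obtain ⟨k, hk⟩ := hP r
  exact htriv k _ (by rw [← map_pow, hk, map_one])

section Relations

variable {p : ℕ} {R : Type*} [Group R] [TopologicalSpace R] [IsTopologicalGroup R]

namespace RelationModule

theorem mk_mul (r s : R) : mk p (r * s) = mk p r + mk p s := rfl

theorem mk_inv (r : R) : mk p r⁻¹ = -mk p r := rfl

theorem mk_surjective : Function.Surjective (mk p : R → RelationModule p R) :=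
  QuotientGroup.mk_surjective

theorem isQuotientMap_mk : Topology.IsQuotientMap (mk p : R → RelationModule p R) :=
  QuotientGroup.isQuotientMap_mk _

theorem mk_eq_mk {r s : R} : mk p r = mk p s ↔ r⁻¹ * s ∈ pCommutator p R := QuotientGroup.eq

theorem mk_eq_zero {r : R} : mk p r = 0 ↔ r ∈ pCommutator p R :=
  (QuotientGroup.eq_one_iff r)

end RelationModule

/-- An open subgroup of a topological group that together with `R^p[R,R]` generates `R` maps onto
every finite `p`-group quotient having it in the kernel. -/
theorem ker_eq_top_of_sup_pCommutator_eq_top [Fact p.Prime] {P : Type*} [Group P] [Finite P]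
    (hP : IsPGroup p P) {f : R →* P} (hf : IsOpen (f.ker : Set R))
    (h : f.ker ⊔ pCommutator p R = ⊤) : f.ker = ⊤ := by
  -- The subgroup on the right contains an open subgroup, so it is closed and absorbs the closure in
  -- the definition of R^p[R,R].
  have hle : pCommutator p R ≤
      f.ker ⊔ (Subgroup.closure (Set.range fun r : R => r ^ p) ⊔ commutator R) := by
    refine Subgroup.topologicalClosure_minimal _ le_sup_right ?_
    exact Subgroup.isClosed_of_isOpen _ (Subgroup.isOpen_mono le_sup_left hf)
  have htop : Subgroup.closure (Set.range fun r : f.range => r ^ p) ⊔ commutator f.range = ⊤ := by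
    rw [eq_top_iff, ← Subgroup.map_top_of_surjective f.rangeRestrict f.rangeRestrict_surjective,
      ← h]
    refine (Subgroup.map_mono (sup_le le_sup_left hle)).trans ?_
    rw [Subgroup.map_sup, Subgroup.map_sup, sup_le_iff, sup_le_iff]
    refine ⟨?_, ?_, ?_⟩
    · rw [Subgroup.map_le_iff_le_comap]
      intro r hr
      have : f.rangeRestrict r = 1 := Subtype.ext hr
      rw [Subgroup.mem_comap, this]
      exact one_mem _
    · rw [Subgroup.map_le_iff_le_comap, Subgroup.closure_le]
      rintro _ ⟨r, rfl⟩
      exact (le_sup_left : _ ≤ Subgroup.closure (Set.range fun r : f.range => r ^ p) ⊔ _)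
        (Subgroup.subset_closure ⟨f.rangeRestrict r, by simp⟩)
    · refine le_trans ?_ le_sup_right
      rw [map_commutator_eq]
      exact Subgroup.commutator_mono le_top le_top
  have hs := (hP.to_subgroup f.range).subsingleton_of_closure_pow_sup_commutator htop
  refine eq_top_iff.2 fun r _ => ?_
  exact congrArg Subtype.val (Subsingleton.elim (f.rangeRestrict r) 1)

variable {F : Type*} [Group F] [TopologicalSpace F] [IsTopologicalGroup F] [Fact p.Prime]
  {G : Type*} [Group G] [TopologicalSpace G] {π : F →ₜ* G} {I : Type*} {ρ : I → (π : F →* G).ker}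

/-- If the classes of `ρ` generate the relation module, then every open normal subgroup of `F`
containing the `ρ_i` contains all relations. -/
theorem IsProP.ker_le_of_mem (hF : IsProP p F) (hρ : Dense (AddSubgroup.closure
      {m | ∃ (y : F) (i : I), m = RelationModule.mk p (MulAut.conjNormal y (ρ i))} :
        Set (RelationModule p (π : F →* G).ker)))
    (U : OpenNormalSubgroup F) (hU : ∀ i, (ρ i : F) ∈ U.toSubgroup) :
    (π : F →* G).ker ≤ U.toSubgroup := by
  have := hF.finite_quotient U
  let f : (π : F →* G).ker →* F ⧸ U.toSubgroup :=
    (QuotientGroup.mk' U.toSubgroup).comp (π : F →* G).ker.subtype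
  have hfker : ∀ r, r ∈ f.ker ↔ (r : F) ∈ U.toSubgroup := fun r => QuotientGroup.eq_one_iff _
  have hopen : IsOpen (f.ker : Set (π : F →* G).ker) := by
    have : (f.ker : Set (π : F →* G).ker) = Subtype.val ⁻¹' (U.toSubgroup : Set F) :=
      Set.ext hfker
    rw [this]
    exact U.isOpen'.preimage continuous_subtype_val
  -- Since `K` is closed and contains R^p[R,R], its image in the relation module is a closed
  -- subgroup. It contains the generators because `U` is normal, so density gives `K = ⊤`, and the
  -- Frattini argument removes R^p[R,R].
  let K := f.ker ⊔ pCommutator p (π : F →* G).ker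
  have hK : IsClosed (K : Set (π : F →* G).ker) :=
    Subgroup.isClosed_of_isOpen _ (Subgroup.isOpen_mono le_sup_left hopen)
  let A : AddSubgroup (RelationModule p (π : F →* G).ker) :=
    { carrier := RelationModule.mk p '' K
      zero_mem' := ⟨1, one_mem _, rfl⟩
      add_mem' := by
        rintro _ _ ⟨r, hr, rfl⟩ ⟨s, hs, rfl⟩
        exact ⟨r * s, mul_mem hr hs, rfl⟩
      neg_mem' := by
        rintro _ ⟨r, hr, rfl⟩
        exact ⟨r⁻¹, inv_mem hr, rfl⟩ }
  have hmem : ∀ r, RelationModule.mk p r ∈ A ↔ r ∈ K := by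
    refine fun r => ⟨?_, fun h => ⟨r, h, rfl⟩⟩
    rintro ⟨s, hs, hsr⟩
    have h1 := RelationModule.mk_eq_mk.1 hsr
    have h2 : s⁻¹ * r ∈ K := (le_sup_right : _ ≤ K) h1
    simpa using mul_mem hs h2
  have hA : IsClosed (A : Set (RelationModule p (π : F →* G).ker)) := by
    rw [← RelationModule.isQuotientMap_mk.isClosed_preimage]
    convert hK using 1
    exact Set.ext hmem
  have hle : AddSubgroup.closure
      {m | ∃ (y : F) (i : I), m = RelationModule.mk p (MulAut.conjNormal y (ρ i))} ≤ A := by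
    rw [AddSubgroup.closure_le]
    rintro _ ⟨y, i, rfl⟩
    refine (hmem _).2 ((le_sup_left : _ ≤ K) ((hfker _).2 ?_))
    rw [MulAut.conjNormal_apply]
    exact U.isNormal'.conj_mem _ (hU i) y
  have htop : K = ⊤ := by
    refine eq_top_iff.2 fun r _ => (hmem r).1 ?_
    exact hA.closure_subset_iff.2 hle (hρ (RelationModule.mk p r))
  have := ker_eq_top_of_sup_pCommutator_eq_top (hF.isPGroup_quotient U) hopen htop
  intro r hr
  exact (hfker ⟨r, hr⟩).1 (this ▸ Subgroup.mem_top _)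

end Relations

/-! ### The kernel of `E → Λ_G` -/

namespace FreeRelators

open MagnusAlgebra

variable {p d : ℕ} [Fact p.Prime] {I : Type*} (S : FreeRelators p d I)
  {F : Type*} [Group F] [TopologicalSpace F] [IsTopologicalGroup F] {x : Fin d → F}
  (hF : IsFreeProP p x)

/-- The subspace `J + E_n`. -/
def idealSup (n : ℕ) : Submodule (ZMod p) (MagnusAlgebra p d) := S.ideal ⊔ filtration p d n

theorem mul_mem_idealSup_left {n : ℕ} (a : MagnusAlgebra p d) {b : MagnusAlgebra p d}
    (hb : b ∈ S.idealSup n) : a * b ∈ S.idealSup n := by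
  obtain ⟨g, hg, c, hc, rfl⟩ := Submodule.mem_sup.1 hb
  rw [mul_add]
  refine Submodule.add_mem_sup (S.mul_mem_ideal_left a hg) ?_
  simpa using mul_mem_filtration (m := 0) (mem_filtration.2 (by simp)) hc

theorem mul_mem_idealSup_right {n : ℕ} {a : MagnusAlgebra p d} (ha : a ∈ S.idealSup n)
    (b : MagnusAlgebra p d) : a * b ∈ S.idealSup n := by
  obtain ⟨g, hg, c, hc, rfl⟩ := Submodule.mem_sup.1 ha
  rw [add_mul]
  refine Submodule.add_mem_sup (S.mul_mem_ideal_right hg b) ?_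
  simpa using mul_mem_filtration (n := 0) hc (mem_filtration.2 (by simp))

/-- Taking coordinates preserves degrees, so the coordinate at a normal word w is unaffected by a
perturbation in E_n with n > |w|. -/
theorem mem_ideal_of_forall_mem_idealSup {a : MagnusAlgebra p d} (h : ∀ n, a ∈ S.idealSup n) :
    a ∈ S.ideal := by
  rw [mem_ideal]
  intro w hw
  obtain ⟨g, hg, c, hc, rfl⟩ := Submodule.mem_sup.1 (h (w.length + 1))
  rw [map_add, add_apply, S.mem_ideal.1 hg w hw, zero_add]
  exact mem_filtration.1 (S.coord_mem_filtration hc) w (Nat.lt_succ_self _)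

theorem isOpen_filtration (n : ℕ) : IsOpen (filtration p d n : Set (MagnusAlgebra p d)) := by
  have : (filtration p d n : Set (MagnusAlgebra p d)) =
      ⋂ w ∈ {w : List (Fin d) | w.length < n}, (fun a : MagnusAlgebra p d => a w) ⁻¹' {0} := by
    ext a
    simp [mem_filtration]
  rw [this]
  exact (List.finite_length_lt (Fin d) n).isOpen_biInter fun w _ =>
    (isOpen_discrete _).preimage (continuous_coeff w)

theorem isOpen_idealSup (n : ℕ) : IsOpen (S.idealSup n : Set (MagnusAlgebra p d)) :=
  AddSubgroup.isOpen_mono (H₁ := (filtration p d n).toAddSubgroup)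
    (H₂ := (S.idealSup n).toAddSubgroup) (le_sup_right : _ ≤ S.idealSup n) (isOpen_filtration n)

/-- The open normal subgroup of the elements congruent to `1` modulo `J + E_n`. -/
def congruenceSubgroup (n : ℕ) : OpenNormalSubgroup F where
  carrier := {y | hF.magnus y - 1 ∈ S.idealSup n}
  one_mem' := by simp
  mul_mem' {y z} hy hz := by
    have h : hF.magnus (y * z) - 1 = (hF.magnus y - 1) * hF.magnus z + (hF.magnus z - 1) := by
      rw [map_mul]; noncomm_ring
    rw [Set.mem_ofPred_eq, h]
    exact add_mem (S.mul_mem_idealSup_right hy _) hz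
  inv_mem' {y} hy := by
    have h : hF.magnus y⁻¹ - 1 = -(hF.magnus y⁻¹ * (hF.magnus y - 1)) := by
      rw [mul_sub, ← map_mul, inv_mul_cancel, map_one]; noncomm_ring
    rw [Set.mem_ofPred_eq, h]
    exact neg_mem (S.mul_mem_idealSup_left _ hy)
  isOpen' := (S.isOpen_idealSup n).preimage (hF.continuous_magnus.sub continuous_const)
  isNormal' := ⟨fun y hy z => by
    have h : hF.magnus (z * y * z⁻¹) - 1 = hF.magnus z * (hF.magnus y - 1) * hF.magnus z⁻¹ := by
      rw [mul_sub, sub_mul, mul_one, ← map_mul, ← map_mul, ← map_mul, mul_inv_cancel, map_one]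
    change hF.magnus (z * y * z⁻¹) - 1 ∈ S.idealSup n
    rw [h]
    exact S.mul_mem_idealSup_right (S.mul_mem_idealSup_left _ hy) _⟩

variable {G : Type*} [Group G] [TopologicalSpace G] {π : F →ₜ* G} {ρ : I → (π : F →* G).ker}

/-- The Magnus image of a relation lies in `1 + J`. -/
theorem magnus_sub_one_mem_ideal (hS : ∀ i, S.rel i = hF.magnus (ρ i) - 1)
    (hρ : Dense (AddSubgroup.closure
      {m | ∃ (y : F) (i : I), m = RelationModule.mk p (MulAut.conjNormal y (ρ i))} :
        Set (RelationModule p (π : F →* G).ker))) {r : F} (hr : r ∈ (π : F →* G).ker) :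
    hF.magnus r - 1 ∈ S.ideal := by
  refine S.mem_ideal_of_forall_mem_idealSup fun n => ?_
  -- The elements congruent to 1 modulo J + E_n form an open normal subgroup containing every ρ_i,
  -- hence all of R.
  refine hF.toIsProP.ker_le_of_mem hρ (S.congruenceSubgroup hF n) (fun i => ?_) hr
  change hF.magnus (ρ i) - 1 ∈ S.idealSup n
  rw [← hS]
  exact (le_sup_left : _ ≤ S.idealSup n) (S.rel_mem_ideal i)

variable [IsTopologicalGroup G] (hG : IsProP p G)

/-- The kernel of `E → Λ_G` is the ideal generated by the relators. -/
theorem toCompleted_eq_zero_iff (hπ : Function.Surjective π)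
    (hS : ∀ i, S.rel i = hF.magnus (ρ i) - 1)
    (hρ : Dense (AddSubgroup.closure
      {m | ∃ (y : F) (i : I), m = RelationModule.mk p (MulAut.conjNormal y (ρ i))} :
        Set (RelationModule p (π : F →* G).ker))) {c : MagnusAlgebra p d} :
    hF.toCompleted hG π c = 0 ↔ c ∈ S.ideal := by
  have hrel : ∀ i, hF.toCompleted hG π (S.rel i) = 0 := by
    intro i
    have h1 : π (ρ i : F) = 1 := (ρ i).2
    rw [hS, map_sub, hF.toCompleted_magnus, map_one, h1, CompletedGroupAlgebra.of_one, sub_self]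
  constructor
  · intro hc
    refine S.mem_ideal_of_forall_mem_idealSup fun n => ?_
    -- The map y ↦ φ(y) modulo J + E_n is trivial on R, so it descends to a continuous function on G
    -- and then extends to Λ_G. Thus E → E/(J + E_n) factors through Λ_G and kills the kernel of E →
    -- Λ_G.
    let Y := MagnusAlgebra p d ⧸ S.idealSup n
    let _ : TopologicalSpace Y := ⊥
    have : DiscreteTopology Y := ⟨rfl⟩
    let f : G → Y := fun g => (S.idealSup n).mkQ (hF.magnus (Function.surjInv hπ g))
    have hmk : Continuous (S.idealSup n).mkQ := by
      refine continuous_of_continuousAt_zero (S.idealSup n).mkQ ?_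
      rw [ContinuousAt, map_zero, nhds_discrete Y, Filter.tendsto_pure]
      filter_upwards [(S.isOpen_idealSup n).mem_nhds (zero_mem _)] with a ha
      exact (Submodule.Quotient.mk_eq_zero _).2 ha
    have hf : ∀ y, f (π y) = (S.idealSup n).mkQ (hF.magnus y) := by
      intro y
      rw [← sub_eq_zero, ← map_sub]
      refine (Submodule.Quotient.mk_eq_zero _).2 ?_
      set z := Function.surjInv hπ (π y) with hz
      have hzy : z * y⁻¹ ∈ (π : F →* G).ker := by
        rw [MonoidHom.mem_ker]
        change π (z * y⁻¹) = 1
        rw [map_mul, Function.surjInv_eq hπ, ← map_mul, mul_inv_cancel, map_one]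
      have h1 : hF.magnus z - hF.magnus y = (hF.magnus (z * y⁻¹) - 1) * hF.magnus y := by
        rw [sub_mul, ← map_mul, inv_mul_cancel_right, one_mul]
      rw [h1]
      exact (le_sup_left : _ ≤ S.idealSup n)
        (S.mul_mem_ideal_right (S.magnus_sub_one_mem_ideal hF hS hρ hzy) _)
    have hcont : Continuous f := by
      have := hF.compactSpace
      have := hG.t2Space
      rw [(π.continuous_toFun.isClosedMap.isQuotientMap π.continuous_toFun hπ).continuous_iff]
      exact (hmk.comp hF.continuous_magnus).congr fun y => (hf y).symm
    obtain ⟨L, hL, hLf⟩ := CompletedGroupAlgebra.exists_linearMap_of_continuous hG hcont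
    have hext : L.comp (hF.toCompleted hG π).toLinearMap = (S.idealSup n).mkQ :=
      hF.linearMap_ext_magnus (hL.comp (hF.continuous_toCompleted hG π)) hmk fun y => by
        change L (hF.toCompleted hG π (hF.magnus y)) = _
        rw [hF.toCompleted_magnus, hLf, hf]
    refine (Submodule.Quotient.mk_eq_zero _).1 ?_
    have := LinearMap.congr_fun hext c
    rw [LinearMap.comp_apply, AlgHom.toLinearMap_apply, hc, map_zero] at this
    exact this.symm
  · intro hc
    have := S.map_mem_of_mem_ideal (hF.toCompleted hG π).toLinearMap
      (hF.continuous_toCompleted hG π) ⊥ (by simp) (fun u _ i v => ?_) hc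
    · simpa using this
    · simp [hrel]

end FreeRelators

end

noncomputable section

/-! ### Counting normal words -/

section Counting

variable {d : ℕ} {I : Type*} {α : I → List (Fin d)}

/-- The normal words of length `n`. -/
def normalWords (α : I → List (Fin d)) (n : ℕ) : Set (List (Fin d)) :=
  {w | IsNormalWord α w ∧ w.length = n}

theorem finite_normalWords (α : I → List (Fin d)) (n : ℕ) : (normalWords α n).Finite :=
  (List.finite_length_eq (Fin d) n).subset fun _ h => h.2

theorem ncard_normalWords_zero (hα : ∀ i, α i ≠ []) : (normalWords α 0).ncard = 1 := by
  rw [Set.ncard_eq_one]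
  refine ⟨[], Set.ext fun w => ⟨fun h => List.length_eq_zero_iff.1 h.2, ?_⟩⟩
  rintro rfl
  exact ⟨isNormalWord_nil hα, rfl⟩

theorem CombinatoriallyFree.finite_length_eq (hfree : CombinatoriallyFree α) (n : ℕ) :
    {i | (α i).length = n}.Finite :=
  (List.finite_length_eq (Fin d) n).preimage hfree.injective.injOn

/-- Appending a letter to a normal word gives either a normal word or a word `u α_i`. -/
theorem CombinatoriallyFree.card_mul_ncard_normalWords (hfree : CombinatoriallyFree α)
    (hα : ∀ i, α i ≠ []) (n : ℕ) :
    d * (normalWords α n).ncard = (normalWords α (n + 1)).ncard +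
      ∑ k ∈ Finset.HasAntidiagonal.antidiagonal (n + 1),
        (normalWords α k.1).ncard * {i | (α i).length = k.2}.ncard := by
  classical
  -- Pairs indexing the words u α_i of length n + 1 with u normal. These are exactly the words that
  -- cease to be normal when the last letter is appended.
  let Z : Set (List (Fin d) × I) :=
    {q | IsNormalWord α q.1 ∧ q.1.length + (α q.2).length = n + 1}
  let e : List (Fin d) × I → List (Fin d) := fun q => q.1 ++ α q.2
  have hinj : Set.InjOn e Z := by
    rintro ⟨u, i⟩ hu ⟨u', k⟩ hu' h
    obtain ⟨h1, h2, -⟩ := hfree.append_unique hu.1 hu'.1 (v := []) (v' := []) (by simpa using h)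
    exact Prod.ext h1 h2
  have himg : (fun q : List (Fin d) × Fin d => q.1 ++ [q.2]) '' (normalWords α n ×ˢ Set.univ) =
      normalWords α (n + 1) ∪ e '' Z := by
    ext w
    constructor
    · rintro ⟨⟨w, j⟩, ⟨hw, -⟩, rfl⟩
      by_cases h : IsNormalWord α (w ++ [j])
      · exact Or.inl ⟨h, by simp [hw.2]⟩
      · obtain ⟨u, i, hu, h'⟩ := exists_append_singleton_eq hα hw.1 h
        refine Or.inr ⟨(u, i), ⟨hu, ?_⟩, h'.symm⟩
        have := congrArg List.length h'
        simp [hw.2] at this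
        exact this.symm
    · rintro (⟨hw, hl⟩ | ⟨⟨u, i⟩, ⟨hu, hl⟩, rfl⟩)
      · rcases List.eq_nil_or_concat w with rfl | ⟨w, j, rfl⟩
        · simp at hl
        · rw [List.concat_eq_append] at hw hl ⊢
          exact ⟨(w, j), ⟨⟨hw.of_isInfix (List.prefix_append w [j]).isInfix, by simpa using hl⟩,
            trivial⟩, rfl⟩
      · rcases List.eq_nil_or_concat (u ++ α i) with h | ⟨w, j, h⟩
        · simp [hα i] at h
        · rw [List.concat_eq_append] at h
          refine ⟨(w, j), ⟨⟨hfree.isNormalWord_of_append_singleton hα hu h.symm, ?_⟩, trivial⟩,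
            h.symm⟩
          have := congrArg List.length h
          simp at this hl
          simp
          omega
  have hfinZ : Z.Finite := by
    refine Set.Finite.of_finite_image ?_ hinj
    exact ((((finite_normalWords α n).prod Set.finite_univ).image _).subset
      (himg ▸ Set.subset_union_right))
  have hdisj : Disjoint (normalWords α (n + 1)) (e '' Z) := by
    rw [Set.disjoint_left]
    rintro _ h ⟨⟨u, i⟩, -, rfl⟩
    refine not_isNormalWord_append (α := α) u i [] ?_
    simpa using h.1
  have h1 : ((fun q : List (Fin d) × Fin d => q.1 ++ [q.2]) ''
      (normalWords α n ×ˢ Set.univ)).ncard = d * (normalWords α n).ncard := by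
    rw [Set.ncard_image_of_injective, Set.ncard_prod, Set.ncard_univ, Nat.card_eq_fintype_card,
      Fintype.card_fin, mul_comm]
    rintro ⟨w, j⟩ ⟨w', j'⟩ h
    have := List.append_inj' h rfl
    simpa using this
  have h2 : Z.ncard = ∑ k ∈ Finset.HasAntidiagonal.antidiagonal (n + 1),
      (normalWords α k.1).ncard * {i | (α i).length = k.2}.ncard := by
    rw [Set.ncard_eq_toFinset_card Z hfinZ,
      Finset.card_eq_sum_card_fiberwise (f := fun q => (q.1.length, (α q.2).length))
        -- Sorting by the lengths of u and α_i turns the number of pairs into a coefficient of a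
        -- product of power series.
        (t := Finset.HasAntidiagonal.antidiagonal (n + 1))]
    · refine Finset.sum_congr rfl fun k hk => ?_
      rw [← Set.ncard_prod, ← Set.ncard_coe_finset]
      congr 1
      ext q
      simp only [Finset.coe_filter, Set.Finite.mem_toFinset, Set.mem_ofPred_eq, Set.mem_prod,
        normalWords, Z, Prod.ext_iff]
      rw [Finset.HasAntidiagonal.mem_antidiagonal] at hk
      constructor
      · rintro ⟨⟨h1, h2⟩, h3, h4⟩
        exact ⟨⟨h1, h3⟩, h4⟩
      · rintro ⟨⟨h1, h3⟩, h4⟩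
        exact ⟨⟨h1, by omega⟩, h3, h4⟩
    · intro q hq
      simp only [Set.Finite.coe_toFinset] at hq
      simpa using hq.2
  rw [← h1, himg, Set.ncard_union_eq hdisj (finite_normalWords α _) (hfinZ.image e),
    hinj.ncard_image, h2]

/-- The generating series of the normal words. -/
theorem CombinatoriallyFree.mk_ncard_normalWords_mul (hfree : CombinatoriallyFree α)
    (hα : ∀ i, α i ≠ []) :
    (PowerSeries.mk fun n : ℕ => ((normalWords α n).ncard : ℤ)) *
      (1 - PowerSeries.C (d : ℤ) * PowerSeries.X +
        PowerSeries.mk fun n : ℕ => ({i | (α i).length = n}.ncard : ℤ)) = 1 := by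
  set N : PowerSeries ℤ := PowerSeries.mk fun n : ℕ => ((normalWords α n).ncard : ℤ) with hN
  set A : PowerSeries ℤ := PowerSeries.mk fun n : ℕ => ({i | (α i).length = n}.ncard : ℤ) with hA
  have h : N * (1 - PowerSeries.C (d : ℤ) * PowerSeries.X + A) =
      N - PowerSeries.C (d : ℤ) * (N * PowerSeries.X) + N * A := by ring
  rw [h]
  ext n
  rw [map_add, map_sub, PowerSeries.coeff_C_mul, PowerSeries.coeff_mul n N A]
  cases n with
  | zero =>
    have h0 : {i | α i = []} = ∅ := by
      ext i
      simpa using hα i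
    simp [hN, hA, ncard_normalWords_zero hα, h0]
  | succ n =>
    rw [PowerSeries.coeff_succ_mul_X, PowerSeries.coeff_one, if_neg (Nat.succ_ne_zero n)]
    simp only [hN, hA, PowerSeries.coeff_mk]
    have := congrArg (Nat.cast : ℕ → ℤ) (hfree.card_mul_ncard_normalWords hα n)
    rw [Nat.cast_mul, Nat.cast_add, Nat.cast_sum] at this
    simp only [Nat.cast_mul] at this
    rw [this]
    ring

end Counting

/-! ### The Poincaré series -/

namespace FreeRelators

open MagnusAlgebra

variable {p d : ℕ} [Fact p.Prime] {I : Type*} (S : FreeRelators p d I)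
  {F : Type*} [Group F] [TopologicalSpace F] [IsTopologicalGroup F] {x : Fin d → F}
  (hF : IsFreeProP p x) {G : Type*} [Group G] [TopologicalSpace G] [IsTopologicalGroup G]
  (hG : IsProP p G) (π : F →ₜ* G)

open Classical in
/-- Extension by zero of a function on the normal words of length `n`. -/
def extendNormal (n : ℕ) : (normalWords S.lead n → ZMod p) →ₗ[ZMod p] MagnusAlgebra p d where
  toFun c := fun w => if h : w ∈ normalWords S.lead n then c ⟨w, h⟩ else 0
  map_add' a b := by
    ext w
    change (if h : w ∈ normalWords S.lead n then (a + b) ⟨w, h⟩ else 0) =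
      (if h : w ∈ normalWords S.lead n then a ⟨w, h⟩ else 0) +
      (if h : w ∈ normalWords S.lead n then b ⟨w, h⟩ else 0)
    split_ifs <;> simp
  map_smul' r a := by
    ext w
    change (if h : w ∈ normalWords S.lead n then (r • a) ⟨w, h⟩ else 0) =
      r * (if h : w ∈ normalWords S.lead n then a ⟨w, h⟩ else 0)
    split_ifs <;> simp

theorem extendNormal_apply {n : ℕ} (c : normalWords S.lead n → ZMod p)
    (w : normalWords S.lead n) : S.extendNormal n c w = c w := dif_pos w.2

theorem extendNormal_apply_of_notMem {n : ℕ} (c : normalWords S.lead n → ZMod p)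
    {w : List (Fin d)} (h : w ∉ normalWords S.lead n) : S.extendNormal n c w = 0 := dif_neg h

theorem extendNormal_mem_filtration {n : ℕ} (c : normalWords S.lead n → ZMod p) :
    S.extendNormal n c ∈ filtration p d n := by
  rw [mem_filtration]
  intro w hw
  exact S.extendNormal_apply_of_notMem c fun h => hw.ne h.2

theorem coord_extendNormal {n : ℕ} (c : normalWords S.lead n → ZMod p) :
    S.coord (S.extendNormal n c) = S.extendNormal n c :=
  S.coord_of_support_isNormalWord fun _ hw => S.extendNormal_apply_of_notMem c fun h => hw h.1

/-- The map from functions on normal words of length `n` to the graded piece of degree `n`. -/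
def toGradedPiece (n : ℕ) : (normalWords S.lead n → ZMod p) →ₗ[ZMod p] gradedPiece hF π n :=
  (Submodule.mkQ _).comp
    (((hF.toCompleted hG π).toLinearMap.comp (S.extendNormal n)).codRestrict
      (inducedFiltration hF π n) fun c => by
        rw [hF.inducedFiltration_eq hG π n]
        exact ⟨_, S.extendNormal_mem_filtration c, rfl⟩)

variable (hker : ∀ c, hF.toCompleted hG π c = 0 ↔ c ∈ S.ideal)

include hker

/-- Normal words of length n represent a basis of the graded piece: elements of J have no normal
coordinates, coordinates respect degrees, and every series agrees with its normal part modulo J. -/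
theorem toGradedPiece_bijective (n : ℕ) :
    Function.Bijective (S.toGradedPiece hF hG π n) := by
  constructor
  · rw [injective_iff_map_eq_zero]
    intro c hc
    have h1 : hF.toCompleted hG π (S.extendNormal n c) ∈ inducedFiltration hF π (n + 1) :=
      (Submodule.Quotient.mk_eq_zero
        ((inducedFiltration hF π (n + 1)).submoduleOf (inducedFiltration hF π n))).1 hc
    rw [hF.inducedFiltration_eq hG π] at h1
    obtain ⟨b, hb, hbc⟩ := h1
    have h2 : S.extendNormal n c - b ∈ S.ideal := by
      rw [← hker, map_sub, sub_eq_zero]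
      exact hbc.symm
    ext w
    have h3 := S.mem_ideal.1 h2 w w.2.1
    rw [map_sub, MagnusAlgebra.sub_apply, coord_extendNormal, extendNormal_apply,
      mem_filtration.1 (S.coord_mem_filtration hb) w (by rw [w.2.2]; exact Nat.lt_succ_self n),
      sub_zero] at h3
    exact h3
  · intro q
    obtain ⟨⟨z, hz⟩, rfl⟩ := Submodule.mkQ_surjective _ q
    have hz' := hz
    rw [hF.inducedFiltration_eq hG π] at hz'
    obtain ⟨a, ha, rfl⟩ := hz'
    refine ⟨fun w => S.coord a w, ?_⟩
    refine (Submodule.Quotient.eq _).2 ?_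
    change hF.toCompleted hG π (S.extendNormal n _) - hF.toCompleted hG π a ∈
      inducedFiltration hF π (n + 1)
    rw [hF.inducedFiltration_eq hG π]
    -- The normal part of a series in E_n starts in degree n; subtracting its component of degree n
    -- leaves an element of E_(n+1).
    refine ⟨S.extendNormal n (fun w => S.coord a w) - S.normalPart a, ?_, ?_⟩
    · refine mem_filtration.2 fun w hw => ?_
      rw [MagnusAlgebra.sub_apply, sub_eq_zero]
      by_cases hn : IsNormalWord S.lead w
      · rw [S.normalPart_apply_of_isNormalWord a hn]
        by_cases hl : w.length = n
        · exact S.extendNormal_apply _ ⟨w, hn, hl⟩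
        · rw [S.extendNormal_apply_of_notMem _ fun h => hl h.2,
            mem_filtration.1 (S.coord_mem_filtration ha) w (by omega)]
      · rw [S.normalPart_apply_of_not_isNormalWord a hn,
          S.extendNormal_apply_of_notMem _ fun h => hn h.1]
    · have : hF.toCompleted hG π (S.normalPart a) = hF.toCompleted hG π a := by
        rw [eq_comm, ← sub_eq_zero, ← map_sub, hker]
        exact S.sub_normalPart_mem a
      rw [AlgHom.toLinearMap_apply, map_sub, this]

theorem finite_gradedPiece (n : ℕ) : Module.Finite (ZMod p) (gradedPiece hF π n) := by
  have := (finite_normalWords S.lead n).to_subtype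
  exact Module.Finite.of_surjective _ (S.toGradedPiece_bijective hF hG π hker n).2

theorem finrank_gradedPiece (n : ℕ) :
    Module.finrank (ZMod p) (gradedPiece hF π n) = (normalWords S.lead n).ncard := by
  have := (finite_normalWords S.lead n).fintype
  rw [← (LinearEquiv.ofBijective _ (S.toGradedPiece_bijective hF hG π hker n)).finrank_eq,
    Module.finrank_fintype_fun_eq_card, ← Nat.card_eq_fintype_card, Nat.card_coe_set_eq]

theorem poincareSeries_mul :
    poincareSeries hF π * (1 - PowerSeries.C (d : ℤ) * PowerSeries.X +
      PowerSeries.mk fun n : ℕ => ({i | (S.lead i).length = n}.ncard : ℤ)) = 1 := by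
  refine Eq.trans ?_ (S.free.mk_ncard_normalWords_mul S.lead_ne_nil)
  congr 1
  ext n
  rw [poincareSeries, PowerSeries.coeff_mk, PowerSeries.coeff_mk,
    S.finrank_gradedPiece hF hG π hker]

end FreeRelators

end

noncomputable section

/-! ### The structure of the relation module -/

/-! ### Elements of large degree are close to the identity -/

section ZassenhausBasis

open MagnusAlgebra

/-- The Zassenhaus filtration is a basis of neighborhoods of `1`. -/
theorem IsFreeProP.exists_filtration_le {p d : ℕ} [Fact p.Prime] {F : Type*} [Group F]
    [TopologicalSpace F] [IsTopologicalGroup F] {x : Fin d → F} (hF : IsFreeProP p x)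
    (U : OpenNormalSubgroup F) :
    ∃ n, ∀ y, hF.magnus y - 1 ∈ filtration p d n → y ∈ U.toSubgroup := by
  refine ⟨(exists_prod_sub_one_eq_zero hF.toIsProP U
    fun j => ContinuousMonoidHom.id F (x j)).choose + 1, fun y hy => ?_⟩
  have h1 : magnusQuotient hF.toIsProP (ContinuousMonoidHom.id F) x U (hF.magnus y - 1) = 0 :=
    eval_eq_zero_of_mem_filtration _ _ hy
  rw [map_sub, map_one, hF.magnusQuotient_magnus, sub_eq_zero, ← map_one
    (MonoidAlgebra.of (ZMod p) (F ⧸ U.toSubgroup))] at h1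
  exact (QuotientGroup.eq_one_iff y).1 (MonoidAlgebra.of_injective h1)

end ZassenhausBasis

namespace FreeRelators

open MagnusAlgebra CompletedGroupAlgebra

variable {p d : ℕ} [Fact p.Prime] {I : Type*} (S : FreeRelators p d I)
  {F : Type*} [Group F] [TopologicalSpace F] [IsTopologicalGroup F] {x : Fin d → F}
  (hF : IsFreeProP p x) {G : Type*} [Group G] [TopologicalSpace G] [IsTopologicalGroup G]
  (hG : IsProP p G) {π : F →ₜ* G}

/-- The coefficients in `Λ_G` of a series modulo `J M`. -/
def completedCoeff (π : F →ₜ* G) (k : I) : MagnusAlgebra p d →ₗ[ZMod p] CompletedGroupAlgebra p G :=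
  (hF.toCompleted hG π).toLinearMap.comp (S.relCoeff k)

theorem continuous_completedCoeff (k : I) : Continuous (S.completedCoeff hF hG π k) :=
  (hF.continuous_toCompleted hG π).comp (S.continuous_relCoeff k)

theorem completedCoeff_mul_of_mem {g b : MagnusAlgebra p d} (hg : g ∈ S.ideal) (hb : b [] = 0)
    (k : I) : S.completedCoeff hF hG π k (g * b) = 0 := by
  rw [completedCoeff, LinearMap.comp_apply, S.relCoeff_mul_of_mem hg hb, map_zero]

theorem magnus_sub_one_nil (y : F) : (hF.magnus y - 1) [] = 0 := by
  rw [MagnusAlgebra.sub_apply, hF.magnus_nil, one_apply, if_pos rfl, sub_self]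

section

variable (hker : ∀ c, hF.toCompleted hG π c = 0 ↔ c ∈ S.ideal)

include hker

theorem toCompleted_normalPart (a : MagnusAlgebra p d) :
    hF.toCompleted hG π (S.normalPart a) = hF.toCompleted hG π a := by
  rw [eq_comm, ← sub_eq_zero, ← map_sub, hker]
  exact S.sub_normalPart_mem a

theorem completedCoeff_mul (a : MagnusAlgebra p d) {g : MagnusAlgebra p d} (hg : g ∈ S.ideal)
    (k : I) : S.completedCoeff hF hG π k (a * g) =
      hF.toCompleted hG π a * S.completedCoeff hF hG π k g := by
  have := (hker _).2 (S.relCoeff_mul a hg k)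
  rw [map_sub, map_mul, sub_eq_zero] at this
  exact this.symm

open Classical in
theorem completedCoeff_mul_rel (a : MagnusAlgebra p d) (i k : I) :
    S.completedCoeff hF hG π k (a * S.rel i) = if k = i then hF.toCompleted hG π a else 0 := by
  rw [completedCoeff, LinearMap.comp_apply, S.relCoeff_mul_rel]
  split_ifs
  · exact S.toCompleted_normalPart hF hG hker a
  · exact map_zero _

end

variable (hmem : ∀ r ∈ (π : F →* G).ker, hF.magnus r - 1 ∈ S.ideal)

/-- The homomorphism `R → ∏ Λ_G` given by the coefficients of `r - 1`. -/
def relHom : (π : F →* G).ker →* Multiplicative (I → CompletedGroupAlgebra p G) where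
  toFun r := Multiplicative.ofAdd fun k => S.completedCoeff hF hG π k (hF.magnus r - 1)
  map_one' := by
    rw [OneMemClass.coe_one, map_one, sub_self]
    simp only [map_zero]
    rfl
  map_mul' r s := by
    -- The last summand lies in JM, which the coefficients ignore; this makes r ↦ r - 1 additive.
    have h : hF.magnus ((r * s : (π : F →* G).ker) : F) - 1 = (hF.magnus r - 1) +
        (hF.magnus s - 1) + (hF.magnus r - 1) * (hF.magnus s - 1) := by
      rw [Subgroup.coe_mul, map_mul]
      noncomm_ring
    rw [h]
    simp only [map_add, S.completedCoeff_mul_of_mem hF hG (hmem r r.2) (magnus_sub_one_nil hF s),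
      add_zero]
    rfl

theorem pCommutator_le_ker_relHom :
    pCommutator p (π : F →* G).ker ≤ (S.relHom hF hG hmem).ker := by
  refine Subgroup.topologicalClosure_minimal _ (sup_le ?_ ?_) ?_
  · rw [Subgroup.closure_le]
    rintro _ ⟨r, rfl⟩
    rw [SetLike.mem_coe, MonoidHom.mem_ker, map_pow]
    refine congrArg Multiplicative.ofAdd
      (a₁ := p • (S.relHom hF hG hmem r).toAdd) (a₂ := 0) (funext fun k => ?_)
    have hp0 : (p : CompletedGroupAlgebra p G) = 0 := by
      rw [← map_natCast (algebraMap (ZMod p) (CompletedGroupAlgebra p G)), ZMod.natCast_self,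
        map_zero]
    rw [Pi.smul_apply, nsmul_eq_mul, hp0, zero_mul, Pi.zero_apply]
  · exact Abelianization.commutator_subset_ker _
  · refine isClosed_singleton (x := (0 : I → CompletedGroupAlgebra p G)) |>.preimage
      (f := fun r => (S.relHom hF hG hmem r).toAdd) (continuous_pi fun k => ?_)
    exact (S.continuous_completedCoeff hF hG k).comp
      ((hF.continuous_magnus.comp continuous_subtype_val).sub continuous_const)

/-- The homomorphism `R / R^p[R,R] → ∏ Λ_G` given by the coefficients of `r - 1`. -/
def relMap : RelationModule p (π : F →* G).ker →+ (I → CompletedGroupAlgebra p G) where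
  toFun m := (QuotientGroup.lift (pCommutator p (π : F →* G).ker) (S.relHom hF hG hmem)
    (S.pCommutator_le_ker_relHom hF hG hmem) (Additive.toMul m)).toAdd
  map_zero' := congrArg Multiplicative.toAdd (map_one (QuotientGroup.lift
    (pCommutator p (π : F →* G).ker) (S.relHom hF hG hmem)
      (S.pCommutator_le_ker_relHom hF hG hmem)))
  map_add' a b := congrArg Multiplicative.toAdd (map_mul (QuotientGroup.lift
    (pCommutator p (π : F →* G).ker) (S.relHom hF hG hmem)
      (S.pCommutator_le_ker_relHom hF hG hmem)) (Additive.toMul a) (Additive.toMul b))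

theorem relMap_mk (r : (π : F →* G).ker) (k : I) :
    S.relMap hF hG hmem (RelationModule.mk p r) k =
      S.completedCoeff hF hG π k (hF.magnus r - 1) := rfl

theorem continuous_relMap : Continuous (S.relMap hF hG hmem) := by
  rw [RelationModule.isQuotientMap_mk.continuous_iff]
  refine continuous_pi fun k => ?_
  exact (S.continuous_completedCoeff hF hG k).comp
    ((hF.continuous_magnus.comp continuous_subtype_val).sub continuous_const)

variable (hker : ∀ c, hF.toCompleted hG π c = 0 ↔ c ∈ S.ideal)

include hker in
-- Modulo JM, the series of y r y⁻¹ - 1 is y(r - 1), so conjugation becomes left multiplication.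
theorem relMap_conj (y : F) (r : (π : F →* G).ker) :
    S.relMap hF hG hmem (RelationModule.mk p (MulAut.conjNormal y r)) =
      of p (π y) • S.relMap hF hG hmem (RelationModule.mk p r) := by
  funext k
  rw [Pi.smul_apply, smul_eq_mul, relMap_mk, relMap_mk, ← hF.toCompleted_magnus hG π,
    ← S.completedCoeff_mul hF hG hker _ (hmem r r.2), MulAut.conjNormal_apply]
  have h : hF.magnus (y * r * y⁻¹) - 1 = hF.magnus y * (hF.magnus r - 1) +
      hF.magnus y * (hF.magnus r - 1) * (hF.magnus y⁻¹ - 1) := by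
    have h1 : hF.magnus y * hF.magnus y⁻¹ = 1 := by rw [← map_mul, mul_inv_cancel, map_one]
    rw [map_mul, map_mul]
    conv_lhs => rw [← h1]
    noncomm_ring
  rw [h, map_add, S.completedCoeff_mul_of_mem hF hG (S.mul_mem_ideal_left _ (hmem r r.2))
    (magnus_sub_one_nil hF _), add_zero]

variable {ρ : I → (π : F →* G).ker} (hS : ∀ i, S.rel i = hF.magnus (ρ i) - 1)

include hker hS

open Classical in
theorem relMap_generator (y : F) (i : I) :
    S.relMap hF hG hmem (RelationModule.mk p (MulAut.conjNormal y (ρ i))) =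
      (Pi.single i (of p (π y)) : I → CompletedGroupAlgebra p G) := by
  rw [S.relMap_conj hF hG hmem hker]
  funext k
  have h1 := S.completedCoeff_mul_rel hF hG hker 1 i k
  rw [one_mul, map_one, hS] at h1
  rw [Pi.smul_apply, relMap_mk, h1, Pi.single_apply, smul_eq_mul]
  split_ifs <;> simp

/-- The image is compact, hence closed. It contains the group elements in each coordinate, these
span a dense subspace of Λ_G, and the finitely supported families are dense in the product. -/
theorem relMap_surjective (hπ : Function.Surjective π) :
    Function.Surjective (S.relMap hF hG hmem) := by
  classical
  have := hF.compactSpace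
  have := hG.t2Space
  have hRc : CompactSpace (π : F →* G).ker := by
    refine isCompact_iff_compactSpace.1 (IsClosed.isCompact ?_)
    exact isClosed_singleton (x := (1 : G)) |>.preimage π.continuous_toFun
  have : CompactSpace (RelationModule p (π : F →* G).ker) :=
    inferInstanceAs (CompactSpace ((π : F →* G).ker ⧸ pCommutator p (π : F →* G).ker))
  have hclosed : IsClosed (Set.range (S.relMap hF hG hmem)) :=
    (isCompact_range (S.continuous_relMap hF hG hmem)).isClosed
  let T : Submodule (ZMod p) (I → CompletedGroupAlgebra p G) :=
    AddSubgroup.toZModSubmodule p (S.relMap hF hG hmem).range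
  have hT : IsClosed (T : Set (I → CompletedGroupAlgebra p G)) := hclosed
  have hsingle : ∀ (i : I) (z : CompletedGroupAlgebra p G), Pi.single i z ∈ T := by
    intro i z
    obtain ⟨c, rfl⟩ := hF.toCompleted_surjective hG π hπ z
    let L : MagnusAlgebra p d →ₗ[ZMod p] (I → CompletedGroupAlgebra p G) :=
      (LinearMap.single (ZMod p) (fun _ : I => CompletedGroupAlgebra p G) i).comp
        (hF.toCompleted hG π).toLinearMap
    have hL : Continuous L := (continuous_single i).comp (hF.continuous_toCompleted hG π)
    have : T.comap L = ⊤ := hF.eq_top_of_magnus_mem (hT.preimage hL) fun y => by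
      refine ⟨RelationModule.mk p (MulAut.conjNormal y (ρ i)), ?_⟩
      rw [S.relMap_generator hF hG hmem hker hS, ← hF.toCompleted_magnus hG π]
      rfl
    exact (this ▸ Submodule.mem_top : c ∈ T.comap L)
  intro c
  have hlim : Filter.Tendsto (fun s : Finset I => ∑ i ∈ s, Pi.single i (c i)) Filter.atTop
      (nhds c) := by
    refine tendsto_pi_nhds.2 fun k => tendsto_const_nhds.congr' ?_
    filter_upwards [Filter.eventually_ge_atTop {k}] with s hs
    rw [Finset.sum_apply, Finset.sum_pi_single, if_pos (hs (Finset.mem_singleton_self k))]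
  exact hT.mem_of_tendsto hlim (.of_forall fun s => T.sum_mem fun i _ => hsingle i _)

/-- A homomorphism from `R / R^p[R,R]` to a discrete group factors through the coefficients. -/
theorem map_eq_zero_of_relMap_eq_zero (hπ : Function.Surjective π)
    (hρ : Dense (AddSubgroup.closure
      {m | ∃ (y : F) (i : I), m = RelationModule.mk p (MulAut.conjNormal y (ρ i))} :
        Set (RelationModule p (π : F →* G).ker)))
    (U : OpenNormalSubgroup F) {Q : Type*} [AddCommGroup Q] [Module (ZMod p) Q]
    [TopologicalSpace Q] [DiscreteTopology Q] (q : RelationModule p (π : F →* G).ker →+ Q)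
    (hqc : Continuous fun r : (π : F →* G).ker => q (RelationModule.mk p r))
    (hqU : ∀ u : (π : F →* G).ker, (u : F) ∈ U.toSubgroup → q (RelationModule.mk p u) = 0)
    {m : RelationModule p (π : F →* G).ker} (hm : S.relMap hF hG hmem m = 0) : q m = 0 := by
  classical
  have hqc' : Continuous q := RelationModule.isQuotientMap_mk.continuous_iff.2 hqc
  -- The value of `q` on a conjugate of ρ_i depends only on the image of the conjugating element in
  -- G, because R acts trivially by conjugation on the abelian module. This continuous function on G
  -- extends to Λ_G.
  have hL : ∀ i, ∃ L : CompletedGroupAlgebra p G →ₗ[ZMod p] Q, Continuous L ∧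
      ∀ y, L (of p (π y)) = q (RelationModule.mk p (MulAut.conjNormal y (ρ i))) := by
    intro i
    let f : G → Q := fun g =>
      q (RelationModule.mk p (MulAut.conjNormal (Function.surjInv hπ g) (ρ i)))
    have hf : ∀ y, f (π y) = q (RelationModule.mk p (MulAut.conjNormal y (ρ i))) := by
      intro y
      set z := Function.surjInv hπ (π y) with hz
      have hzy : z * y⁻¹ ∈ (π : F →* G).ker := by
        rw [MonoidHom.mem_ker]
        change π (z * y⁻¹) = 1
        rw [map_mul, Function.surjInv_eq hπ, ← map_mul, mul_inv_cancel, map_one]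
      have h1 : MulAut.conjNormal z (ρ i) =
          ⟨_, hzy⟩ * MulAut.conjNormal y (ρ i) * (⟨_, hzy⟩ : (π : F →* G).ker)⁻¹ := by
        ext
        simp only [MulAut.conjNormal_apply, Subgroup.coe_mul, Subgroup.coe_inv]
        group
      change q (RelationModule.mk p (MulAut.conjNormal z (ρ i))) = _
      rw [h1, RelationModule.mk_mul, RelationModule.mk_mul, RelationModule.mk_inv]
      congr 1
      abel
    have hcont : Continuous f := by
      have := hF.compactSpace
      have := hG.t2Space
      rw [(π.continuous_toFun.isClosedMap.isQuotientMap π.continuous_toFun hπ).continuous_iff]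
      refine Continuous.congr (hqc.comp ?_) fun y => (hf y).symm
      refine Continuous.subtype_mk (f := fun y : F => y * ρ i * y⁻¹) ?_
        (fun y => (MulAut.conjNormal y (ρ i)).2)
      exact (continuous_id.mul continuous_const).mul continuous_inv
    obtain ⟨L, hL, hLf⟩ := exists_linearMap_of_continuous hG hcont
    exact ⟨L, hL, fun y => (hLf _).trans (hf y)⟩
  choose L hLc hL using hL
  obtain ⟨n, hn⟩ := hF.exists_filtration_le U
  -- Relators of degree greater than n lie in `U`, so `q` sees only finitely many of them and the
  -- sum of the `L i` is finite.
  let s : Finset I := (S.finite_length_lead_le n).toFinset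
  have hs : ∀ i ∉ s, (ρ i : F) ∈ U.toSubgroup := by
    intro i hi
    refine hn _ ?_
    rw [← hS]
    refine S.rel_mem_filtration ?_
    simp only [s, Set.Finite.mem_toFinset, Set.mem_ofPred_eq, not_le] at hi
    exact hi.le
  let C : (I → CompletedGroupAlgebra p G) →+ Q :=
    { toFun := fun c => ∑ i ∈ s, L i (c i)
      map_zero' := by simp
      map_add' := fun a b => by simp [Finset.sum_add_distrib] }
  have hC : Continuous C := continuous_finsetSum _ fun i _ => (hLc i).comp (continuous_apply i)
  -- Both homomorphisms are continuous and agree on the conjugates of the ρ_i, which generate a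
  -- dense subgroup.
  have heq : (C.comp (S.relMap hF hG hmem)).eqLocus q = ⊤ := by
    refine eq_top_iff.2 fun a _ => ?_
    have hcl : IsClosed (((C.comp (S.relMap hF hG hmem)).eqLocus q : AddSubgroup (RelationModule p (π : F →* G).ker)) :
        Set (RelationModule p (π : F →* G).ker)) :=
      isClosed_eq (hC.comp (S.continuous_relMap hF hG hmem)) hqc'
    refine hcl.closure_subset_iff.2 ?_ (hρ a)
    rw [SetLike.coe_subset_coe, AddSubgroup.closure_le]
    rintro _ ⟨y, i, rfl⟩
    change C (S.relMap hF hG hmem _) = q _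
    rw [S.relMap_generator hF hG hmem hker hS]
    change ∑ k ∈ s, L k ((Pi.single i (of p (π y)) : I → CompletedGroupAlgebra p G) k) = _
    by_cases hi : i ∈ s
    · rw [Finset.sum_eq_single_of_mem i hi, Pi.single_eq_same, hL]
      intro k _ hk
      rw [Pi.single_eq_of_ne hk, map_zero]
    · rw [Finset.sum_eq_zero, hqU]
      · rw [MulAut.conjNormal_apply]
        exact U.isNormal'.conj_mem _ (hs i hi) y
      · intro k hk
        rw [Pi.single_eq_of_ne (by rintro rfl; exact hi hk), map_zero]
  have h3 : C (S.relMap hF hG hmem m) = q m :=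
    (heq ▸ AddSubgroup.mem_top m : m ∈ (C.comp (S.relMap hF hG hmem)).eqLocus q)
  rw [hm, map_zero] at h3
  exact h3.symm

/-- The factorization through the coefficients is applied to the quotient of the relation module by
the image of R ∩ U, made discrete and killed by p. -/
theorem mk_mem_of_relMap_eq_zero (hπ : Function.Surjective π)
    (hρ : Dense (AddSubgroup.closure
      {m | ∃ (y : F) (i : I), m = RelationModule.mk p (MulAut.conjNormal y (ρ i))} :
        Set (RelationModule p (π : F →* G).ker))) (U : OpenNormalSubgroup F)
    {m : RelationModule p (π : F →* G).ker} (hm : S.relMap hF hG hmem m = 0) :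
    ∃ u : (π : F →* G).ker, (u : F) ∈ U.toSubgroup ∧ m = RelationModule.mk p u := by
  classical
  let M := RelationModule p (π : F →* G).ker
  let A : AddSubgroup M :=
    { carrier := {m | ∃ u : (π : F →* G).ker, (u : F) ∈ U.toSubgroup ∧ m = RelationModule.mk p u}
      zero_mem' := ⟨1, one_mem _, rfl⟩
      add_mem' := by
        rintro _ _ ⟨r, hr, rfl⟩ ⟨s, hs, rfl⟩
        exact ⟨r * s, mul_mem hr hs, rfl⟩
      neg_mem' := by
        rintro _ ⟨r, hr, rfl⟩
        exact ⟨r⁻¹, inv_mem hr, rfl⟩ }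
  let Q := M ⧸ A
  let _ : TopologicalSpace Q := ⊥
  have : DiscreteTopology Q := ⟨rfl⟩
  let q : M →+ Q := QuotientAddGroup.mk' A
  have hq : ∀ a, q a = 0 ↔ a ∈ A := fun a => QuotientAddGroup.eq_zero_iff a
  have hqU : ∀ u : (π : F →* G).ker, (u : F) ∈ U.toSubgroup → q (RelationModule.mk p u) = 0 :=
    fun u hu => (hq _).2 ⟨u, hu, rfl⟩
  let _ : Module (ZMod p) Q := AddCommGroup.zmodModule fun a => by
    obtain ⟨a, rfl⟩ := QuotientAddGroup.mk_surjective a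
    obtain ⟨r, rfl⟩ := RelationModule.mk_surjective a
    have h1 : p • RelationModule.mk p r = 0 := by
      have : RelationModule.mk p (r ^ p) = 0 := RelationModule.mk_eq_zero.2
        (Subgroup.le_topologicalClosure _ ((le_sup_left : Subgroup.closure _ ≤ _)
          (Subgroup.subset_closure ⟨r, rfl⟩)))
      exact this
    exact (map_nsmul q p _).symm.trans ((congrArg q h1).trans (map_zero q))
  have hqc : Continuous fun r : (π : F →* G).ker => q (RelationModule.mk p r) := by
    rw [continuous_discrete_rng]
    intro b
    rw [isOpen_iff_mem_nhds]
    intro r hr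
    have ho : IsOpen {s : (π : F →* G).ker | ((r⁻¹ * s : (π : F →* G).ker) : F) ∈ U.toSubgroup} :=
      U.isOpen'.preimage (continuous_subtype_val.comp (continuous_const_mul r⁻¹))
    refine Filter.mem_of_superset (ho.mem_nhds (by simp)) fun s hs => ?_
    have h2 := hqU _ hs
    rw [RelationModule.mk_mul, RelationModule.mk_inv, map_add, map_neg, neg_add_eq_zero] at h2
    exact h2.symm.trans hr
  exact (hq m).1 (S.map_eq_zero_of_relMap_eq_zero hF hG hmem hker hS hπ hρ U q hqc hqU hm)

/-- An element of the kernel has representatives in every open normal subgroup of F, while R^p[R,R]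
is closed; so the class is zero. -/
theorem relMap_injective (hπ : Function.Surjective π)
    (hρ : Dense (AddSubgroup.closure
      {m | ∃ (y : F) (i : I), m = RelationModule.mk p (MulAut.conjNormal y (ρ i))} :
        Set (RelationModule p (π : F →* G).ker))) :
    Function.Injective (S.relMap hF hG hmem) := by
  rw [injective_iff_map_eq_zero]
  intro m hm
  obtain ⟨r, rfl⟩ := RelationModule.mk_surjective m
  rw [RelationModule.mk_eq_zero]
  by_contra hr
  have hcl : IsClosed (pCommutator p (π : F →* G).ker : Set (π : F →* G).ker) :=
    Subgroup.isClosed_topologicalClosure _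
  obtain ⟨W, hW, hWeq⟩ := isOpen_induced_iff.1
    (hcl.isOpen_compl.preimage (continuous_const_mul r))
  have h1 : (1 : F) ∈ W := by
    have : (1 : (π : F →* G).ker) ∈ Subtype.val ⁻¹' W := by
      rw [hWeq]
      simpa using hr
    exact this
  obtain ⟨U, hU⟩ := hF.toIsProP.exists_openNormalSubgroup_subset hW h1
  obtain ⟨u, hu, hru⟩ := S.mk_mem_of_relMap_eq_zero hF hG hmem hker hS hπ hρ U hm
  have h2 : u⁻¹ ∈ Subtype.val ⁻¹' W := hU (inv_mem hu : (u : F)⁻¹ ∈ U.toSubgroup)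
  rw [hWeq] at h2
  refine h2 (RelationModule.mk_eq_zero.1 ?_)
  rw [RelationModule.mk_mul, RelationModule.mk_inv, hru, add_neg_cancel]

include hmem in
-- The Λ_G-structure is transported from the product, compactness makes the bijection a
-- homeomorphism, and `relMap_conj` identifies the action of G with conjugation.
theorem exists_module_continuousLinearEquiv (hπ : Function.Surjective π)
    (hρ : Dense (AddSubgroup.closure
      {m | ∃ (y : F) (i : I), m = RelationModule.mk p (MulAut.conjNormal y (ρ i))} :
        Set (RelationModule p (π : F →* G).ker))) :
    ∃ _ : Module (CompletedGroupAlgebra p G) (RelationModule p (π : F →* G).ker),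
      (Continuous fun c : CompletedGroupAlgebra p G × RelationModule p (π : F →* G).ker =>
        c.1 • c.2) ∧
      (∀ (y : F) (r : (π : F →* G).ker),
        CompletedGroupAlgebra.of p (π y) • RelationModule.mk p r =
          RelationModule.mk p (MulAut.conjNormal y r)) ∧
      Nonempty (RelationModule p (π : F →* G).ker ≃L[CompletedGroupAlgebra p G]
        (I → CompletedGroupAlgebra p G)) := by
  let e : RelationModule p (π : F →* G).ker ≃+ (I → CompletedGroupAlgebra p G) :=
    AddEquiv.ofBijective (S.relMap hF hG hmem) ⟨S.relMap_injective hF hG hmem hker hS hπ hρ,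
      S.relMap_surjective hF hG hmem hker hS hπ⟩
  have he : Continuous e := S.continuous_relMap hF hG hmem
  have := hF.compactSpace
  have := hG.t2Space
  have hRc : CompactSpace (π : F →* G).ker := by
    refine isCompact_iff_compactSpace.1 (IsClosed.isCompact ?_)
    exact isClosed_singleton (x := (1 : G)) |>.preimage π.continuous_toFun
  have : CompactSpace (RelationModule p (π : F →* G).ker) :=
    inferInstanceAs (CompactSpace ((π : F →* G).ker ⧸ pCommutator p (π : F →* G).ker))
  have hsymm : Continuous e.symm :=
    (Continuous.homeoOfEquivCompactToT2 (f := e.toEquiv) he).continuous_symm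
  let _ : Module (CompletedGroupAlgebra p G) (RelationModule p (π : F →* G).ker) :=
    AddEquiv.module (CompletedGroupAlgebra p G) e
  have hsmul : ∀ (a : CompletedGroupAlgebra p G) (m : RelationModule p (π : F →* G).ker),
      a • m = e.symm (a • e m) := fun _ _ => rfl
  refine ⟨inferInstance, ?_, fun y r => ?_, ⟨?_⟩⟩
  · simp only [hsmul]
    refine hsymm.comp (continuous_pi fun k => ?_)
    exact continuous_fst.mul ((continuous_apply k).comp (he.comp continuous_snd))
  · rw [hsmul, AddEquiv.symm_apply_eq]
    exact (S.relMap_conj hF hG hmem hker y r).symm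
  · exact
      { toFun := e
        invFun := e.symm
        left_inv := e.symm_apply_apply
        right_inv := e.apply_symm_apply
        map_add' := map_add e
        map_smul' := fun a m => by rw [hsmul, AddEquiv.apply_symm_apply, RingHom.id_apply]
        continuous_toFun := he
        continuous_invFun := hsymm }

end FreeRelators

end

noncomputable section

/-! ### Continuous cohomology of smooth representations -/

section Homology

open CategoryTheory Limits TopModuleCat

theorem TopModuleCat.subsingleton_of_iso {R : Type*} [Ring R] [TopologicalSpace R]
    {M N : TopModuleCat R} (e : M ≅ N) [Subsingleton N] : Subsingleton M := by
  refine ⟨fun a b => ?_⟩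
  have h1 : ∀ a, e.inv.hom (e.hom.hom a) = a := fun a =>
    DFunLike.congr_fun (congrArg Hom.hom e.hom_inv_id) a
  rw [← h1 a, ← h1 b, Subsingleton.elim (e.hom.hom a) (e.hom.hom b)]

/-- The cokernel is an algebraic quotient, so elementwise exactness suffices for vanishing, whatever
the topologies. -/
theorem TopModuleCat.subsingleton_homology {R : Type*} [Ring R] [TopologicalSpace R]
    (S : ShortComplex (TopModuleCat R)) (h : ∀ x, S.g.hom x = 0 → ∃ y, S.f.hom y = x) :
    Subsingleton S.homology := by
  let D : S.LeftHomologyData :=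
    ⟨_, _, _, _, kerι_comp S.g, isLimitKer _, comp_cokerπ _, isColimitCoker _⟩
  have hD : Subsingleton D.H := by
    refine ⟨fun a b => ?_⟩
    obtain ⟨a, rfl⟩ := Submodule.mkQ_surjective _ a
    obtain ⟨b, rfl⟩ := Submodule.mkQ_surjective _ b
    refine (Submodule.Quotient.eq _).2 ?_
    obtain ⟨y, hy⟩ := h _ (a - b).2
    exact ⟨y, Subtype.ext hy⟩
  exact subsingleton_of_iso D.homologyIso
end Homology

namespace TopRep

universe u v w

open CategoryTheory ContRepresentation

variable {k : Type u} {G : Type v} [Ring k] [TopologicalSpace k] [Group G] [TopologicalSpace G]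
  [IsTopologicalGroup G]

/-- A representation on a discrete module with open stabilizers. -/
class IsSmooth (X : TopRep.{w} k G) : Prop where
  discreteTopology : DiscreteTopology X
  continuous_orbit : ∀ v : X, Continuous fun g => X.ρ g v

/-- A continuous function takes finitely many values on compact fibres, so finitely many
compact-open conditions determine it. -/
theorem _root_.ContinuousMap.discreteTopology_of_compactSpace {A B : Type*} [TopologicalSpace A]
    [CompactSpace A] [TopologicalSpace B] [DiscreteTopology B] : DiscreteTopology C(A, B) := by
  refine discreteTopology_iff_isOpen_singleton.2 fun f => ?_
  have hfin : (Set.range f).Finite := (isCompact_range f.continuous).finite_of_discrete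
  have heq : {f} = ⋂ b ∈ Set.range f, {h : C(A, B) | Set.MapsTo h (f ⁻¹' {b}) {b}} := by
    ext h
    simp only [Set.mem_singleton_iff, Set.mem_iInter, Set.mem_ofPred_eq]
    refine ⟨fun hf b _ a ha => hf ▸ ha, fun hh => ContinuousMap.ext fun a => ?_⟩
    exact hh (f a) ⟨a, rfl⟩ (rfl : f a = f a)
  rw [heq]
  refine hfin.isOpen_biInter fun b _ => ContinuousMap.isOpen_setOfPred_mapsTo ?_ (isOpen_discrete _)
  exact ((isClosed_discrete {b}).preimage f.continuous).isCompact

instance isSmooth_coind₁ [CompactSpace G] (X : TopRep.{w} k G) [hX : X.IsSmooth] :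
    X.coind₁.IsSmooth where
  discreteTopology := by
    have := hX.discreteTopology
    exact ContinuousMap.discreteTopology_of_compactSpace
  continuous_orbit f := by
    have := hX.discreteTopology
    have hact : Continuous fun z : X × G => X.ρ z.2 z.1 := by
      rw [continuous_prod_of_discrete_left]
      exact hX.continuous_orbit
    let F : C(G × G, X) := ⟨fun z => X.ρ z.1 (f (z.1⁻¹ * z.2)),
      hact.comp ((f.continuous.comp (continuous_fst.inv.mul continuous_snd)).prodMk
        continuous_fst)⟩
    exact F.curry.continuous

instance isSmooth_resolutionX [CompactSpace G] (X : TopRep.{v} k G) [X.IsSmooth] :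
    ∀ n, (resolutionX X n).IsSmooth
  | 0 => ‹_›
  | n + 1 => @isSmooth_coind₁ _ _ _ _ _ _ _ _ (resolutionX X n) (isSmooth_resolutionX X n)

/-! #### Functoriality of the resolution -/

/-- The map of resolutions induced by a morphism. -/
def resolutionXMap {X Y : TopRep.{v} k G} (a : X ⟶ Y) :
    ∀ n, resolutionX X n ⟶ resolutionX Y n
  | 0 => a
  | n + 1 => (coind₁Functor k G).map (resolutionXMap a n)

theorem resolutionXMap_succ_apply {X Y : TopRep.{v} k G} (a : X ⟶ Y) (n : ℕ)
    (f : C(G, resolutionX X n)) (g : G) :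
    ((resolutionXMap a (n + 1)).hom f : C(G, resolutionX Y n)) g = (resolutionXMap a n).hom (f g) :=
  rfl

theorem d_succ_apply (X : TopRep.{v} k G) (n : ℕ) (f : C(G, resolutionX X n)) (g : G) :
    ((d X (n + 1)).hom f : C(G, C(G, resolutionX X n))) g = f - (d X n).hom (f g) := rfl

theorem resolutionXMap_d {X Y : TopRep.{v} k G} (a : X ⟶ Y) :
    ∀ (n : ℕ) (x : resolutionX X n),
      (resolutionXMap a (n + 1)).hom ((d X n).hom x) = (d Y n).hom ((resolutionXMap a n).hom x)
  | 0, _ => rfl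
  | n + 1, f => by
    refine ContinuousMap.ext fun g => ?_
    refine (resolutionXMap_succ_apply a (n + 1) _ g).trans ?_
    refine Eq.trans ?_ (d_succ_apply Y n _ g).symm
    refine (congrArg _ (d_succ_apply X n f g)).trans ?_
    rw [map_sub]
    exact congrArg _ (resolutionXMap_d a n (f g))

theorem resolutionXMap_injective {X Y : TopRep.{v} k G} {a : X ⟶ Y}
    (ha : Function.Injective a.hom) : ∀ n, Function.Injective (resolutionXMap a n).hom
  | 0 => ha
  | n + 1 => fun f f' h => by
    refine ContinuousMap.ext fun g => resolutionXMap_injective ha n ?_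
    exact DFunLike.congr_fun (F := C(G, resolutionX Y n)) h g

theorem resolutionXMap_comp_eq_zero {X Y Z : TopRep.{v} k G} {a : X ⟶ Y} {b : Y ⟶ Z}
    (hab : ∀ x, b.hom (a.hom x) = 0) :
    ∀ (n : ℕ) (x : resolutionX X n), (resolutionXMap b n).hom ((resolutionXMap a n).hom x) = 0
  | 0, x => hab x
  | n + 1, f => ContinuousMap.ext fun g => resolutionXMap_comp_eq_zero hab n (f g)

theorem resolutionXMap_zero {X Y : TopRep.{v} k G} :
    ∀ (n : ℕ) (x : resolutionX X n), (resolutionXMap (0 : X ⟶ Y) n).hom x = 0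
  | 0, _ => rfl
  | n + 1, f => ContinuousMap.ext fun g => resolutionXMap_zero n (f g)

theorem d_d_apply (X : TopRep.{v} k G) (n : ℕ) (x : resolutionX X n) :
    (d X (n + 1)).hom ((d X n).hom x) = 0 :=
  DFunLike.congr_fun (congrArg Hom.hom (d_comp_d X n)) x

/-- Exactness is inherited level by level: preimages are chosen value by value, and the choice is
continuous because the values lie in a discrete space. -/
theorem exists_resolutionXMap_eq [CompactSpace G] {X Y Z : TopRep.{v} k G} [Y.IsSmooth]
    {a : X ⟶ Y} {b : Y ⟶ Z} (hab : ∀ y, b.hom y = 0 → ∃ x, a.hom x = y) :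
    ∀ (n : ℕ) (y : resolutionX Y n), (resolutionXMap b n).hom y = 0 →
      ∃ x, (resolutionXMap a n).hom x = y
  | 0, y, hy => hab y hy
  | n + 1, f, hf => by
    have := (isSmooth_resolutionX Y n).discreteTopology
    have h1 : ∀ g, ∃ x, (resolutionXMap a n).hom x = f g := fun g =>
      exists_resolutionXMap_eq hab n (f g)
        (DFunLike.congr_fun (F := C(G, resolutionX Z n)) hf g)
    have h2 : ∀ y : Set.range f, ∃ x, (resolutionXMap a n).hom x = y := by
      rintro ⟨_, g, rfl⟩
      exact h1 g
    choose s hs using h2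
    refine ⟨(⟨fun g => s ⟨f g, g, rfl⟩, ?_⟩ : C(G, resolutionX X n)),
      ContinuousMap.ext fun g => hs _⟩
    exact continuous_of_discreteTopology.comp (f.continuous.subtype_mk fun g => ⟨g, rfl⟩)

theorem mem_invariants_coind₁ {X : TopRep.{w} k G} {f : C(G, X)} :
    f ∈ X.coind₁.ρ.invariants ↔ ∀ g, f g = X.ρ g (f 1) := by
  constructor
  · intro h g
    have := DFunLike.congr_fun (F := C(G, X)) (h g) g
    refine this.symm.trans ?_
    refine (coind₁_apply_apply X.ρ g f g).trans ?_
    rw [inv_mul_cancel]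
  · intro h g
    refine ContinuousMap.ext fun x => ?_
    refine (coind₁_apply_apply X.ρ g f x).trans ?_
    rw [h, h x]
    refine (DFunLike.congr_fun (map_mul X.ρ g (g⁻¹ * x)) (f 1)).symm.trans ?_
    rw [mul_inv_cancel_left]

/-- In positive levels an invariant cochain is determined by its value at 1. It is enough to lift
that value and spread the lift along its orbit, which is continuous by smoothness. -/
theorem exists_invariant_resolutionXMap_eq [CompactSpace G] {X Y Z : TopRep.{v} k G} [X.IsSmooth]
    [Y.IsSmooth] {a : X ⟶ Y} {b : Y ⟶ Z} (hab : ∀ y, b.hom y = 0 → ∃ x, a.hom x = y) (n : ℕ)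
    {y : resolutionX Y (n + 1)} (hy : y ∈ (resolutionX Y (n + 1)).ρ.invariants)
    (hby : (resolutionXMap b (n + 1)).hom y = 0) :
    ∃ x ∈ (resolutionX X (n + 1)).ρ.invariants, (resolutionXMap a (n + 1)).hom x = y := by
  have hy' := mem_invariants_coind₁.1 hy
  obtain ⟨x, hx⟩ := exists_resolutionXMap_eq hab n ((y : C(G, resolutionX Y n)) 1)
    (DFunLike.congr_fun (F := C(G, resolutionX Z n)) hby 1)
  let f : C(G, resolutionX X n) := ⟨fun g => (resolutionX X n).ρ g x,
    (isSmooth_resolutionX X n).continuous_orbit x⟩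
  refine ⟨f, mem_invariants_coind₁.2 fun g => ?_, ContinuousMap.ext fun g => ?_⟩
  · change (resolutionX X n).ρ g x = (resolutionX X n).ρ g ((resolutionX X n).ρ 1 x)
    rw [map_one]
    rfl
  · refine Eq.trans ?_ (hy' g).symm
    rw [← hx]
    exact hom_comm_apply _ g x

/-! #### Acyclicity -/

/-- Vanishing of `Hⁿ(G, X)` in terms of homogeneous cochains. -/
def CochainExact (X : TopRep.{v} k G) (n : ℕ) : Prop :=
  ∀ σ ∈ (resolutionX X (n + 1)).ρ.invariants, (d X (n + 1)).hom σ = 0 →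
    ∃ κ ∈ (resolutionX X n).ρ.invariants, (d X n).hom κ = σ

/-- Exchange of the two variables of a function in `C(G, C(G, X))`. -/
def swapCoind [CompactSpace G] (X : TopRep.{w} k G) [hX : X.IsSmooth] :
    X.coind₁.coind₁ ⟶ X.coind₁.coind₁ :=
  ofHom
    { toFun := fun f : C(G, C(G, X)) =>
        (⟨fun z : G × G => f z.2 z.1, by fun_prop⟩ : C(G × G, X)).curry
      map_add' := fun _ _ => rfl
      map_smul' := fun _ _ => rfl
      cont := by
        have := (isSmooth_coind₁ X.coind₁).discreteTopology
        exact continuous_of_discreteTopology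
      isIntertwining' := fun _ => rfl }

/-- The extension of a retraction `C(G, X) → X` to the resolution. -/
def retraction [CompactSpace G] {X : TopRep.{v} k G} [X.IsSmooth] (s : X.coind₁ ⟶ X) :
    ∀ n, (resolutionX X n).coind₁ ⟶ resolutionX X n
  | 0 => s
  | n + 1 => swapCoind (resolutionX X n) ≫ (coind₁Functor k G).map (retraction s n)

/-- The slice `g ↦ f g g₀`. -/
def slice [CompactSpace G] {Y : Type*} [TopologicalSpace Y] (f : C(G, C(G, Y))) (g₀ : G) :
    C(G, Y) := ⟨fun g => f g g₀, (continuous_eval_const g₀).comp f.continuous⟩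

section

variable [CompactSpace G] {X : TopRep.{v} k G} [X.IsSmooth] (s : X.coind₁ ⟶ X)

theorem retraction_succ_apply (n : ℕ) (f : C(G, C(G, resolutionX X n))) (g₀ : G) :
    ((retraction s (n + 1)).hom f : C(G, resolutionX X n)) g₀ =
      (retraction s n).hom (slice f g₀) := rfl

theorem retraction_const (hs : ∀ x, s.hom (ContinuousMap.const G x) = x) :
    ∀ (n : ℕ) (z : resolutionX X n), (retraction s n).hom (ContinuousMap.const G z) = z
  | 0, z => hs z
  | n + 1, z => by
    refine ContinuousMap.ext fun g₀ => ?_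
    exact (retraction_succ_apply s n _ g₀).trans (retraction_const hs n (z g₀))

/-- The retraction acts on an outermost extra variable, which the swaps move past the others, so it
commutes with the differential. -/
theorem retraction_d (hs : ∀ x, s.hom (ContinuousMap.const G x) = x) :
    ∀ (n : ℕ) (f : C(G, resolutionX X n)),
      (retraction s (n + 1)).hom ((coind₁Map (d X n).hom) f) =
        (d X n).hom ((retraction s n).hom f)
  | 0, f => rfl
  | n + 1, f => by
    refine ContinuousMap.ext fun g₀ => ?_
    refine (retraction_succ_apply s (n + 1) _ g₀).trans ?_
    refine Eq.trans ?_ (d_succ_apply X n _ g₀).symm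
    have h1 : slice (coind₁Map (d X (n + 1)).hom f) g₀ =
        f - coind₁Map (d X n).hom (slice (Y := resolutionX X n) f g₀) := rfl
    rw [h1, map_sub]
    exact congrArg _ (retraction_d hs n _)

/-- The cocycle condition says that g ↦ d(f g) is the constant function f. Applying the retraction
gives d(retraction f) = f, so the retraction is a contracting homotopy. -/
theorem cochainExact_of_retraction (hs : ∀ x, s.hom (ContinuousMap.const G x) = x) (n : ℕ) :
    CochainExact X n := by
  intro f hf hdf
  refine ⟨(retraction s n).hom f, fun g => ?_, ?_⟩
  · rw [← hom_comm_apply, hf g]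
  · rw [← retraction_d s hs n]
    have h1 : coind₁Map (d X n).hom f = ContinuousMap.const G f := by
      refine ContinuousMap.ext fun g => ?_
      have := DFunLike.congr_fun (F := C(G, C(G, resolutionX X n))) hdf g
      exact (sub_eq_zero.1 this).symm
    rw [h1]
    exact retraction_const s hs (n + 1) f

end

/-- Evaluation on the diagonal. -/
def diagonal [CompactSpace G] (Y : TopRep.{w} k G) [Y.IsSmooth] :
    Y.coind₁.coind₁ ⟶ Y.coind₁ :=
  ofHom
    { toFun := fun f : C(G, C(G, Y)) => (⟨fun g => f g g, by fun_prop⟩ : C(G, Y))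
      map_add' := fun _ _ => rfl
      map_smul' := fun _ _ => rfl
      cont := by
        have := (isSmooth_coind₁ Y.coind₁).discreteTopology
        exact continuous_of_discreteTopology
      isIntertwining' := fun _ => rfl }

/-- Coinduced representations are acyclic. -/
theorem cochainExact_coind₁ [CompactSpace G] (Y : TopRep.{0} k G) [Y.IsSmooth] (n : ℕ) :
    CochainExact Y.coind₁ n :=
  cochainExact_of_retraction (diagonal Y) (fun _ => rfl) n

/-- Dimension shifting along an exact sequence `0 → A → M₀ → M₁ → M₂ → 0` with acyclic `Mᵢ`. -/
theorem cochainExact_of_exact [CompactSpace G] {A M₀ M₁ M₂ : TopRep.{v} k G} [A.IsSmooth]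
    [M₀.IsSmooth] [M₁.IsSmooth] [M₂.IsSmooth] (h₀ : ∀ n, CochainExact M₀ n)
    (h₁ : ∀ n, CochainExact M₁ n) (h₂ : ∀ n, CochainExact M₂ n)
    {a : A ⟶ M₀} {b : M₀ ⟶ M₁} {c : M₁ ⟶ M₂} (ha : Function.Injective a.hom)
    (hba : ∀ x, b.hom (a.hom x) = 0) (hab : ∀ x, b.hom x = 0 → ∃ y, a.hom y = x)
    (hcb : ∀ x, c.hom (b.hom x) = 0) (hbc : ∀ x, c.hom x = 0 → ∃ y, b.hom y = x)
    (hc : Function.Surjective c.hom) (n : ℕ) : CochainExact A (n + 3) := by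
  intro σ hσ hdσ
  have hinv : ∀ {X Y : TopRep.{v} k G} (f : X ⟶ Y) {x : X}, x ∈ X.ρ.invariants →
      f.hom x ∈ Y.ρ.invariants := fun f x hx g => by rw [← hom_comm_apply, hx g]
  -- Acyclicity pushes the cocycle to the right, losing one degree at each term.
  obtain ⟨τ₀, hτ₀, h0⟩ := h₀ (n + 3) _ (hinv (resolutionXMap a (n + 4)) hσ) (by
    rw [← resolutionXMap_d, hdσ, map_zero])
  obtain ⟨τ₁, hτ₁, h1⟩ := h₁ (n + 2) _ (hinv (resolutionXMap b (n + 3)) hτ₀) (by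
    rw [← resolutionXMap_d, h0, resolutionXMap_comp_eq_zero hba])
  obtain ⟨τ₂, hτ₂, h2⟩ := h₂ (n + 1) _ (hinv (resolutionXMap c (n + 2)) hτ₁) (by
    rw [← resolutionXMap_d, h1, resolutionXMap_comp_eq_zero hcb])
  -- Now the corrections are lifted back to the left. The cochain τ₂ sits in level n + 1, and
  -- invariants can be lifted only in positive levels, hence the shift by 3. Surjectivity of `c` is
  -- used as exactness before the zero map.
  obtain ⟨υ₁, hυ₁, h3⟩ := exists_invariant_resolutionXMap_eq (a := c) (b := (0 : M₂ ⟶ M₂))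
    (fun y _ => hc y) n hτ₂ (resolutionXMap_zero _ _)
  obtain ⟨υ₀, hυ₀, h4⟩ := exists_invariant_resolutionXMap_eq hbc (n + 1)
    (sub_mem hτ₁ (hinv (d M₁ (n + 1)) hυ₁)) (by
      rw [map_sub, resolutionXMap_d, h3, h2, sub_self])
  obtain ⟨κ, hκ, h5⟩ := exists_invariant_resolutionXMap_eq hab (n + 2)
    (sub_mem hτ₀ (hinv (d M₀ (n + 2)) hυ₀)) (by
      rw [map_sub, resolutionXMap_d, h4, map_sub, h1, d_d_apply, sub_zero, sub_self])
  refine ⟨κ, hκ, resolutionXMap_injective ha _ ?_⟩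
  rw [resolutionXMap_d, h5, map_sub, h0, d_d_apply, sub_zero]

/-! #### Comparison with homology -/

theorem subsingleton_continuousCohomology {X : TopRep.{v} k G} {n : ℕ}
    (h : CochainExact X (n + 1)) : Subsingleton (continuousCohomology (n + 1) X) := by
  have : Subsingleton ((homogeneousCochains X).sc' n (n + 1) (n + 2)).homology := by
    refine TopModuleCat.subsingleton_homology _ fun σ hσ => ?_
    have h1 := homogeneousCochains.d_apply X (n + 1) σ
    obtain ⟨κ, hκ, h2⟩ := h σ.1 σ.2 (h1.symm.trans (congrArg Subtype.val hσ))
    refine ⟨⟨κ, hκ⟩, Subtype.ext ?_⟩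
    exact (homogeneousCochains.d_apply X n ⟨κ, hκ⟩).trans h2
  exact TopModuleCat.subsingleton_of_iso
    ((homogeneousCochains X).homologyIsoSc' n (n + 1) (n + 2) (by simp) (by simp))

end TopRep

theorem cohomologicalDimension_le_two {p : ℕ} {G : Type*} [Group G] [TopologicalSpace G]
    [IsTopologicalGroup G] (h : ∀ n, TopRep.CochainExact
      (TopRep.of (ContRepresentation.trivial (ZMod p) G (ULift (ZMod p)))) (n + 3)) :
    cohomologicalDimension p G ≤ 2 := by
  refine sInf_le fun i hi => ?_
  have h2 : 2 < i := by exact_mod_cast hi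
  obtain ⟨n, rfl⟩ := Nat.exists_eq_add_of_le' h2
  exact TopRep.subsingleton_continuousCohomology (h n)

end

noncomputable section

/-! ### A coinduced resolution of the trivial module -/

namespace MagnusAlgebra

variable {p d : ℕ}

theorem deriv_mul (j : Fin d) (a : MagnusAlgebra p d) {b : MagnusAlgebra p d} (hb : b [] = 0) :
    deriv j (a * b) = a * deriv j b := by
  conv_lhs => rw [eq_sum_deriv_mul_X hb, Finset.mul_sum, map_sum]
  simp only [← mul_assoc, deriv_mul_X, Finset.sum_ite_eq, Finset.mem_univ, if_true]

/-- A basic neighbourhood of 0 inside the kernel constrains finitely many coefficients, whose words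
have bounded length. -/
theorem exists_filtration_le_ker {Y : Type*} [AddCommGroup Y] [Module (ZMod p) Y]
    [TopologicalSpace Y] [DiscreteTopology Y] {L : MagnusAlgebra p d →ₗ[ZMod p] Y}
    (hL : Continuous L) : ∃ n, ∀ c ∈ filtration p d n, L c = 0 := by
  obtain ⟨s, u, hu, hs⟩ := isOpen_pi_iff.1 ((isOpen_discrete {(0 : Y)}).preimage hL) 0 (map_zero L)
  refine ⟨s.sup List.length + 1, fun c hc => hs fun w hw => ?_⟩
  rw [mem_filtration.1 hc w (Nat.lt_succ_of_le (Finset.le_sup (f := List.length) hw))]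
  exact (hu w hw).2

end MagnusAlgebra

open MagnusAlgebra CompletedGroupAlgebra

/-! ### Functions on the group as functionals on its completed algebra -/

section Functional

variable {p d : ℕ} [Fact p.Prime] {F : Type*} [Group F] [TopologicalSpace F]
  [IsTopologicalGroup F] {x : Fin d → F} (hF : IsFreeProP p x) {G : Type*} [Group G]
  [TopologicalSpace G] [IsTopologicalGroup G] (hG : IsProP p G) {π : F →ₜ* G}

/-- The continuous functional on `Λ_G` with given values on `G`. -/
def IsProP.functional (f : C(G, ZMod p)) : CompletedGroupAlgebra p G →ₗ[ZMod p] ZMod p :=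
  (exists_linearMap_of_continuous hG f.continuous).choose

theorem IsProP.continuous_functional (f : C(G, ZMod p)) : Continuous (hG.functional f) :=
  (exists_linearMap_of_continuous hG f.continuous).choose_spec.1

theorem IsProP.functional_of (f : C(G, ZMod p)) (g : G) : hG.functional f (of p g) = f g :=
  (exists_linearMap_of_continuous hG f.continuous).choose_spec.2 g

theorem IsFreeProP.functional_toCompleted {f : C(G, ZMod p)}
    {L : MagnusAlgebra p d →ₗ[ZMod p] ZMod p} (hL : Continuous L)
    (h : ∀ y, f (π y) = L (hF.magnus y)) (c : MagnusAlgebra p d) :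
    hG.functional f (hF.toCompleted hG π c) = L c := by
  have : (hG.functional f).comp (hF.toCompleted hG π).toLinearMap = L :=
    hF.linearMap_ext_magnus
      ((hG.continuous_functional f).comp (hF.continuous_toCompleted hG π)) hL fun y => by
        simp only [LinearMap.comp_apply, AlgHom.toLinearMap_apply, hF.toCompleted_magnus,
          hG.functional_of, h]
  exact LinearMap.congr_fun this c

variable (hπ : Function.Surjective π)

include hF hG hπ

theorem IsFreeProP.completed_linearMap_ext {Y : Type*} [AddCommGroup Y] [Module (ZMod p) Y]
    [TopologicalSpace Y] [T2Space Y] {L L' : CompletedGroupAlgebra p G →ₗ[ZMod p] Y}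
    (hL : Continuous L) (hL' : Continuous L') (h : ∀ g, L (of p g) = L' (of p g)) : L = L' := by
  have h1 : L.comp (hF.toCompleted hG π).toLinearMap =
      L'.comp (hF.toCompleted hG π).toLinearMap :=
    hF.linearMap_ext_magnus (hL.comp (hF.continuous_toCompleted hG π))
      (hL'.comp (hF.continuous_toCompleted hG π)) fun y => by
        simp only [LinearMap.comp_apply, AlgHom.toLinearMap_apply, hF.toCompleted_magnus, h]
  refine LinearMap.ext fun z => ?_
  obtain ⟨c, rfl⟩ := hF.toCompleted_surjective hG π hπ z
  exact LinearMap.congr_fun h1 c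

theorem IsFreeProP.functional_add (f f' : C(G, ZMod p)) :
    hG.functional (f + f') = hG.functional f + hG.functional f' :=
  hF.completed_linearMap_ext hG hπ (hG.continuous_functional _)
    ((hG.continuous_functional f).add (hG.continuous_functional f')) fun g => by
      simp [hG.functional_of]

theorem IsFreeProP.functional_smul (r : ZMod p) (f : C(G, ZMod p)) :
    hG.functional (r • f) = r • hG.functional f :=
  hF.completed_linearMap_ext hG hπ (hG.continuous_functional _)
    ((hG.continuous_functional f).const_smul r) fun g => by
      simp [hG.functional_of]

theorem IsFreeProP.functional_translate (f f' : C(G, ZMod p)) (g : G) (h : ∀ u, f' u = f (g * u))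
    (z : CompletedGroupAlgebra p G) : hG.functional f' z = hG.functional f (of p g * z) := by
  have : hG.functional f' = (hG.functional f).comp (LinearMap.mulLeft (ZMod p) (of p g)) :=
    hF.completed_linearMap_ext hG hπ (hG.continuous_functional _)
      ((hG.continuous_functional f).comp (continuous_const_mul _)) fun u => by
        simp [hG.functional_of, h, ← of_mul]
  rw [this]
  rfl

/-- A continuous functional vanishing on the kernel of `E → Λ_G` comes from a function on `G`. -/
theorem IsFreeProP.exists_continuousMap {L : MagnusAlgebra p d →ₗ[ZMod p] ZMod p}
    (hL : Continuous L) (h0 : ∀ c, hF.toCompleted hG π c = 0 → L c = 0) :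
    ∃ f : C(G, ZMod p), ∀ y, f (π y) = L (hF.magnus y) := by
  let f : G → ZMod p := fun g => L (hF.magnus (Function.surjInv hπ g))
  have hf : ∀ y, f (π y) = L (hF.magnus y) := fun y => by
    rw [← sub_eq_zero, ← map_sub]
    refine h0 _ ?_
    rw [map_sub, hF.toCompleted_magnus, hF.toCompleted_magnus, Function.surjInv_eq hπ, sub_self]
  have := hF.compactSpace
  have := hG.t2Space
  refine ⟨⟨f, ?_⟩, hf⟩
  rw [(π.continuous_toFun.isClosedMap.isQuotientMap π.continuous_toFun hπ).continuous_iff]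
  exact Continuous.congr (hL.comp hF.continuous_magnus) fun y => (hf y).symm

end Functional

/-- The coordinate functions of a continuous function to `𝔽_p^d`. -/
def ContinuousMap.coordinate {p d : ℕ} {G : Type*} [TopologicalSpace G]
    (f : C(G, Fin d → ZMod p)) (j : Fin d) : C(G, ZMod p) :=
  ⟨fun g => f g j, (continuous_apply j).comp f.continuous⟩

/-! ### The dual of the resolution by generators and relators -/

namespace FreeRelators

variable {p d : ℕ} [Fact p.Prime] {I : Type*} (S : FreeRelators p d I)
  {F : Type*} [Group F] [TopologicalSpace F] [IsTopologicalGroup F] {x : Fin d → F}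
  (hF : IsFreeProP p x) {G : Type*} [Group G] [TopologicalSpace G] [IsTopologicalGroup G]
  (hG : IsProP p G) {π : F →ₜ* G}

/-- The discrete topology on the free module. -/
local instance : TopologicalSpace (I →₀ ZMod p) := ⊥

local instance : DiscreteTopology (I →₀ ZMod p) := ⟨rfl⟩

local instance : ContinuousSMul (ZMod p) (I →₀ ZMod p) := ⟨continuous_of_discreteTopology⟩

/-- The map `C(G, 𝔽_p) → C(G, 𝔽_p^d)` with components `f ↦ f(g π(x_j)) - f(g)`. -/
def generatorMap (x : Fin d → F) (π : F →ₜ* G) : C(G, ZMod p) →ₗ[ZMod p] C(G, Fin d → ZMod p) where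
  toFun f := ⟨fun g j => f (g * π (x j)) - f g, by fun_prop⟩
  map_add' f f' := by
    ext g j
    simp
    ring
  map_smul' r f := by
    ext g j
    simp [mul_sub]

omit [IsTopologicalGroup F] in
theorem generatorMap_apply (f : C(G, ZMod p)) (g : G) (j : Fin d) :
    generatorMap x π f g j = f (g * π (x j)) - f g := rfl

include hF in
-- The elements y for which right translation by π(y) fixes `f` form a closed subgroup containing
-- the generators.
theorem eq_of_generatorMap_eq_zero (hπ : Function.Surjective π) {f : C(G, ZMod p)}
    (hf : generatorMap x π f = 0) (g : G) : f g = f 1 := by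
  have h1 : ∀ g j, f (g * π (x j)) = f g := fun g j =>
    sub_eq_zero.1 (congrFun (DFunLike.congr_fun hf g) j)
  let H : Subgroup F :=
    { carrier := {y | ∀ g, f (g * π y) = f g}
      one_mem' := by simp
      mul_mem' := fun {y z} hy hz g => by rw [map_mul π, ← mul_assoc, hz, hy]
      inv_mem' := fun {y} hy g => by rw [← hy, map_inv π, inv_mul_cancel_right] }
  have hH : IsClosed (H : Set F) := by
    have : (H : Set F) = ⋂ g, {y | f (g * π y) = f g} := by
      ext y
      simp [H]
    rw [this]
    refine isClosed_iInter fun g => isClosed_eq ?_ continuous_const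
    exact f.continuous.comp (continuous_const.mul π.continuous_toFun)
  have hT := hF.eq_top_of_isClosed hH fun j g => h1 g j
  obtain ⟨y, rfl⟩ := hπ g
  have : y ∈ H := hT ▸ Subgroup.mem_top y
  simpa using this 1

/-- The functional `a ↦ ∑ f_j(∂_j a)` attached to a function `f` with values in `𝔽_p^d`. -/
def potential (π : F →ₜ* G) (f : C(G, Fin d → ZMod p)) : MagnusAlgebra p d →ₗ[ZMod p] ZMod p :=
  ∑ j, ((hG.functional (f.coordinate j)).comp (hF.toCompleted hG π).toLinearMap).comp (deriv j)

theorem potential_apply (f : C(G, Fin d → ZMod p)) (a : MagnusAlgebra p d) :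
    potential hF hG π f a =
      ∑ j, hG.functional (f.coordinate j) (hF.toCompleted hG π (deriv j a)) := by
  simp [potential]

theorem continuous_potential (f : C(G, Fin d → ZMod p)) : Continuous (potential hF hG π f) := by
  refine Continuous.congr (continuous_finsetSum _ fun j _ => ?_)
    fun a => (potential_apply hF hG f a).symm
  exact (hG.continuous_functional _).comp
    ((hF.continuous_toCompleted hG π).comp (continuous_deriv j))

/-- The potential is an antiderivative of `f`: its increments along the generators are the
components f_j. -/
theorem potential_mul_X (f : C(G, Fin d → ZMod p)) (a : MagnusAlgebra p d) (j : Fin d) :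
    potential hF hG π f (a * X j) = hG.functional (f.coordinate j) (hF.toCompleted hG π a) := by
  rw [potential_apply, Finset.sum_eq_single_of_mem j (Finset.mem_univ j)]
  · rw [deriv_mul_X, if_pos rfl]
  · intro k _ hk
    rw [deriv_mul_X, if_neg hk, map_zero, map_zero]

theorem potential_mul_rel (f : C(G, Fin d → ZMod p)) (a : MagnusAlgebra p d) (i : I) :
    potential hF hG π f (a * S.rel i) = ∑ j, hG.functional (f.coordinate j)
      (hF.toCompleted hG π a * hF.toCompleted hG π (deriv j (S.rel i))) := by
  simp only [potential_apply, deriv_mul _ a (S.rel_nil i), map_mul]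

/-- The value at `g` of the map given by the Jacobian of the relators, on the component `i`. -/
def jacobianCoeff (π : F →ₜ* G) (f : C(G, Fin d → ZMod p)) (g : G) (i : I) : ZMod p :=
  ∑ j, hG.functional (f.coordinate j) (of p g * hF.toCompleted hG π (deriv j (S.rel i)))

theorem jacobianCoeff_apply (f : C(G, Fin d → ZMod p)) (y : F) (i : I) :
    S.jacobianCoeff hF hG π f (π y) i = potential hF hG π f (hF.magnus y * S.rel i) := by
  rw [potential_mul_rel, hF.toCompleted_magnus]
  rfl

section

variable (hπ : Function.Surjective π)

include hπ

/-- The potential kills some E_n, and φ(y) f_i lies in E_n when f_i has large degree. So the values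
are finitely supported, with a support uniform in g. -/
theorem finite_jacobianCoeff (f : C(G, Fin d → ZMod p)) :
    {i | ∃ g, S.jacobianCoeff hF hG π f g i ≠ 0}.Finite := by
  obtain ⟨n, hn⟩ := exists_filtration_le_ker (continuous_potential hF hG (π := π) f)
  refine (S.finite_length_lead_le n).subset ?_
  rintro i ⟨g, hg⟩
  by_contra hi
  obtain ⟨y, rfl⟩ := hπ g
  rw [jacobianCoeff_apply] at hg
  refine hg (hn _ ?_)
  have h0 : hF.magnus y ∈ filtration p d 0 := mem_filtration.2 fun w hw => absurd hw (by simp)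
  have := mul_mem_filtration h0 (S.rel_mem_filtration (not_le.1 hi).le)
  rwa [zero_add] at this

theorem continuous_jacobianCoeff (f : C(G, Fin d → ZMod p)) (i : I) :
    Continuous fun g => S.jacobianCoeff hF hG π f g i := by
  have := hF.compactSpace
  have := hG.t2Space
  rw [(π.continuous_toFun.isClosedMap.isQuotientMap π.continuous_toFun hπ).continuous_iff]
  refine Continuous.congr ?_ fun y => (S.jacobianCoeff_apply hF hG f y i).symm
  exact (continuous_potential hF hG f).comp (hF.continuous_magnus.mul continuous_const)

end

/-- The value at `g` of the map given by the Jacobian of the relators. -/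
def jacobian (hπ : Function.Surjective π) (f : C(G, Fin d → ZMod p)) (g : G) : I →₀ ZMod p :=
  Finsupp.ofSupportFinite (S.jacobianCoeff hF hG π f g)
    ((S.finite_jacobianCoeff hF hG hπ f).subset fun _ hi => ⟨g, hi⟩)

theorem jacobian_apply (hπ : Function.Surjective π) (f : C(G, Fin d → ZMod p)) (g : G) (i : I) :
    S.jacobian hF hG hπ f g i = S.jacobianCoeff hF hG π f g i := rfl

theorem continuous_jacobian (hπ : Function.Surjective π) (f : C(G, Fin d → ZMod p)) :
    Continuous (S.jacobian hF hG hπ f) := by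
  classical
  let s := (S.finite_jacobianCoeff hF hG hπ f).toFinset
  have h : ∀ g, ∑ i ∈ s, Finsupp.single i (S.jacobianCoeff hF hG π f g i) =
      S.jacobian hF hG hπ f g := by
    intro g
    ext k
    rw [Finsupp.finsetSum_apply, jacobian_apply]
    simp only [Finsupp.single_apply, Finset.sum_ite_eq']
    split_ifs with hk
    · rfl
    · by_contra h0
      exact hk ((Set.Finite.mem_toFinset _).2 ⟨g, fun h1 => h0 h1.symm⟩)
  refine Continuous.congr (continuous_finsetSum _ fun i _ => ?_) h
  exact (continuous_of_discreteTopology (f := Finsupp.single (M := ZMod p) i)).comp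
    (S.continuous_jacobianCoeff hF hG hπ f i)

/-- The map `C(G, 𝔽_p^d) → C(G, 𝔽_p^{(I)})` given by the Jacobian of the relators. -/
def relatorMap (hπ : Function.Surjective π) :
    C(G, Fin d → ZMod p) →ₗ[ZMod p] C(G, I →₀ ZMod p) where
  toFun f := ⟨S.jacobian hF hG hπ f, S.continuous_jacobian hF hG hπ f⟩
  map_add' f f' := by
    ext g i
    have h : ∀ j, (f + f').coordinate j = f.coordinate j + f'.coordinate j := fun _ => rfl
    simp only [ContinuousMap.add_apply, Finsupp.add_apply, ContinuousMap.coe_mk, jacobian_apply,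
      jacobianCoeff, h, hF.functional_add hG hπ, LinearMap.add_apply, Finset.sum_add_distrib]
  map_smul' r f := by
    ext g i
    have h : ∀ j, (r • f).coordinate j = r • f.coordinate j := fun _ => rfl
    simp only [ContinuousMap.smul_apply, Finsupp.smul_apply, ContinuousMap.coe_mk, jacobian_apply,
      jacobianCoeff, h, hF.functional_smul hG hπ, LinearMap.smul_apply, Finset.smul_sum,
      RingHom.id_apply]

variable (hπ : Function.Surjective π)

theorem relatorMap_apply (f : C(G, Fin d → ZMod p)) (y : F) (i : I) :
    S.relatorMap hF hG hπ f (π y) i = potential hF hG π f (hF.magnus y * S.rel i) :=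
  S.jacobianCoeff_apply hF hG f y i

theorem relatorMap_translate (f f' : C(G, Fin d → ZMod p)) (g : G) (h : ∀ u, f' u = f (g * u))
    (u : G) : S.relatorMap hF hG hπ f' u = S.relatorMap hF hG hπ f (g * u) := by
  ext i
  change ∑ j, hG.functional (f'.coordinate j) (of p u * _) =
    ∑ j, hG.functional (f.coordinate j) (of p (g * u) * _)
  refine Finset.sum_congr rfl fun j _ => ?_
  rw [hF.functional_translate hG hπ (f.coordinate j) (f'.coordinate j) g
    (fun v => congrFun (h v) j), of_mul, mul_assoc]

variable (hker : ∀ c, hF.toCompleted hG π c = 0 ↔ c ∈ S.ideal)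

include hker

/-- By f_i = ∑ (∂_j f_i) X_j, the composite evaluates `f` on φ(y) f_i, which is zero in Λ_G. -/
theorem relatorMap_generatorMap (f : C(G, ZMod p)) :
    S.relatorMap hF hG hπ (generatorMap x π f) = 0 := by
  ext g i
  obtain ⟨y, rfl⟩ := hπ g
  rw [relatorMap_apply]
  have h : ∀ (j : Fin d) (c : MagnusAlgebra p d),
      hG.functional ((generatorMap x π f).coordinate j) (hF.toCompleted hG π c) =
        hG.functional f (hF.toCompleted hG π (c * X j)) := by
    intro j c
    refine hF.functional_toCompleted hG (L := ((hG.functional f).comp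
      (hF.toCompleted hG π).toLinearMap).comp (LinearMap.mulRight (ZMod p) (X j))) ?_ ?_ c
    · exact (hG.continuous_functional f).comp
        ((hF.continuous_toCompleted hG π).comp (continuous_mul_const _))
    · intro z
      have h1 : hF.magnus z * X j = hF.magnus (z * x j) - hF.magnus z := by
        rw [map_mul, hF.magnus_generator, mul_add, mul_one, add_sub_cancel_left]
      simp only [LinearMap.comp_apply, LinearMap.mulRight_apply, AlgHom.toLinearMap_apply, h1,
        map_sub, hF.toCompleted_magnus, hG.functional_of, map_mul π]
      rfl
  rw [potential_apply]
  simp only [h]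
  rw [← map_sum, ← map_sum, ← eq_sum_deriv_mul_X (by rw [mul_nil, S.rel_nil, mul_zero]),
    (hker _).2 (S.mul_rel_mem_ideal _ i), map_zero]
  rfl

/-- The potential always kills JM, by `potential_mul_X`. Vanishing of the relator map says that it
also kills E f_i, and together these span J topologically. -/
theorem potential_eq_zero_of_mem {f : C(G, Fin d → ZMod p)} (hf : S.relatorMap hF hG hπ f = 0)
    {a : MagnusAlgebra p d} (ha : a ∈ S.ideal) : potential hF hG π f a = 0 := by
  have h1 : ∀ a i, potential hF hG π f (a * S.rel i) = 0 := by
    intro a i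
    have : (potential hF hG π f).comp (LinearMap.mulRight (ZMod p) (S.rel i)) = 0 :=
      hF.linearMap_ext_magnus ((continuous_potential hF hG f).comp (continuous_mul_const _))
        continuous_const fun y => by
          rw [LinearMap.comp_apply, LinearMap.mulRight_apply, ← S.relatorMap_apply hF hG hπ, hf]
          rfl
    exact LinearMap.congr_fun this a
  refine (Submodule.mem_bot (ZMod p)).1 (S.map_mem_of_mem_ideal (potential hF hG π f)
    (continuous_potential hF hG f) ⊥ (isClosed_discrete _) (fun u _ i v => ?_) ha)
  rw [Submodule.mem_bot]
  rcases List.eq_nil_or_concat v with rfl | ⟨v, j, rfl⟩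
  · rw [monomial_nil, mul_one, h1]
  · rw [List.concat_eq_append, ← monomial_mul_X, ← mul_assoc, potential_mul_X, (hker _).2
      (S.mul_mem_ideal_right (S.mul_rel_mem_ideal _ i) _), map_zero]

/-- The potential now vanishes on the kernel of E → Λ_G, so it comes from a function on G, which is
the required primitive. -/
theorem exists_generatorMap_eq {f : C(G, Fin d → ZMod p)} (hf : S.relatorMap hF hG hπ f = 0) :
    ∃ f₀, generatorMap x π f₀ = f := by
  obtain ⟨f₀, h⟩ := hF.exists_continuousMap hG hπ (continuous_potential hF hG f)
    fun c hc => S.potential_eq_zero_of_mem hF hG hπ hker hf ((hker c).1 hc)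
  refine ⟨f₀, ?_⟩
  ext g j
  obtain ⟨y, rfl⟩ := hπ g
  rw [generatorMap_apply, ← map_mul π, h, h, ← map_sub, map_mul, hF.magnus_generator, mul_add,
    mul_one, add_sub_cancel_left, potential_mul_X, hF.toCompleted_magnus, hG.functional_of]
  rfl

/-- Here the freeness of J/JM enters. The coefficients define a functional `T` with T(φ(y) f_i) =
h_i(π(y)). It kills JM, so y ↦ T(φ(y) X_j) descends to G and gives the components of a preimage. -/
theorem relatorMap_surjective : Function.Surjective (S.relatorMap hF hG hπ) := by
  classical
  intro h
  have := hG.compactSpace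
  -- By compactness `h` has finitely many values, each finitely supported, so only finitely many
  -- relators matter.
  have hfin : (Set.range h).Finite := (isCompact_range h.continuous).finite_of_discrete
  let s : Finset I := hfin.toFinset.biUnion Finsupp.support
  have hs : ∀ i ∉ s, ∀ g, h g i = 0 := by
    intro i hi g
    by_contra h0
    exact hi (Finset.mem_biUnion.2 ⟨h g, (Set.Finite.mem_toFinset _).2 ⟨g, rfl⟩,
      Finsupp.mem_support_iff.2 h0⟩)
  let hc (i : I) : C(G, ZMod p) := ⟨fun g => h g i,
    (continuous_of_discreteTopology (f := fun v : I →₀ ZMod p => v i)).comp h.continuous⟩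
  let T : MagnusAlgebra p d →ₗ[ZMod p] ZMod p :=
    ∑ i ∈ s, (hG.functional (hc i)).comp (S.completedCoeff hF hG π i)
  have hT : ∀ c, T c = ∑ i ∈ s, hG.functional (hc i) (S.completedCoeff hF hG π i c) := by
    simp [T]
  have hTc : Continuous T := by
    refine Continuous.congr (continuous_finsetSum s fun i _ => ?_) fun c => (hT c).symm
    exact (hG.continuous_functional (hc i)).comp (S.continuous_completedCoeff hF hG i)
  have hf : ∀ j : Fin d, ∃ f : C(G, ZMod p), ∀ y, f (π y) = T (hF.magnus y * X j) := by
    intro j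
    refine hF.exists_continuousMap hG hπ (L := T.comp (LinearMap.mulRight (ZMod p) (X j)))
      (hTc.comp (continuous_mul_const _)) fun c hc0 => ?_
    rw [LinearMap.comp_apply, LinearMap.mulRight_apply, hT]
    refine Finset.sum_eq_zero fun i _ => ?_
    rw [S.completedCoeff_mul_of_mem hF hG ((hker c).1 hc0) (by simp [X, monomial]), map_zero]
  choose f hf using hf
  have hf' : ∀ j c, hG.functional (f j) (hF.toCompleted hG π c) = T (c * X j) := fun j c =>
    hF.functional_toCompleted hG (L := T.comp (LinearMap.mulRight (ZMod p) (X j)))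
      (hTc.comp (continuous_mul_const _)) (hf j) c
  refine ⟨⟨fun g j => f j g, continuous_pi fun j => (f j).continuous⟩, ?_⟩
  ext g i
  obtain ⟨y, rfl⟩ := hπ g
  rw [relatorMap_apply, potential_apply]
  have h1 : ∀ j, (⟨fun g j => f j g, continuous_pi fun j => (f j).continuous⟩ :
    C(G, Fin d → ZMod p)).coordinate j = f j := fun _ => rfl
  simp only [h1, hf']
  rw [← map_sum, ← eq_sum_deriv_mul_X (by rw [mul_nil, S.rel_nil, mul_zero]), hT]
  simp only [S.completedCoeff_mul_rel hF hG hker]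
  by_cases hi : i ∈ s
  · rw [Finset.sum_eq_single_of_mem i hi, if_pos rfl, hF.toCompleted_magnus, hG.functional_of]
    · rfl
    · intro k _ hk
      rw [if_neg hk, map_zero]
  · rw [hs i hi, Finset.sum_eq_zero]
    intro k hk
    rw [if_neg (by rintro rfl; exact hi hk), map_zero]

end FreeRelators

/-! ### Translation-equivariant maps between coinduced representations -/

section

open TopRep

variable {k : Type*} {G : Type*} [Ring k] [TopologicalSpace k] [Group G] [TopologicalSpace G]

instance isSmooth_trivial (V : Type*) [AddCommGroup V] [Module k V] [TopologicalSpace V]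
    [IsTopologicalAddGroup V] [ContinuousSMul k V] [hV : DiscreteTopology V] :
    (TopRep.of (ContRepresentation.trivial k G V)).IsSmooth where
  discreteTopology := hV
  continuous_orbit _ := continuous_const

variable [IsTopologicalGroup G] [CompactSpace G]

/-- A linear map commuting with left translations, as a morphism of coinduced representations. -/
def TopRep.ofTranslation {V W : Type} [AddCommGroup V] [Module k V] [TopologicalSpace V]
    [IsTopologicalAddGroup V] [ContinuousSMul k V] [DiscreteTopology V] [AddCommGroup W]
    [Module k W] [TopologicalSpace W] [IsTopologicalAddGroup W] [ContinuousSMul k W]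
    (T : C(G, V) →ₗ[k] C(G, W))
    (hT : ∀ (f f' : C(G, V)) (g : G), (∀ u, f' u = f (g * u)) → ∀ u, T f' u = T f (g * u)) :
    (TopRep.of (ContRepresentation.trivial k G V)).coind₁ ⟶
      (TopRep.of (ContRepresentation.trivial k G W)).coind₁ :=
  TopRep.ofHom
    { toLinearMap := T
      cont := by
        have : DiscreteTopology C(G, V) := ContinuousMap.discreteTopology_of_compactSpace
        exact continuous_of_discreteTopology
      isIntertwining' := fun g => ContinuousLinearMap.ext fun f => ContinuousMap.ext fun u =>
        hT f _ g⁻¹ (fun _ => rfl) u }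

end

/-! ### The bound on the cohomological dimension -/

namespace FreeRelators

local instance {p : ℕ} {I : Type*} : TopologicalSpace (I →₀ ZMod p) := ⊥

local instance {p : ℕ} {I : Type*} : DiscreteTopology (I →₀ ZMod p) := ⟨rfl⟩

local instance {p : ℕ} {I : Type*} : ContinuousSMul (ZMod p) (I →₀ ZMod p) :=
  ⟨continuous_of_discreteTopology⟩

/-- The constants, the generator map and the relator map form a resolution of 𝔽_p by three coinduced
modules. The index set is in `Type` because the acyclicity statement takes coefficient modules
there. -/
theorem cohomologicalDimension_le_two {p d : ℕ} [Fact p.Prime] {I : Type}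
    (S : FreeRelators p d I) {F : Type*} [Group F] [TopologicalSpace F] [IsTopologicalGroup F]
    {x : Fin d → F} (hF : IsFreeProP p x) {G : Type*} [Group G] [TopologicalSpace G]
    [IsTopologicalGroup G] (hG : IsProP p G) {π : F →ₜ* G} (hπ : Function.Surjective π)
    (hker : ∀ c, hF.toCompleted hG π c = 0 ↔ c ∈ S.ideal) : cohomologicalDimension p G ≤ 2 := by
  have := hG.compactSpace
  refine _root_.cohomologicalDimension_le_two fun n => ?_
  let a : TopRep.of (ContRepresentation.trivial (ZMod p) G (ULift (ZMod p))) ⟶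
      (TopRep.of (ContRepresentation.trivial (ZMod p) G (ZMod p))).coind₁ :=
    TopRep.ofHom
      { toFun := fun r => ContinuousMap.const G r.down
        map_add' := fun _ _ => rfl
        map_smul' := fun _ _ => rfl
        cont := continuous_of_discreteTopology
        isIntertwining' := fun _ => rfl }
  let b := TopRep.ofTranslation (generatorMap (p := p) x π) (by
    intro f f' g h u
    funext j
    rw [generatorMap_apply, generatorMap_apply, h, h, mul_assoc])
  let c := TopRep.ofTranslation (S.relatorMap hF hG hπ) (S.relatorMap_translate hF hG hπ)
  have := TopRep.isSmooth_coind₁ (TopRep.of (ContRepresentation.trivial (ZMod p) G (ZMod p)))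
  have := TopRep.isSmooth_coind₁
    (TopRep.of (ContRepresentation.trivial (ZMod p) G (Fin d → ZMod p)))
  have := TopRep.isSmooth_coind₁
    (TopRep.of (ContRepresentation.trivial (ZMod p) G (I →₀ ZMod p)))
  refine TopRep.cochainExact_of_exact (TopRep.cochainExact_coind₁ _)
    (TopRep.cochainExact_coind₁ _) (TopRep.cochainExact_coind₁ _) (a := a) (b := b) (c := c)
    ?_ ?_ ?_ ?_ ?_ ?_ n
  · intro r s h
    exact ULift.down_injective (DFunLike.congr_fun (F := C(G, ZMod p)) h 1)
  · intro r
    refine ContinuousMap.ext fun g => funext fun j => sub_self r.down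
  · intro f hf
    exact ⟨⟨(f : C(G, ZMod p)) 1⟩, ContinuousMap.ext fun g =>
      (eq_of_generatorMap_eq_zero hF hπ hf g).symm⟩
  · exact S.relatorMap_generatorMap hF hG hπ hker
  · exact fun f hf => S.exists_generatorMap_eq hF hG hπ hker hf
  · exact S.relatorMap_surjective hF hG hπ hker

end FreeRelators

end

/-! ### The main theorem -/

/-- The relators `ρ_i - 1` of a presentation whose highest terms are combinatorially free. -/
noncomputable def IsFreeProP.freeRelators {p d : ℕ} [Fact p.Prime] {F : Type*} [Group F] [TopologicalSpace F]
    [IsTopologicalGroup F] {x : Fin d → F} (hF : IsFreeProP p x) {I : Type*} {ρ : I → F}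
    {α : I → List (Fin d)} (hα : ∀ i, (hF.magnus (ρ i) - 1).IsHighestTerm (α i))
    (hfree : CombinatoriallyFree α) : FreeRelators p d I where
  lead := α
  rel i := hF.magnus (ρ i) - 1
  isHighestTerm := hα
  lead_ne_nil i h := (hα i).1 (h ▸ FreeRelators.magnus_sub_one_nil hF (ρ i))
  free := hfree

theorem mainTheorem2 {p : ℕ} [Fact p.Prime] {d : ℕ}
    {F : Type*} [Group F] [TopologicalSpace F] [IsTopologicalGroup F]
    {G : Type*} [Group G] [TopologicalSpace G] [IsTopologicalGroup G]
    (hG : IsProP p G)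
    -- a minimal presentation `1 → R → F → G → 1`, with `R = ker π`
    (x : Fin d → F) (hF : IsFreeProP p x)
    (π : F →ₜ* G) (hπ : Function.Surjective π) (hd : d = pRank p G)
    -- a family of topological generators of the `Λ_G`-module `R / R^p[R,R]`
    {I : Type*} (ρ : I → (π : F →* G).ker)
    (hρ : Dense (AddSubgroup.closure
      {m | ∃ (y : F) (i : I), m = RelationModule.mk p (MulAut.conjNormal y (ρ i))} :
        Set (RelationModule p (π : F →* G).ker)))
    -- the highest terms of the relations
    (α : I → List (Fin d))
    (hα : ∀ i, (hF.magnus (ρ i) - 1).IsHighestTerm (α i))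
    (hfree : CombinatoriallyFree α) :
    -- `R / R^p[R,R] ≃ ∏_I Λ_G` as topological `Λ_G`-modules, where `Λ_G` acts through the
    -- continuous extension of the conjugation action of `G`
    (∃ _ : Module (CompletedGroupAlgebra p G) (RelationModule p (π : F →* G).ker),
      (Continuous fun c : CompletedGroupAlgebra p G × RelationModule p (π : F →* G).ker =>
        c.1 • c.2) ∧
      (∀ (y : F) (r : (π : F →* G).ker),
        CompletedGroupAlgebra.of p (π y) • RelationModule.mk p r =
          RelationModule.mk p (MulAut.conjNormal y r)) ∧
      Nonempty (RelationModule p (π : F →* G).ker ≃L[CompletedGroupAlgebra p G]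
        (I → CompletedGroupAlgebra p G))) ∧
    cohomologicalDimension p G ≤ 2 ∧
    -- the Poincaré series is the inverse of `1 - d t + ∑_i t ^ deg ρ_i`
    (∀ n, Module.Finite (ZMod p) (gradedPiece hF π n)) ∧
    (∀ n : ℕ, {i | hF.degree (ρ i) = n}.Finite) ∧
    poincareSeries hF π * (1 - PowerSeries.C (d : ℤ) * PowerSeries.X +
      PowerSeries.mk fun n : ℕ => ({i | hF.degree (ρ i) = n}.ncard : ℤ)) = 1 := by
  let S : FreeRelators p d I := hF.freeRelators hα hfree
  have hker : ∀ c, hF.toCompleted hG π c = 0 ↔ c ∈ S.ideal := fun c =>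
    S.toCompleted_eq_zero_iff hF hG hπ (fun _ => rfl) hρ
  have hmem : ∀ r ∈ (π : F →* G).ker, hF.magnus r - 1 ∈ S.ideal := fun r hr =>
    S.magnus_sub_one_mem_ideal hF (fun _ => rfl) hρ hr
  have hdeg : ∀ n : ℕ, {i | hF.degree (ρ i) = n} = {i | (α i).length = n} := fun n => by
    ext i
    rw [Set.mem_ofPred_eq, Set.mem_ofPred_eq, IsFreeProP.degree, (hα i).valuation_eq, Nat.cast_inj]
  refine ⟨S.exists_module_continuousLinearEquiv hF hG hmem hker (fun _ => rfl) hπ hρ, ?_,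
    S.finite_gradedPiece hF hG π hker, fun n => ?_, ?_⟩
  -- The relators are reindexed by their highest terms, which are distinct, so that the index set
  -- lies in `Type`.
  · let e : I ≃ Set.range α := Equiv.ofInjective α hfree.injective
    have hα' : ∀ j, (hF.magnus (ρ (e.symm j)) - 1).IsHighestTerm (j : List (Fin d)) := fun j => by
      have := hα (e.symm j)
      rwa [Equiv.apply_ofInjective_symm hfree.injective j] at this
    have hfree' : CombinatoriallyFree fun j : Set.range α => (j : List (Fin d)) := by
      refine ⟨?_, ?_⟩
      · rintro ⟨_, i, rfl⟩ ⟨_, j, rfl⟩ hij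
        exact hfree.1 i j fun h => hij (by rw [h])
      · rintro ⟨_, i, rfl⟩ ⟨_, j, rfl⟩
        exact hfree.2 i j
    refine (hF.freeRelators hα' hfree').cohomologicalDimension_le_two hF hG hπ fun c =>
      (hF.freeRelators hα' hfree').toCompleted_eq_zero_iff hF hG hπ (ρ := fun j => ρ (e.symm j))
        (fun _ => rfl) ?_
    convert hρ using 6
    exact funext fun y => propext ⟨fun ⟨j, h⟩ => ⟨e.symm j, h⟩,
      fun ⟨i, h⟩ => ⟨e i, by rwa [e.symm_apply_apply]⟩⟩
  · rw [hdeg]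
    exact hfree.finite_length_eq n
  · simp only [hdeg]
    exact S.poincareSeries_mul hF hG π hker
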